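/- **Setting.** A *quantum model* is a quintuple $(\rho,A_1,A_2,B_1,B_2)$ of bounded operators on a separable complex Hilbert space $\mathcal H$, where $\rho\ge 0$ has $\mathrm{tr}\,\rho=1$, the $A_i,B_j$ are Hermitian with $-1\le A_i,B_j\le 1$, and $[A_i,B_j]=0$ for $i,j=1,2$. It is a model for the correlation $c=(c_{ij})\in\mathbb R^{4}$ if $c_{ij}=\mathrm{tr}(\rho A_iB_j)$ for all $i,j$, and a model for the behavior $p=(a_1,a_2,b_1,b_2,c)\in\mathbb R^8$ if moreover $a_i=\mathrm{tr}(\rho A_i)$ and $b_j=\mathrm{tr}(\rho B_j)$. Let $\mathcal Q\subset\mathbb R^4$ be the set of all correlations that have a quantum model and $\mathcal P\subset\mathbb R^8$ the set of all behaviors that have one; $p\in\mathcal P$ is an *extension* of $c$ if its correlation part is $c$. A correlation is *classical* if $c_{ij}=\langle A_iB_j\rangle$ for some $\pm1$-valued random variables $A_1,A_2,B_1,B_2$ on a common probability space. For a model let $\mathcal A$ be the norm closed unital operator algebra generated by the $A_i,B_j$. The model is *cyclic* if $\rho=|\Psi\rangle\langle\Psi|$ with a unit vector $\Psi$ such that $\mathcal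 A\Psi$ is dense in $\mathcal H$. Two models are *unitarily equivalent* if a unitary between their Hilbert spaces intertwines $\rho$, the $A_i$ and the $B_j$. **Explicit model.** Let $M(\tau)=\begin{pmatrix}\cos\tau&\sin\tau\\ \sin\tau&-\cos\tau\end{pmatrix}$. Suppose $c=(c_{11},c_{12},c_{21},c_{22})=(\cos\alpha,\cos\beta,\cos\gamma,\cos\delta)$ with $\alpha+\beta+\gamma+\delta\equiv0\pmod{2\pi}$. The explicit model for $c$ with these angles is, on $\hat{\mathcal H}=\mathbb C^2\otimes\mathbb C^2=\mathbb C^4$, $\hat\rho=|\hat\Psi\rangle\langle\hat\Psi|$ with $\hat\Psi=(0,\tfrac1{\sqrt2},-\tfrac1{\sqrt2},0)^T$, $\hat A_1=M(\alpha)\otimes 1$, $\hat A_2=M(-\gamma)\otimes 1$, $\hat B_1=1\otimes M(\pi)$, $\hat B_2=1\otimes M(\alpha+\beta+\pi)$. **Theorem (self-testing).** Let $c\in\mathcal Q$. The following are equivalent. 1. $c$ is not classical and is an extreme point of $\mathcal Q$. 2. There is a unique cyclic model for $c$: one exists, and any two are unitarily equivalent. Explicitly (and again equivalently): $c$ has angles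 $\alpha,\beta,\gamma,\delta$ as above, and for all such angles the explicit model is a cyclic model for $c$, and every cyclic model for $c$ is unitarily equivalent to it. 3. The model is unique up to unitary transformation, expansion and adding multiplicity: $c$ has angles as above, and for all such angles and every model $(\rho,A_i,B_j)$ for $c$ there are Hilbert spaces $\mathcal H_\nu,\mathcal H_0$, a density operator $\rho_\nu$ on $\mathcal H_\nu$ and bounded operators $A_i^0,B_j^0$ on $\mathcal H_0$ such that, up to a unitary, $\mathcal H=(\hat{\mathcal H}\otimes\mathcal H_\nu)\oplus\mathcal H_0$, $\rho=(\hat\rho\otimes\rho_\nu)\oplus0$, $A_i=(\hat A_i\otimes 1)\oplus A_i^0$, $B_j=(\hat B_j\otimes 1)\oplus B_j^0$. 4. $c$ has a unique extension $p\in\mathcal P$. 5. $c$ is cryptographically secure: it has a unique extension $p\in\mathcal P$, and $p$ is cryptographically secure, i.e. for every model for $p$ and every effect $0\le E\le1$ commuting with $\mathcal A$ one has $\mathrm{tr}(\rho EX)=\mathrm{tr}(\rho E)\,\mathrm{tr}(\rho X)$ for all $X\in\{A_i,\,B_j,\,A_iB_j : i,j=1,2\}$. Equivalently, every extension $p\in\mathcal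 P$ of $c$ is cryptographically secure. 6. $c$ is algebraically secure: for every model for $c$, $\mathrm{tr}(\rho EX)=\mathrm{tr}(\rho E)\,\mathrm{tr}(\rho X)$ for all $X\in\mathcal A$ and all bounded $E$ commuting with $\mathcal A$. Moreover, whenever $c$ has a unique extension $p\in\mathcal P$, this $p$ is an extreme point of $\mathcal P$. -/

import Mathlib

open scoped TensorProduct

namespace QuantumCorrelation

noncomputable section

/-- Points `c = (c 0 0, c 0 1, c 1 0, c 1 1)` of the 4-dimensional correlation space. -/
abbrev Correlation : Type := Fin 2 → Fin 2 → ℝ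

/-- Points of the 8-dimensional behaviour space: the two marginals of Alice, the two marginals of
Bob, and the four correlations. -/
abbrev Behavior : Type := (Fin 2 → ℝ) × (Fin 2 → ℝ) × Correlation

section Operators

variable {H : Type} [NormedAddCommGroup H] [InnerProductSpace ℂ H] [CompleteSpace H]

/-- The trace `∑ i, ⟨e i, T (e i)⟩` over a Hilbert basis of `H`. It is used only for trace class
operators (products of a density operator with bounded operators), for which the sum converges
absolutely and does not depend on the basis. -/
def opTrace (T : H →L[ℂ] H) : ℂ :=
  ∑' i, inner ℂ ((exists_hilbertBasis ℂ H).choose_spec.choose i)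
    (T ((exists_hilbertBasis ℂ H).choose_spec.choose i))

/-- A density operator: a positive operator of trace one. -/
def IsDensityOperator (ρ : H →L[ℂ] H) : Prop :=
  ρ.IsPositive ∧ opTrace ρ = 1

end Operators

/-- A quintuple `(ρ, A 0, A 1, B 0, B 1)` of bounded operators on `H`. -/
structure Quintuple (H : Type) [NormedAddCommGroup H] [InnerProductSpace ℂ H] where
  ρ : H →L[ℂ] H
  A : Fin 2 → H →L[ℂ] H
  B : Fin 2 → H →L[ℂ] H

namespace Quintuple

section Basic

variable {H : Type} [NormedAddCommGroup H] [InnerProductSpace ℂ H]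

/-- The norm closed (unital) operator algebra generated by the `A i` and the `B j`. As the
generators of a quantum model are self-adjoint, it is then a C*-algebra. -/
def alg (M : Quintuple H) : Subalgebra ℂ (H →L[ℂ] H) :=
  (Algebra.adjoin ℂ (Set.range M.A ∪ Set.range M.B)).topologicalClosure

/-- `E` commutes with the algebra generated by the `A i` and the `B j`. -/
def InCommutant (M : Quintuple H) (E : H →L[ℂ] H) : Prop :=
  ∀ X ∈ M.alg, E * X = X * E

/-- `ρ = |Ψ⟩⟨Ψ|` is pure, and its vector `Ψ` is cyclic for the generated algebra. -/
def IsCyclic (M : Quintuple H) : Prop :=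
  ∃ Ψ : H, ‖Ψ‖ = 1 ∧ M.ρ = InnerProductSpace.rankOne ℂ Ψ Ψ ∧
    Dense {φ : H | ∃ X ∈ M.alg, X Ψ = φ}

/-- Unitary equivalence of quintuples, possibly on different Hilbert spaces. -/
def UnitarilyEquivalent {K : Type} [NormedAddCommGroup K] [InnerProductSpace ℂ K]
    (M : Quintuple H) (N : Quintuple K) : Prop :=
  ∃ U : H ≃ₗᵢ[ℂ] K,
    (∀ φ, U (M.ρ φ) = N.ρ (U φ)) ∧
    (∀ i φ, U (M.A i φ) = N.A i (U φ)) ∧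
    (∀ j φ, U (M.B j φ) = N.B j (U φ))

end Basic

section Model

variable {H : Type} [NormedAddCommGroup H] [InnerProductSpace ℂ H] [CompleteSpace H]

/-- A quantum model: `ρ` is a density operator, the `A i`, `B j` are Hermitian with
`-1 ≤ A i, B j ≤ 1` in the operator order, and every `A i` commutes with every `B j`. -/
structure IsModel (M : Quintuple H) : Prop where
  density : IsDensityOperator M.ρ
  selfAdjoint_A : ∀ i, IsSelfAdjoint (M.A i)
  selfAdjoint_B : ∀ j, IsSelfAdjoint (M.B j)
  bounds_A : ∀ i, -1 ≤ M.A i ∧ M.A i ≤ 1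
  bounds_B : ∀ j, -1 ≤ M.B j ∧ M.B j ≤ 1
  commute : ∀ i j, M.A i * M.B j = M.B j * M.A i

/-- `M` is a quantum model for the correlation `c`. -/
def IsModelFor (M : Quintuple H) (c : Correlation) : Prop :=
  M.IsModel ∧ ∀ i j, opTrace (M.ρ * (M.A i * M.B j)) = (c i j : ℂ)

/-- `M` is a quantum model for the behaviour `p`. -/
def IsModelForBehavior (M : Quintuple H) (p : Behavior) : Prop :=
  M.IsModel ∧
    (∀ i, opTrace (M.ρ * M.A i) = (p.1 i : ℂ)) ∧
    (∀ j, opTrace (M.ρ * M.B j) = (p.2.1 j : ℂ)) ∧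
    (∀ i j, opTrace (M.ρ * (M.A i * M.B j)) = (p.2.2 i j : ℂ))

/-- The canonical form of `M` relative to a quintuple `N` on a finite dimensional space `K`: up to
a unitary, the Hilbert space is `(K ⊗ L) ⊕ H₀`, the state is `N.ρ ⊗ σ ⊕ 0` with a density operator
`σ` on `L`, and the observables are `N.A i ⊗ 1 ⊕ A₀ i` and `N.B j ⊗ 1 ⊕ B₀ j`.
(As `K` is finite dimensional, the algebraic tensor product is the Hilbert space one.) -/
def HasCanonicalForm {K : Type} [NormedAddCommGroup K] [InnerProductSpace ℂ K]
    [FiniteDimensional ℂ K] (M : Quintuple H) (N : Quintuple K) : Prop :=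
  ∃ (L : Type) (_ : NormedAddCommGroup L) (_ : InnerProductSpace ℂ L) (_ : CompleteSpace L)
    (_ : TopologicalSpace.SeparableSpace L)
    (H₀ : Type) (_ : NormedAddCommGroup H₀) (_ : InnerProductSpace ℂ H₀) (_ : CompleteSpace H₀)
    (_ : TopologicalSpace.SeparableSpace H₀)
    (σ : L →L[ℂ] L) (A₀ B₀ : Fin 2 → H₀ →L[ℂ] H₀)
    (U : H ≃ₗᵢ[ℂ] WithLp 2 ((K ⊗[ℂ] L) × H₀)),
    IsDensityOperator σ ∧
    (∀ φ, U (M.ρ φ) = WithLp.toLp 2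
      (TensorProduct.map (N.ρ : K →ₗ[ℂ] K) (σ : L →ₗ[ℂ] L) (U φ).fst, 0)) ∧
    (∀ i φ, U (M.A i φ) = WithLp.toLp 2
      (TensorProduct.map (N.A i : K →ₗ[ℂ] K) LinearMap.id (U φ).fst, A₀ i (U φ).snd)) ∧
    (∀ j φ, U (M.B j φ) = WithLp.toLp 2
      (TensorProduct.map (N.B j : K →ₗ[ℂ] K) LinearMap.id (U φ).fst, B₀ j (U φ).snd))

end Model

end Quintuple

/-- The body `𝒬` of quantum correlations: those realized by a quantum model in some separable
complex Hilbert space. -/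
def quantumSet : Set Correlation :=
  {c | ∃ (H : Type) (_ : NormedAddCommGroup H) (_ : InnerProductSpace ℂ H) (_ : CompleteSpace H)
    (_ : TopologicalSpace.SeparableSpace H) (M : Quintuple H), M.IsModelFor c}

/-- The 8-dimensional body of quantum behaviours (correlations together with marginals). -/
def behaviorSet : Set Behavior :=
  {p | ∃ (H : Type) (_ : NormedAddCommGroup H) (_ : InnerProductSpace ℂ H) (_ : CompleteSpace H)
    (_ : TopologicalSpace.SeparableSpace H) (M : Quintuple H), M.IsModelForBehavior p}

/-- The classical correlations: `c i j` is the expectation of `A i * B j` for `±1`-valued random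
variables on a common probability space. -/
def classicalSet : Set Correlation :=
  {c | ∃ (Ω : Type) (_ : MeasurableSpace Ω) (μ : MeasureTheory.Measure Ω)
    (A B : Fin 2 → Ω → ℝ),
    MeasureTheory.IsProbabilityMeasure μ ∧
    (∀ i, Measurable (A i)) ∧ (∀ j, Measurable (B j)) ∧
    (∀ i ω, A i ω = 1 ∨ A i ω = -1) ∧ (∀ j ω, B j ω = 1 ∨ B j ω = -1) ∧
    ∀ i j, c i j = ∫ ω, A i ω * B j ω ∂μ}

/-- `p` is a quantum behaviour extending the correlation `c`. -/
def IsExtension (p : Behavior) (c : Correlation) : Prop :=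
  p ∈ behaviorSet ∧ p.2.2 = c

/-- The Hilbert space `ℂ⁴` of the explicit two-qubit model. -/
abbrev TwoQubit : Type := EuclideanSpace ℂ (Fin 4)

/-- The singlet vector `(0, 1/√2, -1/√2, 0)`. -/
def singlet : TwoQubit :=
  !₂[0, ((1 / Real.sqrt 2 : ℝ) : ℂ), ((-(1 / Real.sqrt 2) : ℝ) : ℂ), 0]

/-- The real `4 × 4` matrix of `M(τ) ⊗ 1`, where `M(τ) = !![cos τ, sin τ; sin τ, -cos τ]`. -/
def reflLeft (τ : ℝ) : Matrix (Fin 4) (Fin 4) ℝ :=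
  !![Real.cos τ, 0, Real.sin τ, 0;
     0, Real.cos τ, 0, Real.sin τ;
     Real.sin τ, 0, -Real.cos τ, 0;
     0, Real.sin τ, 0, -Real.cos τ]

/-- The real `4 × 4` matrix of `1 ⊗ M(τ)`, where `M(τ) = !![cos τ, sin τ; sin τ, -cos τ]`. -/
def reflRight (τ : ℝ) : Matrix (Fin 4) (Fin 4) ℝ :=
  !![Real.cos τ, Real.sin τ, 0, 0;
     Real.sin τ, -Real.cos τ, 0, 0;
     0, 0, Real.cos τ, Real.sin τ;
     0, 0, Real.sin τ, -Real.cos τ]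

/-- The operator on `ℂ⁴` with a given real matrix. -/
def realOp (T : Matrix (Fin 4) (Fin 4) ℝ) : TwoQubit →L[ℂ] TwoQubit :=
  Matrix.toEuclideanCLM (n := Fin 4) (𝕜 := ℂ) (T.map Complex.ofReal)

/-- The explicit two-qubit model with angles `α, β, γ`: the singlet state,
`A₁ = M(α) ⊗ 1`, `A₂ = M(-γ) ⊗ 1`, `B₁ = 1 ⊗ M(π)`, `B₂ = 1 ⊗ M(α + β + π)`. -/
def explicitModel (α β γ : ℝ) : Quintuple TwoQubit where
  ρ := InnerProductSpace.rankOne ℂ singlet singlet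
  A := ![realOp (reflLeft α), realOp (reflLeft (-γ))]
  B := ![realOp (reflRight Real.pi), realOp (reflRight (α + β + Real.pi))]

/-- The cosine parametrization: `c = (cos α, cos β, cos γ, cos δ)` with
`α + β + γ + δ ≡ 0 mod 2π`. -/
def IsAngleParam (c : Correlation) (α β γ : ℝ) : Prop :=
  c 0 0 = Real.cos α ∧ c 0 1 = Real.cos β ∧ c 1 0 = Real.cos γ ∧
    ∃ δ : ℝ, c 1 1 = Real.cos δ ∧ ∃ k : ℤ, α + β + γ + δ = 2 * Real.pi * k

/-- `c` has a cyclic model, and any two cyclic models for `c` are unitarily equivalent. -/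
def HasUniqueCyclicModel (c : Correlation) : Prop :=
  (∃ (H : Type) (_ : NormedAddCommGroup H) (_ : InnerProductSpace ℂ H) (_ : CompleteSpace H)
    (_ : TopologicalSpace.SeparableSpace H) (M : Quintuple H), M.IsModelFor c ∧ M.IsCyclic) ∧
  ∀ (H : Type) [NormedAddCommGroup H] [InnerProductSpace ℂ H] [CompleteSpace H]
    [TopologicalSpace.SeparableSpace H]
    (K : Type) [NormedAddCommGroup K] [InnerProductSpace ℂ K] [CompleteSpace K]
    [TopologicalSpace.SeparableSpace K] (M : Quintuple H) (N : Quintuple K),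
    M.IsModelFor c → M.IsCyclic → N.IsModelFor c → N.IsCyclic → M.UnitarilyEquivalent N

/-- The explicit two-qubit model is applicable to `c`, and (for any choice of its angles) it is a
cyclic model for `c` to which every cyclic model for `c` is unitarily equivalent. -/
def ExplicitModelIsUniqueCyclic (c : Correlation) : Prop :=
  (∃ α β γ : ℝ, IsAngleParam c α β γ) ∧
  ∀ α β γ : ℝ, IsAngleParam c α β γ →
    (explicitModel α β γ).IsModelFor c ∧ (explicitModel α β γ).IsCyclic ∧
    ∀ (H : Type) [NormedAddCommGroup H] [InnerProductSpace ℂ H] [CompleteSpace H]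
      [TopologicalSpace.SeparableSpace H] (M : Quintuple H),
      M.IsModelFor c → M.IsCyclic → M.UnitarilyEquivalent (explicitModel α β γ)

/-- The explicit two-qubit model is applicable to `c`, and (for any choice of its angles) every
model for `c` arises from it by a unitary transformation, expansion and adding multiplicity. -/
def EveryModelIsCanonical (c : Correlation) : Prop :=
  (∃ α β γ : ℝ, IsAngleParam c α β γ) ∧
  ∀ α β γ : ℝ, IsAngleParam c α β γ →
    ∀ (H : Type) [NormedAddCommGroup H] [InnerProductSpace ℂ H] [CompleteSpace H]
      [TopologicalSpace.SeparableSpace H] (M : Quintuple H),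
      M.IsModelFor c → M.HasCanonicalForm (explicitModel α β γ)

/-- Cryptographic security of a behaviour `p`: in every quantum model for `p`, every outcome of an
eavesdropper's measurement (an effect `0 ≤ E ≤ 1` commuting with all `A i`, `B j`) is
statistically independent of the data measured by Alice and Bob, marginals included. -/
def IsCryptographicallySecure (p : Behavior) : Prop :=
  ∀ (H : Type) [NormedAddCommGroup H] [InnerProductSpace ℂ H] [CompleteSpace H]
    [TopologicalSpace.SeparableSpace H] (M : Quintuple H), M.IsModelForBehavior p →
    ∀ E : H →L[ℂ] H, 0 ≤ E → E ≤ 1 → M.InCommutant E →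
      (∀ i, opTrace (M.ρ * (E * M.A i)) = opTrace (M.ρ * E) * opTrace (M.ρ * M.A i)) ∧
      (∀ j, opTrace (M.ρ * (E * M.B j)) = opTrace (M.ρ * E) * opTrace (M.ρ * M.B j)) ∧
      (∀ i j, opTrace (M.ρ * (E * (M.A i * M.B j))) =
        opTrace (M.ρ * E) * opTrace (M.ρ * (M.A i * M.B j)))

/-- Algebraic security of a correlation `c`: in every quantum model for `c`, expectations
factorize between the generated algebra and its commutant. -/
def IsAlgebraicallySecure (c : Correlation) : Prop :=
  ∀ (H : Type) [NormedAddCommGroup H] [InnerProductSpace ℂ H] [CompleteSpace H]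
    [TopologicalSpace.SeparableSpace H] (M : Quintuple H), M.IsModelFor c →
    ∀ X ∈ M.alg, ∀ E : H →L[ℂ] H, M.InCommutant E →
      opTrace (M.ρ * (E * X)) = opTrace (M.ρ * E) * opTrace (M.ρ * X)

end

end QuantumCorrelation

open scoped TensorProduct

namespace QuantumCorrelation

/-! All conditions are compared with one property of Gram matrices, the negation of
`HasDeterministicPart c`. By Tsirelson's argument, quantum correlations are exactly the inner
products of unit vectors `x i`, `y j` in a real Hilbert space (`IsVectorModel.mem_quantumSet`,
`exists_vectorModel_of_mem_quantumSet`).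

Suppose some realization of `c` admits a vector `h` with `⟨h, x i⟩ = ±1` and `⟨h, y j⟩ = ±1`. Then a
small multiple of the rank-one sign matrix can be subtracted from the Gram matrix, so `c` is a
proper mixture of a deterministic correlation and a quantum one
(`HasDeterministicPart.exists_mixture`). The direct sum of the two models has nonzero marginals,
which can be reversed by changing all signs, and a nontrivial projection commuting with the
observables. This destroys uniqueness of the cyclic model and of the extension, and also security. A
nonclassical `c` of this kind is not extreme.

Without such an `h`, the four vectors lie in a plane, and `y j = s j • x 0 + t j • x 1` with `s j *
t j ≠ 0` for some `j`. The orthogonal sum of two realizations is again a realization, so all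
realizations share these relations (`IsVectorModel.eq_of_mixture`); extremality follows. For the
Hilbert–Schmidt vectors `A i √ρ`, `B j √ρ` of a model they become operator relations on the range of
`√ρ`. The deficits `1 - ‖A i √ρ‖²` must vanish, so all observables square to one there. Squaring the
relation for `B j` then fixes the anticommutator of `A 0` and `A 1`. These are the Pauli relations
of the singlet (`Quintuple.IsModelFor.isSingletVector`).

Each singlet vector `φ` spans, under the observables, a copy of `ℂ⁴ ⊗ φ` on which they act as in the
explicit model (`spread`, `inner_spread`). The canonical form, the unique cyclic model, the
vanishing of all marginals and algebraic security can be read off from this. -/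

noncomputable section

/-! ### Traces against a density operator, through Hilbert–Schmidt sums. -/

section Trace

variable {ι κ H K : Type} [NormedAddCommGroup H] [InnerProductSpace ℂ H]

theorem hasSum_norm_sq_inner (e : HilbertBasis ι ℂ H) (v : H) :
    HasSum (fun i => ‖inner ℂ (e i) v‖ ^ 2) (‖v‖ ^ 2) := by
  have h := RCLike.hasSum_re ℂ (e.hasSum_inner_mul_inner v v)
  rw [inner_self_eq_norm_sq] at h
  convert h using 2 with i
  rw [← inner_conj_symm v (e i), RCLike.conj_mul]
  norm_cast

theorem summable_norm_sq_inner (e : HilbertBasis ι ℂ H) (v : κ → H)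
    (h : Summable fun k => ‖v k‖ ^ 2) :
    Summable (fun p : κ × ι => ‖inner ℂ (e p.2) (v p.1)‖ ^ 2) := by
  rw [summable_prod_of_nonneg (fun _ => by positivity)]
  refine ⟨fun k => (hasSum_norm_sq_inner e (v k)).summable, ?_⟩
  simpa only [(hasSum_norm_sq_inner e (v _)).tsum_eq] using h

variable [CompleteSpace H]

/-- The square sum of an operator over a Hilbert basis equals that of its adjoint over any Hilbert
basis of the target. -/
theorem hasSum_norm_sq_adjoint [NormedAddCommGroup K] [InnerProductSpace ℂ K] [CompleteSpace K]
    (e : HilbertBasis ι ℂ H) (f : HilbertBasis κ ℂ K) (T : H →L[ℂ] K)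
    {s : ℝ} (h : HasSum (fun i => ‖T (e i)‖ ^ 2) s) :
    HasSum (fun j => ‖(ContinuousLinearMap.adjoint T) (f j)‖ ^ 2) s := by
  have hs := summable_norm_sq_inner f (fun i => T (e i)) h.summable
  have key : HasSum (fun p : ι × κ => ‖inner ℂ (f p.2) (T (e p.1))‖ ^ 2) s := by
    have := hs.hasSum.prod_fiberwise (fun i => hasSum_norm_sq_inner f (T (e i)))
    rw [← this.unique h]
    exact hs.hasSum
  have key' : HasSum (fun p : κ × ι => ‖inner ℂ (f p.1) (T (e p.2))‖ ^ 2) s :=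
    (Equiv.prodComm κ ι).hasSum_iff.mpr key
  refine key'.prod_fiberwise fun j => ?_
  convert hasSum_norm_sq_inner e (ContinuousLinearMap.adjoint T (f j)) using 2 with i
  rw [← ContinuousLinearMap.adjoint_inner_left, norm_inner_symm]

/-- The Hilbert–Schmidt inner product of `S` and `T` equals that of their adjoints, in reverse. -/
theorem hasSum_inner_adjoint (e : HilbertBasis ι ℂ H) (S T : H →L[ℂ] H)
    (hS : Summable fun i => ‖S (e i)‖ ^ 2) (hT : Summable fun i => ‖T (e i)‖ ^ 2) {s : ℂ}
    (h : HasSum (fun i => inner ℂ (S (e i)) (T (e i))) s) :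
    HasSum (fun j => inner ℂ ((ContinuousLinearMap.adjoint T) (e j))
      ((ContinuousLinearMap.adjoint S) (e j))) s := by
  have hs : Summable (fun p : ι × ι =>
      inner ℂ (S (e p.1)) (e p.2) * inner ℂ (e p.2) (T (e p.1))) := by
    refine Summable.of_norm_bounded
      ((summable_norm_sq_inner e (fun i => S (e i)) hS).add
        (summable_norm_sq_inner e (fun i => T (e i)) hT)) fun p => ?_
    rw [norm_mul, norm_inner_symm (S _)]
    nlinarith [sq_nonneg (‖inner ℂ (e p.2) (S (e p.1))‖ - ‖inner ℂ (e p.2) (T (e p.1))‖),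
      sq_nonneg (‖inner ℂ (e p.2) (S (e p.1))‖ + ‖inner ℂ (e p.2) (T (e p.1))‖)]
  have key : HasSum (fun p : ι × ι =>
      inner ℂ (S (e p.1)) (e p.2) * inner ℂ (e p.2) (T (e p.1))) s := by
    have := hs.hasSum.prod_fiberwise
      (fun i => e.hasSum_inner_mul_inner (S (e i)) (T (e i)))
    rw [← this.unique h]
    exact hs.hasSum
  have key' : HasSum (fun p : ι × ι =>
      inner ℂ (S (e p.2)) (e p.1) * inner ℂ (e p.1) (T (e p.2))) s :=
    (Equiv.prodComm ι ι).hasSum_iff.mpr key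
  refine key'.prod_fiberwise fun j => ?_
  have hj := e.hasSum_inner_mul_inner
    (ContinuousLinearMap.adjoint T (e j)) (ContinuousLinearMap.adjoint S (e j))
  simpa only [ContinuousLinearMap.adjoint_inner_left, ContinuousLinearMap.adjoint_inner_right,
    mul_comm] using hj

variable (H) in
/-- The Hilbert basis used in the definition of `opTrace`. -/
def traceBasis : HilbertBasis (exists_hilbertBasis ℂ H).choose ℂ H :=
  (exists_hilbertBasis ℂ H).choose_spec.choose

theorem opTrace_eq (T : H →L[ℂ] H) :
    opTrace T = ∑' i, inner ℂ (traceBasis H i) (T (traceBasis H i)) := rfl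

/-- The positive square root of a density operator. -/
def sqrtOp (ρ : H →L[ℂ] H) : H →L[ℂ] H := CFC.sqrt ρ

theorem sqrtOp_isSelfAdjoint (ρ : H →L[ℂ] H) : IsSelfAdjoint (sqrtOp ρ) :=
  (CFC.sqrt_nonneg ρ).isSelfAdjoint

theorem inner_sqrtOp (ρ : H →L[ℂ] H) (x y : H) :
    inner ℂ (sqrtOp ρ x) y = inner ℂ x (sqrtOp ρ y) :=
  (sqrtOp_isSelfAdjoint ρ).isSymmetric x y

theorem sqrtOp_sqrtOp {ρ : H →L[ℂ] H} (hρ : ρ.IsPositive) (x : H) :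
    sqrtOp ρ (sqrtOp ρ x) = ρ x := by
  have := CFC.sqrt_mul_sqrt_self ρ ((ContinuousLinearMap.nonneg_iff_isPositive ρ).mpr hρ)
  exact congrArg (fun T : H →L[ℂ] H => T x) this

theorem inner_self_density {ρ : H →L[ℂ] H} (hρ : ρ.IsPositive) (x : H) :
    inner ℂ x (ρ x) = ((‖sqrtOp ρ x‖ ^ 2 : ℝ) : ℂ) := by
  rw [← sqrtOp_sqrtOp hρ, ← inner_sqrtOp, inner_self_eq_norm_sq_to_K]
  norm_cast

theorem IsDensityOperator.hasSum_norm_sq {ρ : H →L[ℂ] H} (hρ : IsDensityOperator ρ) :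
    HasSum (fun i => ‖sqrtOp ρ (traceBasis H i)‖ ^ 2) 1 := by
  have h := hρ.2
  rw [opTrace_eq] at h
  simp only [inner_self_density hρ.1] at h
  -- A divergent `tsum` has the default value 0, so trace one already forces convergence.
  have hs : Summable fun i => ((‖sqrtOp ρ (traceBasis H i)‖ ^ 2 : ℝ) : ℂ) := by
    by_contra hn
    rw [tsum_eq_zero_of_not_summable hn] at h
    exact zero_ne_one h
  have h' := hs.hasSum
  rw [h] at h'
  rw [← Complex.ofReal_one] at h'
  exact Complex.hasSum_ofReal.mp h'

theorem IsDensityOperator.summable_norm_sq_comp {ρ : H →L[ℂ] H} (hρ : IsDensityOperator ρ)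
    (X : H →L[ℂ] H) : Summable (fun i => ‖X (sqrtOp ρ (traceBasis H i))‖ ^ 2) := by
  refine Summable.of_nonneg_of_le (fun _ => by positivity) (fun i => ?_)
    (hρ.hasSum_norm_sq.summable.mul_left (‖X‖ ^ 2))
  rw [← mul_pow]
  exact pow_le_pow_left₀ (norm_nonneg _) (X.le_opNorm _) 2

/-- `tr (ρ X) = tr (√ρ X √ρ)`, with a convergent sum. -/
theorem IsDensityOperator.hasSum_opTrace {ρ : H →L[ℂ] H} (hρ : IsDensityOperator ρ)
    (X : H →L[ℂ] H) :
    HasSum (fun i => inner ℂ (sqrtOp ρ (traceBasis H i)) (X (sqrtOp ρ (traceBasis H i))))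
      (opTrace (ρ * X)) := by
  have hadj : ContinuousLinearMap.adjoint (sqrtOp ρ) = sqrtOp ρ :=
    (sqrtOp_isSelfAdjoint ρ).adjoint_eq
  have hT : Summable fun i => ‖(sqrtOp ρ * X) (traceBasis H i)‖ ^ 2 := by
    have h1 := hρ.summable_norm_sq_comp (ContinuousLinearMap.adjoint X)
    have h2 := hasSum_norm_sq_adjoint (traceBasis H) (traceBasis H)
      (ContinuousLinearMap.adjoint X ∘L sqrtOp ρ) h1.hasSum
    simpa [ContinuousLinearMap.adjoint_comp, hadj] using h2.summable
  have hS := hρ.hasSum_norm_sq.summable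
  have hterm : ∀ i, inner ℂ (sqrtOp ρ (traceBasis H i)) ((sqrtOp ρ * X) (traceBasis H i)) =
      inner ℂ (traceBasis H i) ((ρ * X) (traceBasis H i)) := fun i => by
    rw [inner_sqrtOp, mul_apply_eq_comp, sqrtOp_sqrtOp hρ.1,
      mul_apply_eq_comp]
  have hsum : Summable fun i =>
      inner ℂ (sqrtOp ρ (traceBasis H i)) ((sqrtOp ρ * X) (traceBasis H i)) := by
    refine Summable.of_norm_bounded (hS.add hT) fun i => (norm_inner_le_norm _ _).trans ?_
    nlinarith [sq_nonneg (‖sqrtOp ρ (traceBasis H i)‖ - ‖(sqrtOp ρ * X) (traceBasis H i)‖),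
      sq_nonneg (‖sqrtOp ρ (traceBasis H i)‖ + ‖(sqrtOp ρ * X) (traceBasis H i)‖)]
  -- Cyclicity of the trace: the Hilbert–Schmidt product of `√ρ` and `√ρ X` is `tr (ρ X)`, and that
  -- of the adjoints is `tr (√ρ X √ρ)`.
  have h := hasSum_inner_adjoint (traceBasis H) (sqrtOp ρ) (sqrtOp ρ * X) hS hT hsum.hasSum
  simp only [hterm, ← opTrace_eq] at h
  convert h using 2 with i
  rw [hadj, ContinuousLinearMap.mul_def, ContinuousLinearMap.adjoint_comp, hadj,
    ContinuousLinearMap.comp_apply, ContinuousLinearMap.adjoint_inner_left]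

theorem opTrace_rankOne_mul (Ψ : H) (X : H →L[ℂ] H) :
    opTrace (InnerProductSpace.rankOne ℂ Ψ Ψ * X) = inner ℂ Ψ (X Ψ) := by
  rw [opTrace_eq, ← ContinuousLinearMap.adjoint_inner_left,
    ← (traceBasis H).tsum_inner_mul_inner]
  refine tsum_congr fun i => ?_
  rw [mul_apply_eq_comp, InnerProductSpace.rankOne_apply, inner_smul_right,
    ContinuousLinearMap.adjoint_inner_left]

theorem isDensityOperator_rankOne {Ψ : H} (hΨ : ‖Ψ‖ = 1) :
    IsDensityOperator (InnerProductSpace.rankOne ℂ Ψ Ψ) := by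
  refine ⟨InnerProductSpace.isPositive_rankOne_self Ψ, ?_⟩
  have := opTrace_rankOne_mul Ψ (1 : H →L[ℂ] H)
  rw [mul_one] at this
  rw [this, one_apply_eq_self, inner_self_eq_norm_sq_to_K, hΨ]
  simp

/-- An operator whose compression to the support of `ρ` vanishes has expectation zero. -/
theorem IsDensityOperator.opTrace_mul_eq_zero {ρ : H →L[ℂ] H} (hρ : IsDensityOperator ρ)
    {X : H →L[ℂ] H} (h : ∀ φ, ρ (X (ρ φ)) = 0) : opTrace (ρ * X) = 0 := by
  -- `√ρ` and its square have the same kernel. Hence one factor `√ρ` can be cancelled on the left of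
  -- `ρ X ρ = 0`, and another on the right after passing to the adjoint of `X`.
  have cancel : ∀ v, sqrtOp ρ (sqrtOp ρ v) = 0 → sqrtOp ρ v = 0 := fun v hv => by
    rw [← inner_self_eq_zero (𝕜 := ℂ), inner_sqrtOp, hv, inner_zero_right]
  have h1 : ∀ φ, sqrtOp ρ (X (ρ φ)) = 0 := fun φ => cancel _ (by rw [sqrtOp_sqrtOp hρ.1, h])
  have h2 : ∀ φ ψ, inner ℂ (sqrtOp ρ φ) (X (sqrtOp ρ ψ)) = 0 := fun φ ψ => by
    rw [← ContinuousLinearMap.adjoint_inner_left, inner_sqrtOp ρ _ ψ |>.symm]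
    have : sqrtOp ρ (ContinuousLinearMap.adjoint X (sqrtOp ρ φ)) = 0 := by
      refine cancel _ ?_
      rw [sqrtOp_sqrtOp hρ.1, ← inner_self_eq_zero (𝕜 := ℂ)]
      rw [hρ.1.isSymmetric.apply_clm, ContinuousLinearMap.adjoint_inner_left, inner_sqrtOp, h1,
        inner_zero_right]
    rw [this, inner_zero_left]
  have := hρ.hasSum_opTrace X
  simp only [h2] at this
  exact this.unique hasSum_zero

end Trace

/-! ### Unit vectors realizing a correlation, and rigidity of their linear relations. -/

section VectorModels

variable {E F : Type} [NormedAddCommGroup E] [InnerProductSpace ℝ E]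
  [NormedAddCommGroup F] [InnerProductSpace ℝ F]

/-- Unit vectors in a real inner product space whose inner products are the entries of `c`. -/
structure IsVectorModel (x y : Fin 2 → E) (c : Correlation) : Prop where
  norm_left : ∀ i, ‖x i‖ = 1
  norm_right : ∀ j, ‖y j‖ = 1
  inner_eq : ∀ i j, inner ℝ (x i) (y j) = c i j

/-- Some Gram matrix realizing `c` has a vector of signs in its range. -/
def HasDeterministicPart (c : Correlation) : Prop :=
  ∃ (E : Type) (_ : NormedAddCommGroup E) (_ : InnerProductSpace ℝ E) (x y : Fin 2 → E) (h : E),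
    IsVectorModel x y c ∧ (∀ i, inner ℝ h (x i) = 1 ∨ inner ℝ h (x i) = -1) ∧
      ∀ j, inner ℝ h (y j) = 1 ∨ inner ℝ h (y j) = -1

theorem IsVectorModel.swap {x y : Fin 2 → E} {c : Correlation} (h : IsVectorModel x y c) :
    IsVectorModel y x (fun i j => c j i) :=
  ⟨h.norm_right, h.norm_left, fun i j => by rw [real_inner_comm, h.inner_eq]⟩

theorem HasDeterministicPart.swap {c : Correlation} (h : HasDeterministicPart c) :
    HasDeterministicPart (fun i j => c j i) := by
  obtain ⟨E, _, _, x, y, h, hv, hx, hy⟩ := h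
  exact ⟨E, _, _, y, x, h, hv.swap, hy, hx⟩

/-- Rotating the components of the `y j` orthogonal to the `x i` into new mutually orthogonal
directions. -/
theorem IsVectorModel.hasDeterministicPart {x y : Fin 2 → E} {c : Correlation}
    (hv : IsVectorModel x y c) (p : Fin 2 → E) (h : E)
    (hxn : ∀ i j, inner ℝ (x i) (y j - p j) = 0) (hpn : ∀ j, inner ℝ (p j) (y j - p j) = 0)
    (hx : ∀ i, inner ℝ h (x i) = 1 ∨ inner ℝ h (x i) = -1)
    (hy : ∀ j, y j = p j → inner ℝ h (p j) = 1 ∨ inner ℝ h (p j) = -1) :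
    HasDeterministicPart c := by
  classical
  let r : Fin 2 → ℝ := fun j => ‖y j - p j‖
  -- Each `y j ≠ p j` has its own new direction, and the coordinate of the enlarged `h` there is
  -- chosen to make the product with the rotated `y j` equal to 1. Only the `y j` equal to `p j`
  -- impose a condition on `h`.
  let b : Fin 2 → ℝ := fun j => if y j = p j then 0 else (1 - inner ℝ h (p j)) / r j
  refine ⟨WithLp 2 (E × EuclideanSpace ℝ (Fin 2)), inferInstance, inferInstance,
    fun i => WithLp.toLp 2 (x i, 0),
    fun j => WithLp.toLp 2 (p j, r j • EuclideanSpace.single j 1),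
    WithLp.toLp 2 (h, WithLp.toLp 2 b), ⟨fun i => ?_, fun j => ?_, fun i j => ?_⟩, fun i => ?_,
    fun j => ?_⟩
  · have := hv.norm_left i
    rw [← sq_eq_sq₀ (norm_nonneg _) zero_le_one, WithLp.prod_norm_sq_eq_of_L2]
    simp [this]
  · have h1 := hv.norm_right j
    have h2 : ‖y j‖ ^ 2 = ‖p j‖ ^ 2 + r j ^ 2 := by
      have : y j = p j + (y j - p j) := by abel
      rw [this, norm_add_sq_real, hpn]
      simp [r]
    rw [← sq_eq_sq₀ (norm_nonneg _) zero_le_one, WithLp.prod_norm_sq_eq_of_L2]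
    simp [norm_smul, r, ← h2, h1]
  · have := hxn i j
    rw [inner_sub_right, sub_eq_zero, hv.inner_eq] at this
    simp [WithLp.prod_inner_apply, this]
  · simpa [WithLp.prod_inner_apply] using hx i
  · have key : inner ℝ (WithLp.toLp 2 (h, WithLp.toLp 2 b) : WithLp 2 (E × EuclideanSpace ℝ (Fin 2)))
        (WithLp.toLp 2 (p j, r j • EuclideanSpace.single j 1)) = inner ℝ h (p j) + r j * b j := by
      simp [WithLp.prod_inner_apply, inner_smul_right, EuclideanSpace.inner_single_right]
    rw [key]
    by_cases hj : y j = p j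
    · simpa [b, hj] using hy j hj
    · left
      have : r j ≠ 0 := by simpa [r, sub_eq_zero] using hj
      simp only [b, hj, if_false]
      field_simp
      ring

/-- In every excluded case a sign vector `h` can be written down. If the `x i` are parallel, `h = x
0` works. Otherwise `h = (x 0 + x 1) / (1 + u)` has product 1 with both `x i` and `s + t` with `s •
x 0 + t • x 1`; this is `±1` for a unit vector with `s * t = 0`. Components of the `y j` outside the
plane are rotated away by `IsVectorModel.hasDeterministicPart`. -/
theorem IsVectorModel.exists_mixed {x y : Fin 2 → E} {c : Correlation}
    (hv : IsVectorModel x y c) (hc : ¬ HasDeterministicPart c) :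
    inner ℝ (x 0) (x 1) ^ 2 ≠ 1 ∧
      ∃ j, ∃ s t : ℝ, s * t ≠ 0 ∧ y j = s • x 0 + t • x 1 := by
  set u := inner ℝ (x 0) (x 1) with hu
  have hx : ∀ i, inner ℝ (x i) (x i) = 1 := fun i => by
    rw [real_inner_self_eq_norm_sq, hv.norm_left, one_pow]
  have hy : ∀ i, inner ℝ (y i) (y i) = 1 := fun i => by
    rw [real_inner_self_eq_norm_sq, hv.norm_right, one_pow]
  have hu' : inner ℝ (x 1) (x 0) = u := real_inner_comm _ _
  have hu1 : u ^ 2 ≠ 1 := by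
    intro hu1
    have hx1 : x 1 = u • x 0 := by
      rw [← sub_eq_zero, ← inner_self_eq_zero (𝕜 := ℝ)]
      simp only [inner_sub_left, inner_sub_right, inner_smul_left, inner_smul_right, hx, hu',
        ← hu]
      simp
      linarith
    refine hc (hv.hasDeterministicPart (fun j => c 0 j • x 0) (x 0) ?_ ?_ ?_ ?_)
    · rw [Fin.forall_fin_two]
      constructor
      · intro j
        simp only [inner_sub_right, inner_smul_right, hx, hv.inner_eq]
        ring
      · intro j
        simp only [hx1, inner_smul_left, inner_sub_right, inner_smul_right, hx, hv.inner_eq]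
        simp [mul_comm]
    · intro j
      simp only [inner_smul_left, inner_sub_right, inner_smul_right, hx, hv.inner_eq]
      simp
    · rw [Fin.forall_fin_two]
      exact ⟨Or.inl (hx 0), mul_self_eq_one_iff.mp (by rwa [← sq])⟩
    · intro j hj
      have := hy j
      rw [hj] at this
      simp only [inner_smul_left, inner_smul_right, hx] at this ⊢
      simp only [mul_one] at this ⊢
      exact mul_self_eq_one_iff.mp (by simpa using this)
  refine ⟨hu1, ?_⟩
  have hu2 : 1 - u ^ 2 ≠ 0 := fun h => hu1 (by linarith)
  have hu3 : 1 + u ≠ 0 := fun h => hu1 (by nlinarith)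
  -- Cramer's rule for the coefficients of the orthogonal projection of `y j` to the span of the `x
  -- i`.
  let s : Fin 2 → ℝ := fun j => (c 0 j - u * c 1 j) / (1 - u ^ 2)
  let t : Fin 2 → ℝ := fun j => (c 1 j - u * c 0 j) / (1 - u ^ 2)
  have hst0 : ∀ j, s j + t j * u = c 0 j := fun j => by simp only [s, t]; field_simp; ring
  have hst1 : ∀ j, s j * u + t j = c 1 j := fun j => by simp only [s, t]; field_simp; ring
  by_contra hne
  push Not at hne
  have hxn : ∀ i j, inner ℝ (x i) (y j - (s j • x 0 + t j • x 1)) = 0 := by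
    rw [Fin.forall_fin_two]
    constructor <;> intro j <;>
      simp only [inner_sub_right, inner_add_right, inner_smul_right, hx, hu', ← hu, hv.inner_eq]
    · linarith [hst0 j]
    · linarith [hst1 j]
  refine hc (hv.hasDeterministicPart (fun j => s j • x 0 + t j • x 1)
    ((1 + u)⁻¹ • (x 0 + x 1)) hxn ?_ ?_ ?_)
  · intro j
    rw [inner_add_left, inner_smul_left, inner_smul_left, hxn, hxn]
    simp
  · rw [Fin.forall_fin_two]
    constructor <;> left <;>
      simp only [inner_smul_left, inner_add_left, hx, hu', ← hu] <;> simp <;> field_simp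
    ring
  · intro j hj
    have h1 := hne j (s j) (t j)
    have h2 : s j * t j = 0 := by
      by_contra h0
      exact h1 h0 hj
    have h3 := hy j
    rw [hj] at h3
    simp only [inner_add_left, inner_add_right, inner_smul_left, inner_smul_right, hx, hu',
      ← hu] at h3 ⊢
    simp only [conj_trivial] at h3 ⊢
    have h4 : (s j + t j) ^ 2 = 1 := by linear_combination h3 + (2 - 2 * u) * h2
    have h5 : s j * ((1 + u)⁻¹ * (1 + u)) + t j * ((1 + u)⁻¹ * (u + 1)) = s j + t j := by
      field_simp
      ring
    rw [h5]
    exact mul_self_eq_one_iff.mp (by rwa [← sq])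

/-- Vectors realizing a correlation without deterministic part span a plane. -/
theorem IsVectorModel.exists_coefficients {x y : Fin 2 → E} {c : Correlation}
    (hv : IsVectorModel x y c) (hc : ¬ HasDeterministicPart c) :
    ∃ s t : Fin 2 → ℝ, (∀ j, y j = s j • x 0 + t j • x 1) ∧ ∃ j, s j * t j ≠ 0 := by
  obtain ⟨-, j, s, t, hst, hj⟩ := hv.exists_mixed hc
  -- With the roles exchanged, some `x i` is a combination of both `y`s with nonzero coefficients.
  -- One `y j` is already in the span of the `x`s, so this relation can be solved for the other one.
  obtain ⟨-, i, s', t', hst', hi⟩ := hv.swap.exists_mixed (fun h => hc h.swap)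
  have hspan : ∀ k, y k ∈ Submodule.span ℝ {x 0, x 1} := by
    have hx0 : x 0 ∈ Submodule.span ℝ {x 0, x 1} := Submodule.subset_span (by simp)
    have hx1 : x 1 ∈ Submodule.span ℝ {x 0, x 1} := Submodule.subset_span (by simp)
    have hxi : x i ∈ Submodule.span ℝ {x 0, x 1} := by
      fin_cases i
      exacts [hx0, hx1]
    have hyj : y j ∈ Submodule.span ℝ {x 0, x 1} := by
      rw [hj]
      exact add_mem (Submodule.smul_mem _ _ hx0) (Submodule.smul_mem _ _ hx1)
    have hs' := left_ne_zero_of_mul hst'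
    have ht' := right_ne_zero_of_mul hst'
    have h0 : s'⁻¹ • (x i - t' • y 1) = y 0 := by
      rw [hi, add_sub_cancel_right, smul_smul, inv_mul_cancel₀ hs', one_smul]
    have h1 : t'⁻¹ • (x i - s' • y 0) = y 1 := by
      rw [hi, add_sub_cancel_left, smul_smul, inv_mul_cancel₀ ht', one_smul]
    rw [Fin.forall_fin_two]
    fin_cases j
    · refine ⟨hyj, ?_⟩
      rw [← h1]
      exact Submodule.smul_mem _ _ (sub_mem hxi (Submodule.smul_mem _ _ hyj))
    · refine ⟨?_, hyj⟩
      rw [← h0]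
      exact Submodule.smul_mem _ _ (sub_mem hxi (Submodule.smul_mem _ _ hyj))
  have hcoef : ∀ k, ∃ a b : ℝ, y k = a • x 0 + b • x 1 ∧ (k = j → a * b ≠ 0) := fun k => by
    by_cases hk : k = j
    · exact ⟨s, t, hk ▸ hj, fun _ => hst⟩
    · obtain ⟨a, b, hab⟩ := Submodule.mem_span_pair.mp (hspan k)
      exact ⟨a, b, hab.symm, fun h => absurd h hk⟩
  choose s t hst using hcoef
  exact ⟨s, t, fun k => (hst k).1, j, (hst j).2 rfl⟩

/-- Two vector models whose mixture has no deterministic part satisfy the same linear relations,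
and realize the same correlation. -/
theorem IsVectorModel.eq_of_mixture {x y : Fin 2 → E} {x' y' : Fin 2 → F} {c c' c'' : Correlation}
    (hc : ¬ HasDeterministicPart c) (hv : IsVectorModel x y c') (hv' : IsVectorModel x' y' c'')
    {a b : ℝ} (ha : 0 < a) (hb : 0 < b) (hab : a + b = 1) (hmix : a • c' + b • c'' = c) :
    c' = c'' ∧ ∃ s t : Fin 2 → ℝ, (∀ j, y j = s j • x 0 + t j • x 1) ∧
      (∀ j, y' j = s j • x' 0 + t j • x' 1) ∧ ∃ j, s j * t j ≠ 0 := by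
  have ha' := Real.sq_sqrt ha.le
  have hb' := Real.sq_sqrt hb.le
  have hnorm : ∀ (v : E) (v' : F), ‖v‖ = 1 → ‖v'‖ = 1 →
      ‖(WithLp.toLp 2 (√a • v, √b • v') : WithLp 2 (E × F))‖ = 1 := by
    intro v v' h h'
    rw [← sq_eq_sq₀ (norm_nonneg _) zero_le_one, WithLp.prod_norm_sq_eq_of_L2]
    simp [norm_smul, h, h', ha', hb', hab]
  -- The orthogonal sum with weights `√a`, `√b` realizes the mixture `c`, and a linear relation in
  -- the sum holds in each component with the same coefficients.
  have hw : IsVectorModel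
      (fun i => (WithLp.toLp 2 (√a • x i, √b • x' i) : WithLp 2 (E × F)))
      (fun j => WithLp.toLp 2 (√a • y j, √b • y' j)) c := by
    refine ⟨fun i => hnorm _ _ (hv.norm_left i) (hv'.norm_left i),
      fun j => hnorm _ _ (hv.norm_right j) (hv'.norm_right j), fun i j => ?_⟩
    rw [← hmix]
    simp only [WithLp.prod_inner_apply, inner_smul_left, inner_smul_right, hv.inner_eq,
      hv'.inner_eq, conj_trivial, Pi.add_apply, Pi.smul_apply, smul_eq_mul]
    linear_combination c' i j * ha' + c'' i j * hb'
  obtain ⟨s, t, hst, j, hj⟩ := hw.exists_coefficients hc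
  have h1 : ∀ j, y j = s j • x 0 + t j • x 1 := fun j => by
    have := congrArg WithLp.fst (hst j)
    change √a • y j = s j • √a • x 0 + t j • √a • x 1 at this
    rw [smul_comm (s j), smul_comm (t j), ← smul_add] at this
    exact smul_right_injective _ (Real.sqrt_pos.mpr ha).ne' this
  have h2 : ∀ j, y' j = s j • x' 0 + t j • x' 1 := fun j => by
    have := congrArg WithLp.snd (hst j)
    change √b • y' j = s j • √b • x' 0 + t j • √b • x' 1 at this
    rw [smul_comm (s j), smul_comm (t j), ← smul_add] at this
    exact smul_right_injective _ (Real.sqrt_pos.mpr hb).ne' this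
  refine ⟨?_, s, t, h1, h2, j, hj⟩
  have hu : ∀ {G : Type} [NormedAddCommGroup G] [InnerProductSpace ℝ G] (x y : Fin 2 → G)
      (c : Correlation), IsVectorModel x y c → (∀ j, y j = s j • x 0 + t j • x 1) →
      s j ^ 2 + t j ^ 2 + 2 * (s j * t j) * inner ℝ (x 0) (x 1) = 1 ∧
      ∀ j, c 0 j = s j + t j * inner ℝ (x 0) (x 1) ∧
        c 1 j = s j * inner ℝ (x 0) (x 1) + t j := by
    intro G _ _ x y c hv h
    have hx : ∀ i, inner ℝ (x i) (x i) = 1 := fun i => by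
      rw [real_inner_self_eq_norm_sq, hv.norm_left, one_pow]
    refine ⟨?_, fun j => ?_⟩
    · have hy : inner ℝ (y j) (y j) = 1 := by
        rw [real_inner_self_eq_norm_sq, hv.norm_right, one_pow]
      rw [h j] at hy
      simp only [inner_add_left, inner_add_right, inner_smul_left, inner_smul_right, hx,
        real_inner_comm (x 0) (x 1), conj_trivial] at hy
      linear_combination hy
    · rw [← hv.inner_eq, ← hv.inner_eq, h j]
      simp only [inner_add_right, inner_smul_right, hx, real_inner_comm (x 0) (x 1)]
      constructor <;> ring
  obtain ⟨k1, l1⟩ := hu x y c' hv h1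
  obtain ⟨k2, l2⟩ := hu x' y' c'' hv' h2
  -- The condition `‖y j‖ = 1` reads `s² + t² + 2 s t ⟨x 0, x 1⟩ = 1`, which determines the inner
  -- product because `s t ≠ 0`. All other products follow from the linear relations.
  have huu : inner ℝ (x 0) (x 1) = inner ℝ (x' 0) (x' 1) :=
    mul_left_cancel₀ (mul_ne_zero two_ne_zero hj) (by linear_combination k1 - k2)
  funext i k
  fin_cases i
  · exact ((l1 k).1.trans (by rw [huu])).trans (l2 k).1.symm
  · exact ((l1 k).2.trans (by rw [huu])).trans (l2 k).2.symm

end VectorModels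

/-! ### Pure models and direct sums of operators. -/

section PureModels

variable {H K : Type} [NormedAddCommGroup H] [InnerProductSpace ℂ H] [CompleteSpace H]
  [NormedAddCommGroup K] [InnerProductSpace ℂ K] [CompleteSpace K]

theorem IsSelfAdjoint.le_one_of_contraction {A : H →L[ℂ] H} (hA : IsSelfAdjoint A)
    (h : ∀ φ, ‖A φ‖ ≤ ‖φ‖) : -1 ≤ A ∧ A ≤ 1 := by
  have hre : ∀ φ, |Complex.re (inner ℂ (A φ) φ)| ≤ ‖φ‖ ^ 2 := fun φ =>
    (Complex.abs_re_le_norm _).trans ((norm_inner_le_norm _ _).trans (by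
      rw [sq]; exact mul_le_mul_of_nonneg_right (h φ) (norm_nonneg _)))
  constructor <;> rw [ContinuousLinearMap.le_def, ContinuousLinearMap.isPositive_def']
  · refine ⟨hA.sub (IsSelfAdjoint.one _).neg, fun φ => ?_⟩
    rw [ContinuousLinearMap.reApplyInnerSelf_apply]
    have := (abs_le.mp (hre φ)).1
    simp only [sub_neg_eq_add, add_apply, one_apply_eq_self, inner_add_left,
      map_add, inner_self_eq_norm_sq]
    simp only [RCLike.re_eq_complex_re]
    linarith
  · refine ⟨(IsSelfAdjoint.one _).sub hA, fun φ => ?_⟩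
    rw [ContinuousLinearMap.reApplyInnerSelf_apply]
    have := (abs_le.mp (hre φ)).2
    simp only [sub_apply, one_apply_eq_self, inner_sub_left,
      map_sub, inner_self_eq_norm_sq]
    simp only [RCLike.re_eq_complex_re]
    linarith

/-- The unit vector `Ψ` and the self-adjoint contractions `A i`, `B j` define a pure quantum
model. -/
structure IsPureModel (Ψ : H) (A B : Fin 2 → H →L[ℂ] H) : Prop where
  norm_eq : ‖Ψ‖ = 1
  selfAdjoint_A : ∀ i, IsSelfAdjoint (A i)
  selfAdjoint_B : ∀ j, IsSelfAdjoint (B j)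
  contraction_A : ∀ i φ, ‖A i φ‖ ≤ ‖φ‖
  contraction_B : ∀ j φ, ‖B j φ‖ ≤ ‖φ‖
  commute : ∀ i j φ, A i (B j φ) = B j (A i φ)

/-- The quintuple with pure state `|Ψ⟩⟨Ψ|`. -/
def pureQuintuple (Ψ : H) (A B : Fin 2 → H →L[ℂ] H) : Quintuple H :=
  ⟨InnerProductSpace.rankOne ℂ Ψ Ψ, A, B⟩

theorem IsPureModel.isModel {Ψ : H} {A B : Fin 2 → H →L[ℂ] H} (h : IsPureModel Ψ A B) :
    (pureQuintuple Ψ A B).IsModel where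
  density := isDensityOperator_rankOne h.norm_eq
  selfAdjoint_A := h.selfAdjoint_A
  selfAdjoint_B := h.selfAdjoint_B
  bounds_A i := IsSelfAdjoint.le_one_of_contraction (h.selfAdjoint_A i) (h.contraction_A i)
  bounds_B j := IsSelfAdjoint.le_one_of_contraction (h.selfAdjoint_B j) (h.contraction_B j)
  commute i j := ContinuousLinearMap.ext (h.commute i j)

theorem IsPureModel.isModelFor {Ψ : H} {A B : Fin 2 → H →L[ℂ] H} (h : IsPureModel Ψ A B)
    {c : Correlation} (hc : ∀ i j, inner ℂ Ψ (A i (B j Ψ)) = (c i j : ℂ)) :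
    (pureQuintuple Ψ A B).IsModelFor c :=
  ⟨h.isModel, fun i j => (opTrace_rankOne_mul Ψ _).trans (hc i j)⟩

theorem IsPureModel.isModelForBehavior {Ψ : H} {A B : Fin 2 → H →L[ℂ] H}
    (h : IsPureModel Ψ A B) {p : Behavior} (ha : ∀ i, inner ℂ Ψ (A i Ψ) = (p.1 i : ℂ))
    (hb : ∀ j, inner ℂ Ψ (B j Ψ) = (p.2.1 j : ℂ))
    (hc : ∀ i j, inner ℂ Ψ (A i (B j Ψ)) = (p.2.2 i j : ℂ)) :
    (pureQuintuple Ψ A B).IsModelForBehavior p :=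
  ⟨h.isModel, fun i => (opTrace_rankOne_mul Ψ _).trans (ha i),
    fun j => (opTrace_rankOne_mul Ψ _).trans (hb j),
    fun i j => (opTrace_rankOne_mul Ψ _).trans (hc i j)⟩

/-- Reversing the signs of all observables. -/
theorem IsPureModel.neg {Ψ : H} {A B : Fin 2 → H →L[ℂ] H} (h : IsPureModel Ψ A B) :
    IsPureModel Ψ (-A) (-B) where
  norm_eq := h.norm_eq
  selfAdjoint_A i := (h.selfAdjoint_A i).neg
  selfAdjoint_B j := (h.selfAdjoint_B j).neg
  contraction_A i φ := by simpa using h.contraction_A i φ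
  contraction_B j φ := by simpa using h.contraction_B j φ
  commute i j φ := by simpa using h.commute i j φ

/-- The direct sum of two operators. -/
def directSum (S : H →L[ℂ] H) (T : K →L[ℂ] K) : WithLp 2 (H × K) →L[ℂ] WithLp 2 (H × K) :=
  (WithLp.prodContinuousLinearEquiv 2 ℂ H K).symm.toContinuousLinearMap ∘L
    (S.prodMap T) ∘L (WithLp.prodContinuousLinearEquiv 2 ℂ H K).toContinuousLinearMap

omit [CompleteSpace H] [CompleteSpace K] in
@[simp] theorem directSum_apply (S : H →L[ℂ] H) (T : K →L[ℂ] K) (φ : WithLp 2 (H × K)) :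
    directSum S T φ = WithLp.toLp 2 (S φ.fst, T φ.snd) := rfl

theorem isSelfAdjoint_directSum {S : H →L[ℂ] H} {T : K →L[ℂ] K} (hS : IsSelfAdjoint S)
    (hT : IsSelfAdjoint T) : IsSelfAdjoint (directSum S T) := by
  rw [ContinuousLinearMap.isSelfAdjoint_iff_isSymmetric]
  intro φ ψ
  have h1 := hS.isSymmetric φ.fst ψ.fst
  have h2 := hT.isSymmetric φ.snd ψ.snd
  simp only [ContinuousLinearMap.coe_coe] at h1 h2
  simp [WithLp.prod_inner_apply, h1, h2]

omit [CompleteSpace H] [CompleteSpace K] in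
theorem norm_directSum_le {S : H →L[ℂ] H} {T : K →L[ℂ] K} (hS : ∀ φ, ‖S φ‖ ≤ ‖φ‖)
    (hT : ∀ φ, ‖T φ‖ ≤ ‖φ‖) (φ : WithLp 2 (H × K)) : ‖directSum S T φ‖ ≤ ‖φ‖ := by
  rw [← sq_le_sq₀ (norm_nonneg _) (norm_nonneg _), WithLp.prod_norm_sq_eq_of_L2,
    WithLp.prod_norm_sq_eq_of_L2]
  exact add_le_add (pow_le_pow_left₀ (norm_nonneg _) (hS _) 2)
    (pow_le_pow_left₀ (norm_nonneg _) (hT _) 2)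

end PureModels

/-! ### Planar spin observables in the singlet state. -/

section TwoQubits

/-- The real matrix of `(a σ_z + b σ_x) ⊗ 1`. -/
def leftMat (a b : ℝ) : Matrix (Fin 4) (Fin 4) ℝ :=
  !![a, 0, b, 0; 0, a, 0, b; b, 0, -a, 0; 0, b, 0, -a]

/-- The real matrix of `1 ⊗ (a σ_z + b σ_x)`. -/
def rightMat (a b : ℝ) : Matrix (Fin 4) (Fin 4) ℝ :=
  !![a, b, 0, 0; b, -a, 0, 0; 0, 0, a, b; 0, 0, b, -a]

theorem leftMat_mul_self (a b : ℝ) : leftMat a b * leftMat a b = (a ^ 2 + b ^ 2) • 1 := by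
  ext i j
  fin_cases i <;> fin_cases j <;> simp [leftMat, Matrix.mul_apply, Fin.sum_univ_four] <;> ring

theorem rightMat_mul_self (a b : ℝ) : rightMat a b * rightMat a b = (a ^ 2 + b ^ 2) • 1 := by
  ext i j
  fin_cases i <;> fin_cases j <;> simp [rightMat, Matrix.mul_apply, Fin.sum_univ_four] <;> ring

theorem leftMat_mul_rightMat (a b a' b' : ℝ) :
    leftMat a b * rightMat a' b' = rightMat a' b' * leftMat a b := by
  ext i j
  fin_cases i <;> fin_cases j <;>
    simp [leftMat, rightMat, Matrix.mul_apply, Fin.sum_univ_four] <;> ring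

theorem realOp_mul (S T : Matrix (Fin 4) (Fin 4) ℝ) : realOp (S * T) = realOp S * realOp T := by
  unfold realOp
  rw [← map_mul]
  congr 1
  exact Matrix.map_mul (f := Complex.ofRealHom)

theorem isSelfAdjoint_realOp {T : Matrix (Fin 4) (Fin 4) ℝ} (hT : T.transpose = T) :
    IsSelfAdjoint (realOp T) := by
  unfold realOp
  suffices h : IsSelfAdjoint (T.map Complex.ofReal) from
    h.map (Matrix.toEuclideanCLM (n := Fin 4) (𝕜 := ℂ))
  change (T.map Complex.ofReal).conjTranspose = _
  ext i j
  have := congrFun (congrFun hT i) j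
  simp only [Matrix.transpose_apply] at this
  simp [Matrix.conjTranspose_apply, this]

theorem realOp_apply (T : Matrix (Fin 4) (Fin 4) ℝ) (φ : TwoQubit) (i : Fin 4) :
    realOp T φ i = ∑ j, (T i j : ℂ) * φ j := rfl

theorem realOp_smul_one (r : ℝ) : realOp (r • 1) = (r : ℂ) • 1 := by
  ext φ i
  rw [realOp_apply]
  simp [Matrix.one_apply, apply_ite Complex.ofReal]

theorem norm_realOp_apply {T : Matrix (Fin 4) (Fin 4) ℝ} (hT : T.transpose = T) {r : ℝ}
    (hr : T * T = r • 1) (φ : TwoQubit) : ‖realOp T φ‖ ^ 2 = r * ‖φ‖ ^ 2 := by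
  have h : inner ℂ (realOp T φ) (realOp T φ) = (r : ℂ) * inner ℂ φ φ := by
    rw [show inner ℂ (realOp T φ) (realOp T φ) = inner ℂ φ (realOp T (realOp T φ)) from
      (isSelfAdjoint_realOp hT).isSymmetric _ _]
    rw [show realOp T (realOp T φ) = (realOp T * realOp T) φ from rfl, ← realOp_mul, hr,
      realOp_smul_one]
    simp
  rw [inner_self_eq_norm_sq_to_K, inner_self_eq_norm_sq_to_K] at h
  apply Complex.ofReal_injective
  push_cast
  exact h

theorem inner_singlet_realOp (T : Matrix (Fin 4) (Fin 4) ℝ) :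
    inner ℂ singlet (realOp T singlet) = (((T 1 1 - T 1 2 - T 2 1 + T 2 2) / 2 : ℝ) : ℂ) := by
  rw [PiLp.inner_apply, Fin.sum_univ_four]
  simp only [realOp_apply, Fin.sum_univ_four, singlet]
  have h : ((√2 : ℝ) : ℂ) ^ 2 = 2 := by norm_cast; simp
  have h0 : ((√2 : ℝ) : ℂ) ≠ 0 := by intro h'; rw [h'] at h; norm_num at h
  simp
  field_simp
  linear_combination (-1 * (T 1 1 - T 1 2 - T 2 1 + T 2 2 : ℂ)) * h

theorem norm_singlet : ‖singlet‖ = 1 := by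
  have h : ‖singlet‖ ^ 2 = 1 := by
    rw [EuclideanSpace.norm_sq_eq, Fin.sum_univ_four]
    simp [singlet]
    norm_num
  exact (pow_eq_one_iff_of_nonneg (norm_nonneg _) two_ne_zero).mp h

theorem isPureModel_twoQubit {a b : Fin 2 → Fin 2 → ℝ} (ha : ∀ i, a i 0 ^ 2 + a i 1 ^ 2 ≤ 1)
    (hb : ∀ j, b j 0 ^ 2 + b j 1 ^ 2 ≤ 1) :
    IsPureModel singlet (fun i => realOp (leftMat (a i 0) (a i 1)))
      (fun j => realOp (rightMat (b j 0) (b j 1))) where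
  norm_eq := norm_singlet
  selfAdjoint_A i := isSelfAdjoint_realOp (by
    ext k l; fin_cases k <;> fin_cases l <;> rfl)
  selfAdjoint_B i := isSelfAdjoint_realOp (by
    ext k l; fin_cases k <;> fin_cases l <;> rfl)
  contraction_A i φ := by
    rw [← sq_le_sq₀ (norm_nonneg _) (norm_nonneg _), norm_realOp_apply (by
      ext k l; fin_cases k <;> fin_cases l <;> rfl) (leftMat_mul_self _ _)]
    exact mul_le_of_le_one_left (sq_nonneg _) (ha i)
  contraction_B i φ := by
    rw [← sq_le_sq₀ (norm_nonneg _) (norm_nonneg _), norm_realOp_apply (by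
      ext k l; fin_cases k <;> fin_cases l <;> rfl) (rightMat_mul_self _ _)]
    exact mul_le_of_le_one_left (sq_nonneg _) (hb i)
  commute i j φ := by
    have := congrArg (fun T => realOp T φ)
      (leftMat_mul_rightMat (a i 0) (a i 1) (b j 0) (b j 1))
    simp only [realOp_mul] at this
    exact this

theorem inner_singlet_left_right (a b a' b' : ℝ) :
    inner ℂ singlet (realOp (leftMat a b) (realOp (rightMat a' b') singlet)) =
      ((-(a * a' + b * b') : ℝ) : ℂ) := by
  rw [show realOp (leftMat a b) (realOp (rightMat a' b') singlet) =
    (realOp (leftMat a b) * realOp (rightMat a' b')) singlet from rfl, ← realOp_mul,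
    inner_singlet_realOp]
  congr 1
  simp [leftMat, rightMat, Matrix.mul_apply, Fin.sum_univ_four]
  ring

theorem inner_singlet_left (a b : ℝ) : inner ℂ singlet (realOp (leftMat a b) singlet) = 0 := by
  rw [inner_singlet_realOp]
  simp [leftMat]

theorem inner_singlet_right (a b : ℝ) : inner ℂ singlet (realOp (rightMat a b) singlet) = 0 := by
  rw [inner_singlet_realOp]
  simp [rightMat]

end TwoQubits

/-! ### From vectors to two-qubit models, and splitting off a deterministic correlation. -/

section Realization

variable {E : Type} [NormedAddCommGroup E] [InnerProductSpace ℝ E]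

/-- Tsirelson's reduction to the plane: the inner products of two pairs of unit vectors are inner
products of vectors in the unit disc. -/
theorem IsVectorModel.exists_disc {x y : Fin 2 → E} {c : Correlation} (hv : IsVectorModel x y c) :
    ∃ a b : Fin 2 → Fin 2 → ℝ, (∀ i, a i 0 ^ 2 + a i 1 ^ 2 ≤ 1) ∧
      (∀ j, b j 0 ^ 2 + b j 1 ^ 2 ≤ 1) ∧ ∀ i j, c i j = a i 0 * b j 0 + a i 1 * b j 1 := by
  set u := inner ℝ (x 0) (x 1) with hu
  have hx : ∀ i, inner ℝ (x i) (x i) = 1 := fun i => by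
    rw [real_inner_self_eq_norm_sq, hv.norm_left, one_pow]
  have hu' : inner ℝ (x 1) (x 0) = u := real_inner_comm _ _
  have hsq : ‖x 1 - u • x 0‖ ^ 2 = 1 - u ^ 2 := by
    rw [← real_inner_self_eq_norm_sq]
    simp only [inner_sub_left, inner_sub_right, inner_smul_left, inner_smul_right, hx, hu', ← hu,
      conj_trivial]
    ring
  have hu1 : 0 ≤ 1 - u ^ 2 := hsq ▸ sq_nonneg _
  have hr := Real.sq_sqrt hu1
  -- Gram–Schmidt, with `f = 0` when the `x i` are parallel; hence only `⟨f, f⟩ ≤ 1`, which is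
  -- enough for the Bessel inequality below.
  obtain ⟨f, hf, hfx, hf1⟩ : ∃ f : E, √(1 - u ^ 2) • f = x 1 - u • x 0 ∧ inner ℝ (x 0) f = 0 ∧
      inner ℝ f f ≤ 1 := by
    by_cases h0 : √(1 - u ^ 2) = 0
    · refine ⟨0, ?_, by simp, by simp⟩
      rw [h0, zero_pow two_ne_zero] at hr
      rw [← hr, sq_eq_zero_iff, norm_eq_zero] at hsq
      rw [hsq, smul_zero]
    · refine ⟨(√(1 - u ^ 2))⁻¹ • (x 1 - u • x 0), ?_, ?_, ?_⟩
      · rw [smul_smul, mul_inv_cancel₀ h0, one_smul]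
      · simp [inner_smul_right, inner_sub_right, ← hu, hv.norm_left]
      · rw [real_inner_self_eq_norm_sq, norm_smul, mul_pow, hsq, norm_inv, inv_pow,
          Real.norm_eq_abs, sq_abs, hr, inv_mul_cancel₀]
        rw [← hr]
        exact pow_ne_zero 2 h0
  refine ⟨![![1, 0], ![u, √(1 - u ^ 2)]], fun j => ![inner ℝ (x 0) (y j), inner ℝ f (y j)],
    ?_, fun j => ?_, ?_⟩
  · rw [Fin.forall_fin_two]
    constructor
    · simp
    · simp [hr]
  · have hy : inner ℝ (y j) (y j) = 1 := by
      rw [real_inner_self_eq_norm_sq, hv.norm_right, one_pow]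
    have h := real_inner_self_nonneg (x := y j - inner ℝ (x 0) (y j) • x 0 - inner ℝ f (y j) • f)
    simp only [inner_sub_left, inner_sub_right, inner_smul_left, inner_smul_right, hx, hy, hfx,
      real_inner_comm (x 0) f, real_inner_comm (y j) (x 0), real_inner_comm (y j) f,
      conj_trivial] at h
    simp only [real_inner_comm (x 0) (y j), real_inner_comm f (y j)] at h ⊢
    simp
    nlinarith [mul_le_mul_of_nonneg_left hf1 (sq_nonneg (inner ℝ f (y j)))]
  · have h1 : ∀ j, √(1 - u ^ 2) * inner ℝ f (y j) = c 1 j - u * c 0 j := fun j => by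
      rw [← hv.inner_eq, ← hv.inner_eq, ← real_inner_smul_left, hf, inner_sub_left,
        real_inner_smul_left]
    rw [Fin.forall_fin_two]
    constructor <;> intro j
    · simp [hv.inner_eq]
    · simp [hv.inner_eq, h1]

theorem IsVectorModel.exists_twoQubit {x y : Fin 2 → E} {c : Correlation}
    (hv : IsVectorModel x y c) :
    ∃ A B : Fin 2 → TwoQubit →L[ℂ] TwoQubit, IsPureModel singlet A B ∧
      (∀ i, inner ℂ singlet (A i singlet) = 0) ∧ (∀ j, inner ℂ singlet (B j singlet) = 0) ∧
      ∀ i j, inner ℂ singlet (A i (B j singlet)) = (c i j : ℂ) := by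
  obtain ⟨a, b, ha, hb, hc⟩ := hv.exists_disc
  -- The singlet is anticorrelated, `⟨(a·σ) ⊗ (b·σ)⟩ = -a·b`, so Bob's vectors are negated.
  refine ⟨_, _, isPureModel_twoQubit (b := -b) ha (by simpa using hb),
    fun i => inner_singlet_left _ _, fun j => inner_singlet_right _ _, fun i j => ?_⟩
  rw [inner_singlet_left_right, hc]
  congr 1
  simp only [Pi.neg_apply]
  ring

theorem IsVectorModel.mem_quantumSet {x y : Fin 2 → E} {c : Correlation}
    (hv : IsVectorModel x y c) : c ∈ quantumSet := by
  obtain ⟨A, B, h, -, -, hc⟩ := hv.exists_twoQubit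
  exact ⟨TwoQubit, inferInstance, inferInstance, inferInstance, inferInstance, _,
    h.isModelFor hc⟩

/-- A correlation with a deterministic part is a proper mixture of a deterministic correlation and
a quantum one. -/
theorem HasDeterministicPart.exists_mixture {c : Correlation} (hc : HasDeterministicPart c) :
    ∃ (l : ℝ) (s t : Fin 2 → ℝ) (c' : Correlation) (F : Type) (_ : NormedAddCommGroup F)
      (_ : InnerProductSpace ℝ F) (x y : Fin 2 → F), 0 < l ∧ l < 1 ∧ (∀ i, s i = 1 ∨ s i = -1) ∧
      (∀ j, t j = 1 ∨ t j = -1) ∧ IsVectorModel x y c' ∧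
      ∀ i j, c i j = l * (s i * t j) + (1 - l) * c' i j := by
  obtain ⟨E, _, _, x, y, h, hv, hx, hy⟩ := hc
  have hsq : ∀ r : ℝ, r = 1 ∨ r = -1 → r ^ 2 = 1 := by rintro r (rfl | rfl) <;> norm_num
  have hh : h ≠ 0 := by
    rintro rfl
    have := hsq _ (hx 0)
    simp at this
  -- The extra 1 keeps the weight `N⁻¹` of the deterministic part strictly below 1 even if `‖h‖ =
  -- 1`. It is the square of the additional coordinate of `g`.
  set N : ℝ := ‖h‖ ^ 2 + 1 with hN
  have hN1 : 1 < N := by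
    have := norm_pos_iff.mpr hh
    rw [hN]; linarith [pow_pos this 2]
  have hN0 : N ≠ 0 := by linarith
  have hl : 0 < 1 - N⁻¹ := by linarith [inv_lt_one_of_one_lt₀ hN1]
  have hl0 := hl.ne'
  have hroot := Real.sq_sqrt hl.le
  have hroot0 : √(1 - N⁻¹) ≠ 0 := (Real.sqrt_pos.mpr hl).ne'
  let g : WithLp 2 (E × ℝ) := WithLp.toLp 2 (h, 1)
  have hg : inner ℝ g g = N := by
    rw [real_inner_self_eq_norm_sq, WithLp.prod_norm_sq_eq_of_L2]
    simp [g, hN]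
  -- The component of `(v, 0)` orthogonal to `g`, rescaled. Its Gram matrix is the old one minus
  -- `N⁻¹` times the matrix of the products `⟨h, v⟩ ⟨h, v'⟩`, up to the factor `(1 - N⁻¹)⁻¹`; the
  -- sign condition on `h` gives norm one.
  let w : E → WithLp 2 (E × ℝ) := fun v =>
    (√(1 - N⁻¹))⁻¹ • (WithLp.toLp 2 (v, 0) - (N⁻¹ * inner ℝ h v) • g)
  have hw : ∀ v v', inner ℝ (w v) (w v') =
      (1 - N⁻¹)⁻¹ * (inner ℝ v v' - N⁻¹ * (inner ℝ h v * inner ℝ h v')) := by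
    intro v v'
    have h1 : ∀ v : E, inner ℝ g (WithLp.toLp 2 (v, (0 : ℝ))) = inner ℝ h v := fun v => by
      simp [g, WithLp.prod_inner_apply]
    have h2 : ∀ v : E, inner ℝ (WithLp.toLp 2 (v, (0 : ℝ))) g = inner ℝ h v := fun v => by
      rw [real_inner_comm, h1]
    have h3 : inner ℝ (WithLp.toLp 2 (v, (0 : ℝ))) (WithLp.toLp 2 (v', (0 : ℝ))) =
        inner ℝ v v' := by
      simp [WithLp.prod_inner_apply]
    simp only [w, inner_smul_left, inner_smul_right, inner_sub_left, inner_sub_right, h1, h2, h3,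
      hg, conj_trivial]
    have hk : (√(1 - N⁻¹))⁻¹ * (√(1 - N⁻¹))⁻¹ = (1 - N⁻¹)⁻¹ := by
      rw [← mul_inv, ← sq, hroot]
    linear_combination (inner ℝ v v' - N⁻¹ * (inner ℝ h v * inner ℝ h v')) * hk +
      (√(1 - N⁻¹))⁻¹ * (√(1 - N⁻¹))⁻¹ * N⁻¹ * inner ℝ h v * inner ℝ h v' * inv_mul_cancel₀ hN0
  have hnorm : ∀ v, ‖v‖ = 1 → (inner ℝ h v = 1 ∨ inner ℝ h v = -1) → ‖w v‖ = 1 := by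
    intro v hv1 hv2
    rw [← sq_eq_sq₀ (norm_nonneg _) zero_le_one, ← real_inner_self_eq_norm_sq, hw,
      real_inner_self_eq_norm_sq, hv1, ← sq, hsq _ hv2, one_pow, mul_one, inv_mul_cancel₀ hl0]
  refine ⟨N⁻¹, fun i => inner ℝ h (x i), fun j => inner ℝ h (y j), _, WithLp 2 (E × ℝ),
    inferInstance, inferInstance, fun i => w (x i), fun j => w (y j), by positivity, by linarith,
    hx, hy,
    ⟨fun i => hnorm _ (hv.norm_left i) (hx i), fun j => hnorm _ (hv.norm_right j) (hy j),
      fun i j => rfl⟩, fun i j => ?_⟩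
  rw [hw, mul_inv_cancel_left₀ hl0, hv.inner_eq]
  ring

theorem IsVectorModel.deterministic {s t : Fin 2 → ℝ} (hs : ∀ i, s i = 1 ∨ s i = -1)
    (ht : ∀ j, t j = 1 ∨ t j = -1) : IsVectorModel s t (fun i j => s i * t j) :=
  ⟨fun i => by rcases hs i with h | h <;> simp [h], fun j => by rcases ht j with h | h <;> simp [h],
    fun i j => by simp [mul_comm]⟩

theorem deterministic_mem_classicalSet {s t : Fin 2 → ℝ} (hs : ∀ i, s i = 1 ∨ s i = -1)
    (ht : ∀ j, t j = 1 ∨ t j = -1) : (fun i j => s i * t j) ∈ classicalSet :=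
  ⟨Unit, ⊤, MeasureTheory.Measure.dirac (), fun i _ => s i, fun j _ => t j, inferInstance,
    fun _ => measurable_const, fun _ => measurable_const, fun i _ => hs i, fun j _ => ht j,
    fun i j => by simp⟩

theorem HasDeterministicPart.not_extreme {c : Correlation} (hc : HasDeterministicPart c)
    (hcl : c ∉ classicalSet) : c ∉ Set.extremePoints ℝ quantumSet := by
  obtain ⟨l, s, t, c', F, _, _, x, y, hl0, hl1, hs, ht, hv, h⟩ := hc.exists_mixture
  intro he
  refine hcl ?_
  have := he.2 (IsVectorModel.deterministic hs ht).mem_quantumSet hv.mem_quantumSet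
    ⟨l, 1 - l, hl0, by linarith, by ring, by ext i j; simp [h]⟩
  rw [← this]
  exact deterministic_mem_classicalSet hs ht

/-- The random variables are unit vectors of `L²(μ)`. One of the finitely many joint outcomes has
positive probability, and its normalized indicator pairs with each variable to the sign taken in
that outcome. -/
theorem hasDeterministicPart_of_mem_classicalSet {c : Correlation} (hc : c ∈ classicalSet) :
    HasDeterministicPart c := by
  obtain ⟨Ω, _, μ, A, B, _, hA, hB, hA1, hB1, hc⟩ := hc
  have mem : ∀ f : Ω → ℝ, Measurable f → (∀ ω, f ω = 1 ∨ f ω = -1) →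
      MeasureTheory.MemLp f 2 μ := fun f hf hf1 =>
    MeasureTheory.MemLp.of_bound hf.aestronglyMeasurable 1
      (Filter.Eventually.of_forall fun ω => by rcases hf1 ω with h | h <;> simp [h])
  have inner_toLp : ∀ (f g : Ω → ℝ) (hf : MeasureTheory.MemLp f 2 μ)
      (hg : MeasureTheory.MemLp g 2 μ), inner ℝ hf.toLp hg.toLp = ∫ ω, f ω * g ω ∂μ := by
    intro f g hf hg
    rw [MeasureTheory.L2.inner_def]
    refine MeasureTheory.integral_congr_ae ?_
    filter_upwards [hf.coeFn_toLp, hg.coeFn_toLp] with ω h1 h2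
    rw [h1, h2]
    simp [mul_comm]
  have norm_toLp : ∀ (f : Ω → ℝ) (hf : MeasureTheory.MemLp f 2 μ),
      (∀ ω, f ω = 1 ∨ f ω = -1) → ‖hf.toLp‖ = 1 := by
    intro f hf hf1
    rw [← sq_eq_sq₀ (norm_nonneg _) zero_le_one, ← real_inner_self_eq_norm_sq, inner_toLp]
    have : ∀ ω, f ω * f ω = 1 := fun ω => by rcases hf1 ω with h | h <;> simp [h]
    simp [this]
  let sgn : Bool → ℝ := fun b => if b then 1 else -1
  have hsgn : ∀ b, sgn b = 1 ∨ sgn b = -1 := by simp [sgn]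
  let Z : (Fin 2 → Bool) × (Fin 2 → Bool) → Set Ω := fun σ =>
    (⋂ i, A i ⁻¹' {sgn (σ.1 i)}) ∩ ⋂ j, B j ⁻¹' {sgn (σ.2 j)}
  have hZ : ⋃ σ, Z σ = Set.univ := by
    refine Set.eq_univ_of_forall fun ω => Set.mem_iUnion.mpr
      ⟨(fun i => decide (A i ω = 1), fun j => decide (B j ω = 1)), ?_⟩
    simp only [Z, Set.mem_inter_iff, Set.mem_iInter, Set.mem_preimage, Set.mem_singleton_iff, sgn]
    refine ⟨fun i => ?_, fun j => ?_⟩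
    · rcases hA1 i ω with h | h <;> simp [h]
    · rcases hB1 j ω with h | h <;> simp [h]
  obtain ⟨σ, hσ⟩ := MeasureTheory.exists_measure_pos_of_not_measure_iUnion_null
    (μ := μ) (s := Z) (by rw [hZ]; simp)
  have hZm : MeasurableSet (Z σ) :=
    (MeasurableSet.iInter fun i => hA i (measurableSet_singleton _)).inter
      (MeasurableSet.iInter fun j => hB j (measurableSet_singleton _))
  have hσ' : μ.real (Z σ) ≠ 0 := by
    rw [MeasureTheory.measureReal_def]
    exact (ENNReal.toReal_pos hσ.ne' (MeasureTheory.measure_ne_top μ _)).ne'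
  let h : Ω → ℝ := (Z σ).indicator fun _ => (μ.real (Z σ))⁻¹
  have hh : MeasureTheory.MemLp h 2 μ := MeasureTheory.MemLp.indicator hZm
    (MeasureTheory.memLp_const _)
  have hint : ∀ (f : Ω → ℝ) (hf : MeasureTheory.MemLp f 2 μ) (r : ℝ), (∀ ω ∈ Z σ, f ω = r) →
      inner ℝ hh.toLp hf.toLp = r := by
    intro f hf r hr
    rw [inner_toLp]
    have : (fun ω => h ω * f ω) = (Z σ).indicator fun _ => (μ.real (Z σ))⁻¹ * r := by
      funext ω
      by_cases hω : ω ∈ Z σ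
      · simp [h, hω, hr ω hω]
      · simp [h, hω]
    rw [this, MeasureTheory.integral_indicator hZm, MeasureTheory.setIntegral_const, smul_eq_mul,
      ← mul_assoc, mul_inv_cancel₀ hσ', one_mul]
  refine ⟨MeasureTheory.Lp ℝ 2 μ, inferInstance, inferInstance,
    fun i => (mem (A i) (hA i) (hA1 i)).toLp, fun j => (mem (B j) (hB j) (hB1 j)).toLp, hh.toLp,
    ⟨fun i => norm_toLp _ _ (hA1 i), fun j => norm_toLp _ _ (hB1 j), fun i j => ?_⟩,
    fun i => ?_, fun j => ?_⟩
  · rw [inner_toLp, hc]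
  · rw [hint (A i) _ (sgn (σ.1 i)) fun ω hω => by simpa using Set.mem_iInter.mp hω.1 i]
    exact hsgn _
  · rw [hint (B j) _ (sgn (σ.2 j)) fun ω hω => by simpa using Set.mem_iInter.mp hω.2 j]
    exact hsgn _

end Realization

/-! ### A deterministic part destroys uniqueness of the extension and security. -/

section Mixtures

/-- The model on `ℂ ⊕ ℂ⁴` of the mixture of a deterministic correlation with a quantum one, with the
projection `E` to the first summand. -/
theorem HasDeterministicPart.exists_pureModel {c : Correlation} (hc : HasDeterministicPart c) :
    ∃ (l : ℝ) (s t : Fin 2 → ℝ) (Ψ : WithLp 2 (ℂ × TwoQubit))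
      (A B : Fin 2 → WithLp 2 (ℂ × TwoQubit) →L[ℂ] WithLp 2 (ℂ × TwoQubit))
      (E : WithLp 2 (ℂ × TwoQubit) →L[ℂ] WithLp 2 (ℂ × TwoQubit)),
      0 < l ∧ l < 1 ∧ (∀ i, s i = 1 ∨ s i = -1) ∧ IsPureModel Ψ A B ∧
      (∀ i, inner ℂ Ψ (A i Ψ) = ((l * s i : ℝ) : ℂ)) ∧
      (∀ j, inner ℂ Ψ (B j Ψ) = ((l * t j : ℝ) : ℂ)) ∧
      (∀ i j, inner ℂ Ψ (A i (B j Ψ)) = (c i j : ℂ)) ∧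
      0 ≤ E ∧ E ≤ 1 ∧ (∀ i, E * A i = A i * E) ∧ (∀ j, E * B j = B j * E) ∧
      inner ℂ Ψ (E Ψ) = (l : ℂ) ∧ ∀ i, inner ℂ Ψ (E (A i Ψ)) = ((l * s i : ℝ) : ℂ) := by
  obtain ⟨l, s, t, c', F, _, _, x, y, hl0, hl1, hs, ht, hv, h⟩ := hc.exists_mixture
  obtain ⟨A, B, hm, hA0, hB0, hAB⟩ := hv.exists_twoQubit
  have hl := Complex.ofReal_inj.mpr (Real.mul_self_sqrt hl0.le)
  have hl' := Complex.ofReal_inj.mpr (Real.mul_self_sqrt (sub_nonneg.mpr hl1.le))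
  push_cast at hl hl'
  have hs1 : ∀ (r : ℝ), r = 1 ∨ r = -1 → IsSelfAdjoint ((r : ℂ) • (1 : ℂ →L[ℂ] ℂ)) ∧
      ∀ φ, ‖((r : ℂ) • (1 : ℂ →L[ℂ] ℂ)) φ‖ ≤ ‖φ‖ := by
    intro r hr
    constructor
    · rw [ContinuousLinearMap.isSelfAdjoint_iff_isSymmetric]
      intro φ ψ
      simp
      ring
    · intro φ
      rcases hr with rfl | rfl <;> simp
  -- Block-diagonal operators see this superposition as the mixture with weights `l` and `1 - l`.
  -- The singlet block has no marginals, so only the deterministic block contributes `l * s i` and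
  -- `l * t j`.
  let Ψ : WithLp 2 (ℂ × TwoQubit) := WithLp.toLp 2 (((√l : ℝ) : ℂ), ((√(1 - l) : ℝ) : ℂ) • singlet)
  have hΨ : ∀ (r : ℂ) (T : TwoQubit →L[ℂ] TwoQubit),
      inner ℂ Ψ (WithLp.toLp 2 (r * ((√l : ℝ) : ℂ), T (((√(1 - l) : ℝ) : ℂ) • singlet))) =
        l * r + (1 - l) * inner ℂ singlet (T singlet) := by
    intro r T
    rw [WithLp.prod_inner_apply]
    simp only [Ψ, map_smul, inner_smul_left, inner_smul_right, RCLike.inner_apply,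
      Complex.conj_ofReal]
    linear_combination r * hl + inner ℂ singlet (T singlet) * hl'
  have hE : ∀ φ : WithLp 2 (ℂ × TwoQubit),
      directSum (1 : ℂ →L[ℂ] ℂ) (0 : TwoQubit →L[ℂ] TwoQubit) φ = WithLp.toLp 2 (φ.fst, 0) :=
    fun φ => rfl
  have hEsa : IsSelfAdjoint (directSum (1 : ℂ →L[ℂ] ℂ) (0 : TwoQubit →L[ℂ] TwoQubit)) :=
    isSelfAdjoint_directSum (IsSelfAdjoint.one _) (IsSelfAdjoint.zero _)
  refine ⟨l, s, t, Ψ, fun i => directSum ((s i : ℂ) • 1) (A i),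
    fun j => directSum ((t j : ℂ) • 1) (B j), directSum 1 0, hl0, hl1, hs,
    ⟨?_, fun i => isSelfAdjoint_directSum (hs1 _ (hs i)).1 (hm.selfAdjoint_A i),
      fun j => isSelfAdjoint_directSum (hs1 _ (ht j)).1 (hm.selfAdjoint_B j),
      fun i => norm_directSum_le (hs1 _ (hs i)).2 (hm.contraction_A i),
      fun j => norm_directSum_le (hs1 _ (ht j)).2 (hm.contraction_B j),
      fun i j φ => ?_⟩, fun i => ?_, fun j => ?_, fun i j => ?_, ?_, ?_, fun i => ?_, fun j => ?_,
      ?_, fun i => ?_⟩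
  · have h1 := hΨ 1 1
    have h2 : inner ℂ Ψ Ψ = 1 := by
      have h3 : inner ℂ singlet singlet = (1 : ℂ) := by
        rw [inner_self_eq_norm_sq_to_K, norm_singlet]; simp
      simp only [one_apply_eq_self, h3, one_mul] at h1
      rw [show (1 : ℂ) = l * 1 + (1 - l) * 1 by ring]
      exact h1
    rw [inner_self_eq_norm_sq_to_K] at h2
    have h4 : ‖Ψ‖ ^ 2 = 1 := by
      apply Complex.ofReal_injective
      push_cast
      exact h2
    exact (pow_eq_one_iff_of_nonneg (norm_nonneg _) two_ne_zero).mp h4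
  · simp only [directSum_apply]
    simp [mul_left_comm, hm.commute i j φ.snd]
  · refine (hΨ (s i) (A i)).trans ?_
    rw [hA0]
    push_cast
    ring
  · refine (hΨ (t j) (B j)).trans ?_
    rw [hB0]
    push_cast
    ring
  · have h2 : directSum ((s i : ℂ) • 1) (A i) (directSum ((t j : ℂ) • 1) (B j) Ψ) =
        WithLp.toLp 2 ((s i * t j : ℂ) * ((√l : ℝ) : ℂ),
          (A i * B j) (((√(1 - l) : ℝ) : ℂ) • singlet)) := by
      rw [mul_assoc]
      rfl
    have h3 : inner ℂ singlet ((A i * B j) singlet) = (c' i j : ℂ) := hAB i j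
    simp only [h2, hΨ, h3, h]
    push_cast
    ring
  · rw [ContinuousLinearMap.nonneg_iff_isPositive, ContinuousLinearMap.isPositive_def']
    refine ⟨hEsa, fun φ => ?_⟩
    rw [ContinuousLinearMap.reApplyInnerSelf_apply, hE, WithLp.prod_inner_apply]
    simpa using inner_self_nonneg (𝕜 := ℂ) (x := φ.fst)
  · rw [ContinuousLinearMap.le_def, ContinuousLinearMap.isPositive_def']
    refine ⟨(IsSelfAdjoint.one _).sub hEsa, fun φ => ?_⟩
    rw [ContinuousLinearMap.reApplyInnerSelf_apply, sub_apply, hE, WithLp.prod_inner_apply]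
    simpa using inner_self_nonneg (𝕜 := ℂ) (x := φ.snd)
  · ext1 φ
    simp
  · ext1 φ
    simp
  · have h1 := hΨ 1 0
    simp only [one_mul, zero_apply, inner_zero_right, mul_zero, add_zero, mul_one] at h1
    exact h1
  · have h1 := hΨ (s i) 0
    simp only [zero_apply, inner_zero_right, mul_zero, add_zero] at h1
    push_cast
    exact h1

/-- Changing the sign of every observable preserves `c` but reverses the marginal `± l ≠ 0`. -/
theorem HasDeterministicPart.not_unique_extension {c : Correlation}
    (hc : HasDeterministicPart c) (p : Behavior) : ¬ ∀ q, IsExtension q c → q = p := by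
  obtain ⟨l, s, t, Ψ, A, B, -, hl, -, hs, hm, hA, hB, hAB, -⟩ := hc.exists_pureModel
  intro h
  have h1 := h (fun i => l * s i, fun j => l * t j, c)
    ⟨⟨_, _, _, inferInstance, inferInstance, _, hm.isModelForBehavior hA hB hAB⟩, rfl⟩
  have h2 := h (fun i => -(l * s i), fun j => -(l * t j), c)
    ⟨⟨_, _, _, inferInstance, inferInstance, _, hm.neg.isModelForBehavior
      (fun i => by simp [hA]) (fun j => by simp [hB]) (fun i j => by simp [hAB])⟩, rfl⟩
  have h3 := congrFun (congrArg Prod.fst (h1.trans h2.symm)) 0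
  simp only at h3
  rcases hs 0 with h4 | h4 <;> rw [h4] at h3 <;> linarith

theorem Quintuple.inCommutant_of_commute {H : Type}
    [NormedAddCommGroup H] [InnerProductSpace ℂ H] {M : Quintuple H} {E : H →L[ℂ] H}
    (hA : ∀ i, E * M.A i = M.A i * E) (hB : ∀ j, E * M.B j = M.B j * E) : M.InCommutant E := by
  have h : M.alg ≤ Subalgebra.centralizer ℂ {E} := by
    refine Subalgebra.topologicalClosure_minimal (Algebra.adjoin_le ?_)
      (Set.isClosed_centralizer _)
    rintro _ (⟨i, rfl⟩ | ⟨j, rfl⟩)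
    · exact Set.mem_centralizer_iff.mpr fun m hm => by rw [Set.mem_singleton_iff.mp hm, hA]
    · exact Set.mem_centralizer_iff.mpr fun m hm => by rw [Set.mem_singleton_iff.mp hm, hB]
  exact fun X hX => Set.mem_centralizer_iff.mp (h hX) E rfl

/-- For the projection to the deterministic block, factorization would require `l * s 0 = l * (l * s
0)`, which is false for `0 < l < 1`. -/
theorem HasDeterministicPart.not_secure {c : Correlation} (hc : HasDeterministicPart c) :
    ¬ ∀ p, IsExtension p c → IsCryptographicallySecure p := by
  obtain ⟨l, s, t, Ψ, A, B, E, hl0, hl1, hs, hm, hA, hB, hAB, hE0, hE1, hEA, hEB, hE, hEA'⟩ :=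
    hc.exists_pureModel
  intro h
  have hb := hm.isModelForBehavior (p := (fun i => l * s i, fun j => l * t j, c)) hA hB hAB
  have h1 := (h _ ⟨⟨_, _, _, inferInstance, inferInstance, _, hb⟩, rfl⟩ _ _ hb E hE0 hE1
    (Quintuple.inCommutant_of_commute hEA hEB)).1 0
  simp only [pureQuintuple, opTrace_rankOne_mul, mul_apply_eq_comp, hEA', hE, hA] at h1
  norm_cast at h1
  rcases hs 0 with h4 | h4 <;> rw [h4] at h1 <;> nlinarith

end Mixtures

/-! ### A deterministic part gives inequivalent cyclic models. -/

section Cyclic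

variable {H : Type} [NormedAddCommGroup H] [InnerProductSpace ℂ H] [CompleteSpace H]
  [TopologicalSpace.SeparableSpace H]

/-- Restriction of a pure model to the cyclic subspace generated by its vector. -/
theorem IsPureModel.exists_cyclic {Ψ : H} {A B : Fin 2 → H →L[ℂ] H} (h : IsPureModel Ψ A B) :
    ∃ (K : Type) (_ : NormedAddCommGroup K) (_ : InnerProductSpace ℂ K) (_ : CompleteSpace K)
      (_ : TopologicalSpace.SeparableSpace K) (Ψ' : K) (A' B' : Fin 2 → K →L[ℂ] K),
      IsPureModel Ψ' A' B' ∧ (pureQuintuple Ψ' A' B').IsCyclic ∧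
      (∀ i, inner ℂ Ψ' (A' i Ψ') = inner ℂ Ψ (A i Ψ)) ∧
      ∀ i j, inner ℂ Ψ' (A' i (B' j Ψ')) = inner ℂ Ψ (A i (B j Ψ)) := by
  let 𝒜 : Subalgebra ℂ (H →L[ℂ] H) := Algebra.adjoin ℂ (Set.range A ∪ Set.range B)
  let S : Submodule ℂ H := 𝒜.toSubmodule.map (ContinuousLinearMap.apply ℂ H Ψ : (H →L[ℂ] H) →ₗ[ℂ] H)
  have hS : ∀ v, v ∈ S ↔ ∃ X ∈ 𝒜, X Ψ = v := fun v => Iff.rfl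
  let V : Submodule ℂ H := S.topologicalClosure
  have hinv : ∀ X ∈ 𝒜, ∀ v ∈ V, X v ∈ V := by
    intro X hX v hv
    have : Set.MapsTo X (S : Set H) (S : Set H) := by
      rintro w ⟨Y, hY, rfl⟩
      exact ⟨X * Y, 𝒜.mul_mem hX hY, rfl⟩
    exact this.closure X.continuous hv
  have hA : ∀ i, A i ∈ 𝒜 := fun i => Algebra.subset_adjoin (Or.inl ⟨i, rfl⟩)
  have hB : ∀ j, B j ∈ 𝒜 := fun j => Algebra.subset_adjoin (Or.inr ⟨j, rfl⟩)
  have hΨ : Ψ ∈ V := S.le_topologicalClosure ⟨1, 𝒜.one_mem, rfl⟩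
  let res : ∀ X : H →L[ℂ] H, X ∈ 𝒜 → V →L[ℂ] V := fun X hX =>
    (X ∘L V.subtypeL).codRestrict V fun v => hinv X hX v v.2
  have hsa : ∀ X hX, IsSelfAdjoint X → IsSelfAdjoint (res X hX) := by
    intro X hX hX'
    rw [ContinuousLinearMap.isSelfAdjoint_iff_isSymmetric]
    intro v w
    exact hX'.isSymmetric (v : H) w
  refine ⟨V, inferInstance, inferInstance, inferInstance, ?_, ⟨Ψ, hΨ⟩, fun i => res (A i) (hA i),
    fun j => res (B j) (hB j), ⟨h.norm_eq, fun i => hsa _ (hA i) (h.selfAdjoint_A i),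
      fun j => hsa _ (hB j) (h.selfAdjoint_B j), fun i φ => h.contraction_A i φ,
      fun j φ => h.contraction_B j φ, fun i j φ => Subtype.ext (h.commute i j φ)⟩, ?_,
    fun i => rfl, fun i j => rfl⟩
  · have := UniformSpace.secondCountable_of_separable H
    infer_instance
  · refine ⟨⟨Ψ, hΨ⟩, h.norm_eq, rfl, ?_⟩
    rw [Subtype.dense_iff]
    change closure (S : Set H) ⊆ _
    refine closure_mono ?_
    rintro _ ⟨X, hX, rfl⟩
    have key : ∀ X ∈ 𝒜, ∃ X' ∈ Algebra.adjoin ℂ (Set.range (fun i => res (A i) (hA i)) ∪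
        Set.range (fun j => res (B j) (hB j))), ∀ v : V, (X' v : H) = X v := by
      intro X hX
      induction hX using Algebra.adjoin_induction with
      | mem X hX =>
        rcases hX with ⟨i, rfl⟩ | ⟨j, rfl⟩
        · exact ⟨_, Algebra.subset_adjoin (Or.inl ⟨i, rfl⟩), fun v => rfl⟩
        · exact ⟨_, Algebra.subset_adjoin (Or.inr ⟨j, rfl⟩), fun v => rfl⟩
      | algebraMap r => exact ⟨algebraMap ℂ _ r, Subalgebra.algebraMap_mem _ r, fun v => rfl⟩
      | add X Y _ _ hX hY =>
        obtain ⟨X', hX', h1⟩ := hX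
        obtain ⟨Y', hY', h2⟩ := hY
        exact ⟨X' + Y', Subalgebra.add_mem _ hX' hY', fun v => by simp [h1, h2]⟩
      | mul X Y _ _ hX hY =>
        obtain ⟨X', hX', h1⟩ := hX
        obtain ⟨Y', hY', h2⟩ := hY
        exact ⟨X' * Y', Subalgebra.mul_mem _ hX' hY', fun v => by simp [h1, h2]⟩
    obtain ⟨X', hX', h1⟩ := key X hX
    exact ⟨X' ⟨Ψ, hΨ⟩, ⟨X', Subalgebra.le_topologicalClosure _ hX', rfl⟩, h1 _⟩

omit [CompleteSpace H] [TopologicalSpace.SeparableSpace H] in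
/-- Unitarily equivalent pure models have the same expectations. -/
theorem inner_eq_of_unitarilyEquivalent {K : Type} [NormedAddCommGroup K]
    [InnerProductSpace ℂ K] {Ψ : H} {A B : Fin 2 → H →L[ℂ] H}
    {Ψ' : K} {A' B' : Fin 2 → K →L[ℂ] K} (hΨ : ‖Ψ‖ = 1)
    (h : (pureQuintuple Ψ A B).UnitarilyEquivalent (pureQuintuple Ψ' A' B')) (i : Fin 2) :
    inner ℂ Ψ (A i Ψ) = inner ℂ Ψ' (A' i Ψ') := by
  obtain ⟨U, hρ, hA, -⟩ := h
  simp only [pureQuintuple, InnerProductSpace.rankOne_apply, map_smul] at hρ hA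
  have hΨΨ : inner ℂ Ψ Ψ = (1 : ℂ) := by
    rw [inner_self_eq_norm_sq_to_K, hΨ]; simp
  have h1 := hρ Ψ
  rw [hΨΨ, one_smul] at h1
  have hz : inner ℂ Ψ' (U Ψ) ≠ 0 := by
    intro hz
    rw [hz, zero_smul] at h1
    rw [U.injective (h1.trans (map_zero U).symm), norm_zero] at hΨ
    exact zero_ne_one hΨ
  -- `U Ψ` is a nonzero multiple of `Ψ'`. Applying the intertwining of the states to `A i Ψ` gives
  -- both expectations times this factor.
  have h2 := hρ (A i Ψ)
  rw [hA, h1, map_smul, inner_smul_right, smul_smul, mul_comm] at h2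
  have hΨ' : Ψ' ≠ 0 := by
    rintro rfl
    exact hz (inner_zero_left _)
  exact mul_right_cancel₀ hz (((mul_comm _ _).trans (smul_left_injective ℂ hΨ' h2)).trans (mul_comm _ _))

/-- The mixture model and its sign reversal, restricted to their cyclic subspaces, have opposite
nonzero marginals. -/
theorem HasDeterministicPart.not_hasUniqueCyclicModel {c : Correlation}
    (hc : HasDeterministicPart c) : ¬ HasUniqueCyclicModel c := by
  obtain ⟨l, s, t, Ψ, A, B, -, hl, -, hs, hm, hA, hB, hAB, -⟩ := hc.exists_pureModel
  intro h
  obtain ⟨K, _, _, _, _, Ψ₁, A₁, B₁, hm₁, hcyc₁, hA₁, hAB₁⟩ := hm.exists_cyclic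
  obtain ⟨L, _, _, _, _, Ψ₂, A₂, B₂, hm₂, hcyc₂, hA₂, hAB₂⟩ := hm.neg.exists_cyclic
  have hu := h.2 K L _ _ (hm₁.isModelFor fun i j => by rw [hAB₁, hAB]) hcyc₁
    (hm₂.isModelFor (c := c) fun i j => by rw [hAB₂]; simp [hAB]) hcyc₂
  have h3 := inner_eq_of_unitarilyEquivalent hm₁.norm_eq hu 0
  rw [hA₁, hA₂, Pi.neg_apply, neg_apply, inner_neg_right, hA] at h3
  norm_cast at h3
  rcases hs 0 with h4 | h4 <;> rw [h4] at h3 <;> linarith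

end Cyclic

/-! ### From operators to vectors: the Hilbert–Schmidt vectors of a model. -/

section VectorModelOfModel

variable {H : Type} [NormedAddCommGroup H] [InnerProductSpace ℂ H] [CompleteSpace H]

/-- The identity `(1 - A)(1 + A)(1 - A) + (1 + A)(1 - A)(1 + A) = 2 (1 - A²)` exhibits `1 - A²` as a
sum of positive operators, without functional calculus. -/
theorem contraction_of_le_one {A : H →L[ℂ] H} (hA : IsSelfAdjoint A) (h : -1 ≤ A ∧ A ≤ 1)
    (φ : H) : ‖A φ‖ ≤ ‖φ‖ := by
  have h1 := (ContinuousLinearMap.le_def _ _).mp h.1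
  have h2 := (ContinuousLinearMap.le_def _ _).mp h.2
  have p1 := h1.re_inner_nonneg_left (φ - A φ)
  have p2 := h2.re_inner_nonneg_left (φ + A φ)
  have hs : ∀ x y, inner ℂ (A x) y = inner ℂ x (A y) := fun x y => hA.isSymmetric x y
  have key : inner ℂ ((A - -1) (φ - A φ)) (φ - A φ) + inner ℂ ((1 - A) (φ + A φ)) (φ + A φ) =
      2 * (inner ℂ φ φ - inner ℂ (A φ) (A φ)) := by
    simp only [sub_apply, neg_apply, one_apply_eq_self, map_sub, map_add, inner_sub_left,
      inner_sub_right, inner_add_left, inner_add_right, inner_neg_left, hs]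
    ring
  have key' := congrArg Complex.re key
  rw [inner_self_eq_norm_sq_to_K, inner_self_eq_norm_sq_to_K] at key'
  simp only [RCLike.re_eq_complex_re] at p1 p2
  rw [Complex.add_re] at key'
  have hre : (2 * (((‖φ‖ : ℝ) : ℂ) ^ 2 - ((‖A φ‖ : ℝ) : ℂ) ^ 2)).re =
      2 * (‖φ‖ ^ 2 - ‖A φ‖ ^ 2) := by
    rw [← Complex.ofReal_re (2 * (‖φ‖ ^ 2 - ‖A φ‖ ^ 2))]
    push_cast
    rfl
  rw [← sq_le_sq₀ (norm_nonneg _) (norm_nonneg _)]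
  have := (add_nonneg p1 p2).trans (key'.le.trans hre.le)
  linarith

omit [CompleteSpace H] in
theorem ext_hilbertBasis {ι : Type} (b : HilbertBasis ι ℂ H) {S T : H →L[ℂ] H}
    (h : ∀ i, S (b i) = T (b i)) : S = T :=
  ContinuousLinearMap.ext_on (Submodule.dense_iff_topologicalClosure_eq_top.mpr b.dense_span)
    (by rintro _ ⟨i, rfl⟩; exact h i)

/-- The family `T √ρ e`, `e` in a Hilbert basis, as a square summable family. -/
def IsDensityOperator.vec {ρ : H →L[ℂ] H} (hρ : IsDensityOperator ρ) (T : H →L[ℂ] H) :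
    lp (fun _ : (exists_hilbertBasis ℂ H).choose => H) 2 :=
  ⟨fun i => T (sqrtOp ρ (traceBasis H i)), by
    refine memℓp_gen ?_
    simpa using hρ.summable_norm_sq_comp T⟩

theorem IsDensityOperator.vec_apply {ρ : H →L[ℂ] H} (hρ : IsDensityOperator ρ) (T : H →L[ℂ] H)
    (i) : hρ.vec T i = T (sqrtOp ρ (traceBasis H i)) := rfl

theorem IsDensityOperator.inner_vec {ρ : H →L[ℂ] H} (hρ : IsDensityOperator ρ) {S : H →L[ℂ] H}
    (hS : IsSelfAdjoint S) (T : H →L[ℂ] H) :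
    inner ℂ (hρ.vec S) (hρ.vec T) = opTrace (ρ * (S * T)) := by
  refine (lp.hasSum_inner _ _).unique ?_
  have h : ∀ i, inner ℂ (hρ.vec S i) (hρ.vec T i) = inner ℂ (sqrtOp ρ (traceBasis H i))
      ((S * T) (sqrtOp ρ (traceBasis H i))) := fun i => hS.isSymmetric _ _
  simpa only [h] using hρ.hasSum_opTrace (S * T)

theorem IsDensityOperator.norm_sq_vec {ρ : H →L[ℂ] H} (hρ : IsDensityOperator ρ)
    (T : H →L[ℂ] H) :
    HasSum (fun i => ‖T (sqrtOp ρ (traceBasis H i))‖ ^ 2) (‖hρ.vec T‖ ^ 2) := by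
  have h := RCLike.hasSum_re ℂ (lp.hasSum_inner (𝕜 := ℂ) (hρ.vec T) (hρ.vec T))
  simpa only [inner_self_eq_norm_sq, hρ.vec_apply] using h

theorem IsDensityOperator.norm_vec_le {ρ : H →L[ℂ] H} (hρ : IsDensityOperator ρ)
    {T : H →L[ℂ] H} (hT : ∀ φ, ‖T φ‖ ≤ ‖φ‖) : ‖hρ.vec T‖ ^ 2 ≤ 1 :=
  hasSum_le (fun _ => pow_le_pow_left₀ (norm_nonneg _) (hT _) 2) (hρ.norm_sq_vec T)
    hρ.hasSum_norm_sq

/-- A self-adjoint contraction with second moment one is an involution on the support of `ρ`. -/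
theorem IsDensityOperator.sq_eq_of_norm_vec {ρ : H →L[ℂ] H} (hρ : IsDensityOperator ρ)
    {T : H →L[ℂ] H} (hT : IsSelfAdjoint T) (hT' : ∀ φ, ‖T φ‖ ≤ ‖φ‖) (h : ‖hρ.vec T‖ ^ 2 = 1)
    (φ : H) : T (T (sqrtOp ρ φ)) = sqrtOp ρ φ := by
  have hsum := hρ.norm_sq_vec T
  rw [h] at hsum
  have heq : ∀ i, ‖T (sqrtOp ρ (traceBasis H i))‖ ^ 2 = ‖sqrtOp ρ (traceBasis H i)‖ ^ 2 := by
    have h0 := hρ.hasSum_norm_sq.sub hsum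
    rw [sub_self, hasSum_zero_iff_of_nonneg fun i => sub_nonneg.mpr
      (pow_le_pow_left₀ (norm_nonneg _) (hT' _) 2)] at h0
    exact fun i => (sub_eq_zero.mp (congrFun h0 i)).symm
  have key : ∀ v, ‖T v‖ ^ 2 = ‖v‖ ^ 2 → T (T v) = v := by
    intro v hv
    rw [← sub_eq_zero, ← norm_eq_zero, ← sq_eq_zero_iff]
    refine le_antisymm ?_ (sq_nonneg _)
    rw [norm_sub_sq (𝕜 := ℂ), show inner ℂ (T (T v)) v = inner ℂ (T v) (T v) from
      hT.isSymmetric _ _, inner_self_eq_norm_sq]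
    have := pow_le_pow_left₀ (norm_nonneg _) (hT' (T v)) 2
    linarith
  exact congrArg (fun S : H →L[ℂ] H => S φ) (ext_hilbertBasis (traceBasis H)
    (S := T * T * sqrtOp ρ) (T := sqrtOp ρ) fun i => key _ (heq i))

/-- The linear relations of the vectors defined by a model hold on the support of the state. -/
theorem Quintuple.IsModelFor.exists_vectorModel {M : Quintuple H} {c : Correlation}
    (hM : M.IsModelFor c) :
    ∃ (E : Type) (_ : NormedAddCommGroup E) (_ : InnerProductSpace ℝ E) (x y : Fin 2 → E),
      IsVectorModel x y c ∧ ∀ s t : Fin 2 → ℝ, (∀ j, y j = s j • x 0 + t j • x 1) →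
        (∃ j, s j * t j ≠ 0) → ∀ φ,
        (∀ j, M.B j (sqrtOp M.ρ φ) =
          (s j : ℂ) • M.A 0 (sqrtOp M.ρ φ) + (t j : ℂ) • M.A 1 (sqrtOp M.ρ φ)) ∧
        (∀ i, M.A i (M.A i (sqrtOp M.ρ φ)) = sqrtOp M.ρ φ) ∧
        ∀ j, M.B j (M.B j (sqrtOp M.ρ φ)) = sqrtOp M.ρ φ := by
  obtain ⟨hM, hc⟩ := hM
  have hρ := hM.density
  have hA := fun i => contraction_of_le_one (hM.selfAdjoint_A i) (hM.bounds_A i)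
  have hB := fun j => contraction_of_le_one (hM.selfAdjoint_B j) (hM.bounds_B j)
  let V := lp (fun _ : (exists_hilbertBasis ℂ H).choose => H) 2
  let _ : InnerProductSpace ℝ V := InnerProductSpace.rclikeToReal ℂ V
  -- Each observable gets a private direction that completes its vector to norm one without changing
  -- the products between Alice and Bob.
  let lift : (H →L[ℂ] H) → (Fin 2 ⊕ Fin 2) → WithLp 2 (V × EuclideanSpace ℝ (Fin 2 ⊕ Fin 2)) := fun T k =>
    WithLp.toLp 2 (hρ.vec T, √(1 - ‖hρ.vec T‖ ^ 2) • EuclideanSpace.single k 1)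
  have hnorm : ∀ T k, (∀ φ, ‖T φ‖ ≤ ‖φ‖) → ‖lift T k‖ = 1 := by
    intro T k hT
    have h := Real.sq_sqrt (sub_nonneg.mpr (hρ.norm_vec_le hT))
    rw [← sq_eq_sq₀ (norm_nonneg _) zero_le_one, WithLp.prod_norm_sq_eq_of_L2]
    simp [lift, norm_smul, h]
  refine ⟨WithLp 2 (V × EuclideanSpace ℝ (Fin 2 ⊕ Fin 2)), inferInstance, inferInstance, fun i => lift (M.A i) (Sum.inl i),
    fun j => lift (M.B j) (Sum.inr j),
    ⟨fun i => hnorm _ _ (hA i), fun j => hnorm _ _ (hB j), fun i j => ?_⟩, ?_⟩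
  · have h := hρ.inner_vec (hM.selfAdjoint_A i) (M.B j)
    rw [hc] at h
    have h' : inner ℝ (hρ.vec (M.A i)) (hρ.vec (M.B j)) = c i j := by
      rw [real_inner_eq_re_inner ℂ, h]
      simp
    rw [WithLp.prod_inner_apply]
    simp only [lift, inner_smul_left, inner_smul_right]
    simpa [EuclideanSpace.inner_single_left] using h'
  · intro s t hst hj φ
    have h1 : ∀ j, hρ.vec (M.B j) = s j • hρ.vec (M.A 0) + t j • hρ.vec (M.A 1) := fun j =>
      congrArg WithLp.fst (hst j)
    have h2 : ∀ j, (√(1 - ‖hρ.vec (M.B j)‖ ^ 2) • EuclideanSpace.single (Sum.inr j) 1 :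
        EuclideanSpace ℝ (Fin 2 ⊕ Fin 2)) =
        s j • √(1 - ‖hρ.vec (M.A 0)‖ ^ 2) • EuclideanSpace.single (Sum.inl 0) 1 +
        t j • √(1 - ‖hρ.vec (M.A 1)‖ ^ 2) • EuclideanSpace.single (Sum.inl 1) 1 := fun j =>
      congrArg WithLp.snd (hst j)
    have hdef : ∀ T : H →L[ℂ] H, (∀ φ, ‖T φ‖ ≤ ‖φ‖) → √(1 - ‖hρ.vec T‖ ^ 2) = 0 →
        ‖hρ.vec T‖ ^ 2 = 1 := by
      intro T hT h
      have := (Real.sqrt_eq_zero (sub_nonneg.mpr (hρ.norm_vec_le hT))).mp h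
      linarith
    -- The private direction of `B j` is absent from the right side of the relation, so its deficit
    -- vanishes. The private directions of `A 0` and `A 1` are absent from the left side, and their
    -- coefficients for the chosen `j` are nonzero.
    have hBd : ∀ j, √(1 - ‖hρ.vec (M.B j)‖ ^ 2) = 0 := fun j => by
      have := congrArg (fun v : EuclideanSpace ℝ (Fin 2 ⊕ Fin 2) => v (Sum.inr j)) (h2 j)
      simpa using this
    obtain ⟨j, hj⟩ := hj
    have hAd : ∀ i, √(1 - ‖hρ.vec (M.A i)‖ ^ 2) = 0 := by
      rw [Fin.forall_fin_two]
      constructor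
      · have := congrArg (fun v : EuclideanSpace ℝ (Fin 2 ⊕ Fin 2) => v (Sum.inl 0)) (h2 j)
        simpa [left_ne_zero_of_mul hj] using this
      · have := congrArg (fun v : EuclideanSpace ℝ (Fin 2 ⊕ Fin 2) => v (Sum.inl 1)) (h2 j)
        simpa [right_ne_zero_of_mul hj] using this
    refine ⟨fun j => ?_,
      fun i => hρ.sq_eq_of_norm_vec (hM.selfAdjoint_A i) (hA i) (hdef _ (hA i) (hAd i)) φ,
      fun j => hρ.sq_eq_of_norm_vec (hM.selfAdjoint_B j) (hB j) (hdef _ (hB j) (hBd j)) φ⟩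
    refine congrArg (fun S : H →L[ℂ] H => S φ) (ext_hilbertBasis (traceBasis H)
      (S := M.B j * sqrtOp M.ρ) (T := (s j : ℂ) • (M.A 0 * sqrtOp M.ρ) +
        (t j : ℂ) • (M.A 1 * sqrtOp M.ρ)) fun i => ?_)
    have := congrArg (fun v : V => v.1 i) (h1 j)
    exact this

end VectorModelOfModel

theorem exists_vectorModel_of_mem_quantumSet {c : Correlation} (hc : c ∈ quantumSet) :
    ∃ (E : Type) (_ : NormedAddCommGroup E) (_ : InnerProductSpace ℝ E) (x y : Fin 2 → E),
      IsVectorModel x y c := by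
  obtain ⟨H, _, _, _, _, M, hM⟩ := hc
  obtain ⟨E, _, _, x, y, h, -⟩ := hM.exists_vectorModel
  exact ⟨E, _, _, x, y, h⟩

/-- Both ends of a segment through `c` have vector models, and `IsVectorModel.eq_of_mixture` makes
the ends equal. -/
theorem mem_extremePoints_of_not_hasDeterministicPart {c : Correlation} (hc : c ∈ quantumSet)
    (h : ¬ HasDeterministicPart c) : c ∈ Set.extremePoints ℝ quantumSet := by
  refine ⟨hc, fun c' hc' c'' hc'' hseg => ?_⟩
  obtain ⟨a, b, ha, hb, hab, hmix⟩ := hseg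
  obtain ⟨E, _, _, x, y, hv⟩ := exists_vectorModel_of_mem_quantumSet hc'
  obtain ⟨F, _, _, x', y', hv'⟩ := exists_vectorModel_of_mem_quantumSet hc''
  have := (IsVectorModel.eq_of_mixture h hv hv' ha hb hab hmix).1
  rw [← hmix, ← this, ← add_smul, hab, one_smul]

theorem extreme_nonclassical_iff {c : Correlation} (hc : c ∈ quantumSet) :
    c ∉ classicalSet ∧ c ∈ Set.extremePoints ℝ quantumSet ↔ ¬ HasDeterministicPart c :=
  ⟨fun h hP => hP.not_extreme h.1 h.2, fun h =>
    ⟨fun hcl => h (hasDeterministicPart_of_mem_classicalSet hcl),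
      mem_extremePoints_of_not_hasDeterministicPart hc h⟩⟩

/-! ### Planar angles of a correlation without deterministic part. -/

section Angles

theorem exists_cos_sin_eq {a b : ℝ} (h : a ^ 2 + b ^ 2 = 1) :
    ∃ θ : ℝ, Real.cos θ = a ∧ Real.sin θ = b := by
  have hz : ‖(⟨a, b⟩ : ℂ)‖ = 1 := by
    rw [← sq_eq_sq₀ (norm_nonneg _) zero_le_one, ← Complex.normSq_eq_norm_sq, Complex.normSq_mk]
    linarith
  refine ⟨Complex.arg ⟨a, b⟩, ?_, ?_⟩
  · rw [Complex.cos_arg (by rw [← norm_ne_zero_iff, hz]; exact one_ne_zero), hz, div_one]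
  · rw [Complex.sin_arg, hz, div_one]

theorem exists_isAngleParam {c : Correlation} (hc : c ∈ quantumSet)
    (h : ¬ HasDeterministicPart c) : ∃ α β γ : ℝ, IsAngleParam c α β γ := by
  obtain ⟨E, _, _, x, y, hv⟩ := exists_vectorModel_of_mem_quantumSet hc
  obtain ⟨s, t, hst, -⟩ := hv.exists_coefficients h
  set u := inner ℝ (x 0) (x 1) with hu
  have hx : ∀ i, inner ℝ (x i) (x i) = 1 := fun i => by
    rw [real_inner_self_eq_norm_sq, hv.norm_left, one_pow]
  have hu' : inner ℝ (x 1) (x 0) = u := real_inner_comm _ _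
  have hu1 : 0 ≤ 1 - u ^ 2 := by
    have := real_inner_mul_inner_self_le (x 0) (x 1)
    rw [hx, hx, ← hu] at this
    linarith
  have hr := Real.sq_sqrt hu1
  have hy : ∀ j, s j ^ 2 + t j ^ 2 + 2 * s j * t j * u = 1 := fun j => by
    have hy : inner ℝ (y j) (y j) = 1 := by
      rw [real_inner_self_eq_norm_sq, hv.norm_right, one_pow]
    rw [hst j] at hy
    simp only [inner_add_left, inner_add_right, inner_smul_left, inner_smul_right, hx,
      ← hu, hu', conj_trivial] at hy
    linear_combination hy
  have hc0 : ∀ j, c 0 j = s j + t j * u := fun j => by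
    rw [← hv.inner_eq, hst j]
    simp only [inner_add_right, inner_smul_right, hx, ← hu]
    ring
  have hc1 : ∀ j, c 1 j = s j * u + t j := fun j => by
    rw [← hv.inner_eq, hst j]
    simp only [inner_add_right, inner_smul_right, hx, hu']
    ring
  -- Polar coordinates in the plane of the vectors: `x 0` at angle 0, `x 1` at `ξ`, `y j` at `η j`.
  -- The four angle differences, taken around the cycle `y 0, x 0, y 1, x 1`, sum to zero.
  obtain ⟨ξ, hξc, hξs⟩ := exists_cos_sin_eq (a := u) (b := √(1 - u ^ 2)) (by linarith)
  have hη : ∀ j, ∃ θ : ℝ, Real.cos θ = s j + t j * u ∧ Real.sin θ = t j * √(1 - u ^ 2) := fun j =>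
    exists_cos_sin_eq (by linear_combination hy j + t j ^ 2 * hr)
  choose η hηc hηs using hη
  have h1 : ∀ j, Real.cos (ξ - η j) = c 1 j := fun j => by
    rw [Real.cos_sub, hξc, hξs, hηc, hηs, hc1]
    linear_combination t j * hr
  refine ⟨-η 0, η 1, η 0 - ξ, ?_, ?_, ?_, ξ - η 1, ?_, 0, ?_⟩
  · rw [Real.cos_neg, hηc, hc0]
  · rw [hηc, hc0]
  · rw [← h1, ← Real.cos_neg, neg_sub]
  · rw [h1]
  · push_cast; ring

/-- The unit vector at angle `θ`. -/
def unitVec (θ : ℝ) : EuclideanSpace ℝ (Fin 2) := !₂[Real.cos θ, Real.sin θ]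

theorem inner_unitVec (θ η : ℝ) : inner ℝ (unitVec θ) (unitVec η) = Real.cos (θ - η) := by
  rw [Real.cos_sub]
  simp [unitVec, PiLp.inner_apply, Fin.sum_univ_two]
  ring

theorem norm_unitVec (θ : ℝ) : ‖unitVec θ‖ = 1 := by
  have h := inner_unitVec θ θ
  rw [real_inner_self_eq_norm_sq, sub_self, Real.cos_zero] at h
  exact (pow_eq_one_iff_of_nonneg (norm_nonneg _) two_ne_zero).mp h

theorem IsAngleParam.isVectorModel {c : Correlation} {α β γ : ℝ} (h : IsAngleParam c α β γ) :
    IsVectorModel ![unitVec α, unitVec (-γ)] ![unitVec 0, unitVec (α + β)] c := by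
  obtain ⟨h00, h01, h10, δ, h11, k, hk⟩ := h
  refine ⟨?_, ?_, ?_⟩
  · simp [Fin.forall_fin_two, norm_unitVec]
  · simp [Fin.forall_fin_two, norm_unitVec]
  · have h1 : Real.cos (-γ - (α + β)) = Real.cos δ := by
      rw [show -γ - (α + β) = δ - k * (2 * Real.pi) by linear_combination -hk]
      exact Real.cos_sub_int_mul_two_pi δ k
    simp only [Fin.forall_fin_two]
    simp [inner_unitVec, h00, h01, h10, h11, h1]

/-- `α + γ` is the angle between Alice's vectors and `α + β` the angle between Bob's; neither pair
can be parallel by `IsVectorModel.exists_mixed`. -/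
theorem IsAngleParam.sin_ne_zero {c : Correlation} {α β γ : ℝ} (h : IsAngleParam c α β γ)
    (hc : ¬ HasDeterministicPart c) : Real.sin (α + γ) ≠ 0 ∧ Real.sin (α + β) ≠ 0 := by
  have h1 := (h.isVectorModel.exists_mixed hc).1
  have h2 := (h.isVectorModel.swap.exists_mixed fun h => hc h.swap).1
  simp only [Matrix.cons_val_zero, Matrix.cons_val_one, inner_unitVec] at h1 h2
  rw [sub_neg_eq_add] at h1
  rw [zero_sub, Real.cos_neg] at h2
  exact ⟨fun h => h1 (by rw [Real.cos_sq', h]; ring), fun h => h2 (by rw [Real.cos_sq', h]; ring)⟩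

end Angles

/-! ### Rigidity: Pauli relations on the support of the state. -/

section SingletVectors

variable {H : Type} [NormedAddCommGroup H] [InnerProductSpace ℂ H]

/-- The vector `φ` behaves with respect to `P, Q` and `P', Q'` as the singlet with respect to
`σ_z ⊗ 1, σ_x ⊗ 1` and `-1 ⊗ σ_z, -1 ⊗ σ_x`. -/
structure IsSingletVector (P Q P' Q' : H →L[ℂ] H) (φ : H) : Prop where
  eq_P : P' φ = P φ
  eq_Q : Q' φ = Q φ
  sq_P : P (P φ) = φ
  sq_Q : Q (Q φ) = φ
  anti : Q (P φ) = -P (Q φ)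

/-- Alice's operator playing the role of `σ_z ⊗ 1`. -/
def Quintuple.opP (M : Quintuple H) (α γ : ℝ) : H →L[ℂ] H :=
  (((Real.sin (α + γ))⁻¹ : ℝ) : ℂ) • ((Real.sin γ : ℂ) • M.A 0 + (Real.sin α : ℂ) • M.A 1)

/-- Alice's operator playing the role of `σ_x ⊗ 1`. -/
def Quintuple.opQ (M : Quintuple H) (α γ : ℝ) : H →L[ℂ] H :=
  (((Real.sin (α + γ))⁻¹ : ℝ) : ℂ) • ((Real.cos γ : ℂ) • M.A 0 - (Real.cos α : ℂ) • M.A 1)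

/-- Bob's operator playing the role of `-1 ⊗ σ_x`. -/
def Quintuple.opQ' (M : Quintuple H) (α β : ℝ) : H →L[ℂ] H :=
  (((Real.sin (α + β))⁻¹ : ℝ) : ℂ) • (M.B 1 - (Real.cos (α + β) : ℂ) • M.B 0)

/-- `opP` and `opQ` solve the linear system formed by this equation and `Quintuple.A_one_eq`, whose
determinant is `-sin (α + γ)`. -/
theorem Quintuple.A_zero_eq (M : Quintuple H) {α γ : ℝ} (h : Real.sin (α + γ) ≠ 0) :
    M.A 0 = (Real.cos α : ℂ) • M.opP α γ + (Real.sin α : ℂ) • M.opQ α γ := by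
  have h' : (Real.sin (α + γ) : ℂ) ≠ 0 := by exact_mod_cast h
  have h2 := congrArg (fun r : ℝ => (r : ℂ)) (Real.sin_add α γ)
  simp only [opP, opQ]
  match_scalars
  · push_cast at h2 h' ⊢
    field_simp
    linear_combination h2
  · ring

theorem Quintuple.A_one_eq (M : Quintuple H) {α γ : ℝ} (h : Real.sin (α + γ) ≠ 0) :
    M.A 1 = (Real.cos γ : ℂ) • M.opP α γ - (Real.sin γ : ℂ) • M.opQ α γ := by
  have h' : (Real.sin (α + γ) : ℂ) ≠ 0 := by exact_mod_cast h
  have h2 := congrArg (fun r : ℝ => (r : ℂ)) (Real.sin_add α γ)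
  simp only [opP, opQ]
  match_scalars
  · push_cast at h2 h' ⊢
    field_simp
    linear_combination h2
  · ring

theorem Quintuple.B_one_eq (M : Quintuple H) {α β : ℝ} (h : Real.sin (α + β) ≠ 0) :
    M.B 1 = (Real.cos (α + β) : ℂ) • M.B 0 + (Real.sin (α + β) : ℂ) • M.opQ' α β := by
  have h' : (Real.sin (α + β) : ℂ) ≠ 0 := by exact_mod_cast h
  simp only [opQ']
  match_scalars
  · push_cast at h' ⊢
    field_simp
  · push_cast at h' ⊢
    field_simp
    ring

variable [CompleteSpace H]

/-- Rigidity: in a model for a correlation without deterministic part, the support of the state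
consists of singlet vectors. -/
theorem Quintuple.IsModelFor.isSingletVector {M : Quintuple H} {c : Correlation}
    (hM : M.IsModelFor c) (hc : ¬ HasDeterministicPart c) {α β γ : ℝ} (h : IsAngleParam c α β γ)
    (ψ : H) :
    IsSingletVector (M.opP α γ) (M.opQ α γ) (M.B 0) (M.opQ' α β) (sqrtOp M.ρ ψ) := by
  obtain ⟨hsA, hsB⟩ := h.sin_ne_zero hc
  obtain ⟨E, _, _, x, y, hv, hrel⟩ := hM.exists_vectorModel
  -- Here `c` is mixed with itself: the planar vectors with the given angles and the vectors of `M`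
  -- both realize `c`, so their relations have the same coefficients, which can be computed in the
  -- plane.
  obtain ⟨-, s, t, hst, hst', j, hj⟩ := IsVectorModel.eq_of_mixture hc h.isVectorModel hv
    (a := 1 / 2) (b := 1 / 2) (by norm_num) (by norm_num) (by norm_num)
    (by rw [← add_smul]; norm_num)
  obtain ⟨hB, hAA, hBB⟩ := hrel s t hst' ⟨j, hj⟩ ψ
  have hcomm : ∀ i j φ, M.A i (M.B j φ) = M.B j (M.A i φ) := fun i j φ =>
    congrArg (fun T : H →L[ℂ] H => T φ) (hM.1.commute i j)
  have e00 : s 0 * Real.cos α + t 0 * Real.cos γ = 1 := by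
    have := congrArg (fun v : EuclideanSpace ℝ (Fin 2) => v 0) (hst 0)
    simpa [unitVec] using this.symm
  have e01 : s 0 * Real.sin α - t 0 * Real.sin γ = 0 := by
    have := congrArg (fun v : EuclideanSpace ℝ (Fin 2) => v 1) (hst 0)
    simpa [unitVec, ← sub_eq_add_neg] using this.symm
  have e10 : s 1 * Real.cos α + t 1 * Real.cos γ = Real.cos (α + β) := by
    have := congrArg (fun v : EuclideanSpace ℝ (Fin 2) => v 0) (hst 1)
    simpa [unitVec] using this.symm
  have e11 : s 1 * Real.sin α - t 1 * Real.sin γ = Real.sin (α + β) := by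
    have := congrArg (fun v : EuclideanSpace ℝ (Fin 2) => v 1) (hst 1)
    simpa [unitVec, ← sub_eq_add_neg] using this.symm
  have hu : s j ^ 2 + t j ^ 2 + 2 * (s j * t j) * Real.cos (α + γ) = 1 := by
    have h1 : s j ^ 2 + t j ^ 2 + 2 * (s j * t j) * Real.cos (α + γ) =
        (s j * Real.cos α + t j * Real.cos γ) ^ 2 + (s j * Real.sin α - t j * Real.sin γ) ^ 2 := by
      rw [Real.cos_add]
      linear_combination -(s j ^ 2) * Real.sin_sq_add_cos_sq α -
        t j ^ 2 * Real.sin_sq_add_cos_sq γ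
    rw [h1]
    fin_cases j
    · simp only [Fin.zero_eta, e00, e01]
      norm_num
    · simp only [Fin.mk_one, e10, e11]
      rw [add_comm]
      exact Real.sin_sq_add_cos_sq _
  set φ := sqrtOp M.ρ ψ
  -- Expand `B j (B j φ) = φ`, where `B j` is moved past the `A i` before the relation is applied at
  -- `φ` again. Compare with the norm relation `hu` and divide by `s j * t j ≠ 0`.
  have hanti : M.A 0 (M.A 1 φ) + M.A 1 (M.A 0 φ) = ((2 * Real.cos (α + γ) : ℝ) : ℂ) • φ := by
    have h1 : ∀ i, M.B j (M.A i φ) = (s j : ℂ) • M.A i (M.A 0 φ) + (t j : ℂ) • M.A i (M.A 1 φ) :=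
      fun i => by rw [← hcomm, hB, map_add, map_smul, map_smul]
    have h2 := hBB j
    rw [hB j, map_add, map_smul, map_smul, h1, h1, hAA, hAA] at h2
    have h3 : ((s j * t j : ℝ) : ℂ) ≠ 0 := by exact_mod_cast hj
    refine smul_right_injective H h3 ?_
    have hu' := congrArg (fun r : ℝ => (r : ℂ)) hu
    push_cast at hu' ⊢
    have h4 : (s j : ℂ) • (s j : ℂ) • φ + (t j : ℂ) • (t j : ℂ) • φ +
        (2 * (s j * t j) * Complex.cos (α + γ) : ℂ) • φ = φ := by
      rw [smul_smul, smul_smul, ← add_smul, ← add_smul]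
      conv_rhs => rw [← one_smul ℂ φ]
      congr 1
      linear_combination hu'
    linear_combination (norm := module) h2 - h4
  have hs0 : s 0 = (Real.sin (α + γ))⁻¹ * Real.sin γ := by
    rw [eq_inv_mul_iff_mul_eq₀ hsA, Real.sin_add]
    linear_combination Real.sin γ * e00 + Real.cos γ * e01
  have ht0 : t 0 = (Real.sin (α + γ))⁻¹ * Real.sin α := by
    rw [eq_inv_mul_iff_mul_eq₀ hsA, Real.sin_add]
    linear_combination Real.sin α * e00 - Real.cos α * e01
  have hP : M.B 0 φ = M.opP α γ φ := by
    rw [hB 0, hs0, ht0]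
    simp only [opP, smul_apply, add_apply]
    push_cast
    module
  have hS : ((Real.sin (α + γ) : ℝ) : ℂ) ≠ 0 := by exact_mod_cast hsA
  have hA1A0 : M.A 1 (M.A 0 φ) = ((2 * Real.cos (α + γ) : ℝ) : ℂ) • φ - M.A 0 (M.A 1 φ) := by
    rw [← hanti]
    abel
  have hT : ((Real.sin (α + β) : ℝ) : ℂ) ≠ 0 := by exact_mod_cast hsB
  refine ⟨hP, ?_, ?_, ?_, ?_⟩
  · refine smul_right_injective H hT ?_
    have h1 := congrArg (fun T : H →L[ℂ] H => T φ) (M.B_one_eq hsB)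
    have h2 := congrArg (fun T : H →L[ℂ] H => T φ) (M.A_zero_eq hsA)
    have h3 := congrArg (fun T : H →L[ℂ] H => T φ) (M.A_one_eq hsA)
    simp only [add_apply, sub_apply, smul_apply, hP] at h1 h2 h3
    rw [hB 1, h2, h3, ← e10, ← e11] at h1
    rw [← e11]
    push_cast at h1 ⊢
    linear_combination (norm := module) -h1
  · rw [← hP, show M.opP α γ (M.B 0 φ) = M.B 0 (M.opP α γ φ) by
      simp only [opP, smul_apply, add_apply, hcomm, map_smul, map_add], ← hP, hBB]
  · have key : Real.cos γ ^ 2 + Real.cos α ^ 2 - Real.cos γ * Real.cos α * (2 * Real.cos (α + γ)) =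
        Real.sin (α + γ) ^ 2 := by
      rw [Real.cos_add, Real.sin_add]
      linear_combination -(Real.cos γ ^ 2) * Real.sin_sq_add_cos_sq α -
        Real.cos α ^ 2 * Real.sin_sq_add_cos_sq γ
    have key' := congrArg (fun r : ℝ => (r : ℂ)) key
    simp only [opQ, smul_apply, sub_apply, map_smul, map_sub, hAA, hA1A0]
    match_scalars
    · push_cast at key' hS ⊢
      field_simp
      linear_combination key'
    · ring
  · have key : Real.sin γ * Real.cos γ * 2 - Real.sin α * Real.cos α * 2 -
        (Real.sin γ * Real.cos α - Real.sin α * Real.cos γ) * (2 * Real.cos (α + γ)) = 0 := by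
      rw [Real.cos_add]
      linear_combination -2 * Real.sin γ * Real.cos γ * Real.sin_sq_add_cos_sq α +
        2 * Real.sin α * Real.cos α * Real.sin_sq_add_cos_sq γ
    have key' := congrArg (fun r : ℝ => (r : ℂ)) key
    simp only [opQ, opP, smul_apply, sub_apply, add_apply, map_smul, map_sub, map_add, hAA, hA1A0]
    match_scalars
    · push_cast at key' hS ⊢
      field_simp
      linear_combination key'
    · ring

end SingletVectors

/-! ### The copy of `ℂ⁴` generated by a singlet vector. -/

section SingletSpace

variable {H : Type} [NormedAddCommGroup H] [InnerProductSpace ℂ H]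

/-- Two commuting pairs of self-adjoint operators. -/
structure IsCommutingPairs [CompleteSpace H] (P Q P' Q' : H →L[ℂ] H) : Prop where
  selfAdjoint_P : IsSelfAdjoint P
  selfAdjoint_Q : IsSelfAdjoint Q
  selfAdjoint_P' : IsSelfAdjoint P'
  selfAdjoint_Q' : IsSelfAdjoint Q'
  comm_PP' : ∀ φ, P (P' φ) = P' (P φ)
  comm_PQ' : ∀ φ, P (Q' φ) = Q' (P φ)
  comm_QP' : ∀ φ, Q (P' φ) = P' (Q φ)
  comm_QQ' : ∀ φ, Q (Q' φ) = Q' (Q φ)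

/-- The operator embedding a singlet vector `φ` as the vector corresponding to `v ⊗ φ`. -/
def spread (P Q : H →L[ℂ] H) (v : TwoQubit) : H →L[ℂ] H :=
  -- These are the coefficients of `v` in the Bell basis formed by the singlet and its images under
  -- `σ_z ⊗ 1`, `σ_x ⊗ 1` and their product.
  (((√2)⁻¹ : ℝ) : ℂ) • ((v 1 - v 2) • 1 + (v 1 + v 2) • P + (v 3 - v 0) • Q -
    (v 3 + v 0) • (P * Q))

theorem spread_apply (P Q : H →L[ℂ] H) (v : TwoQubit) (φ : H) : spread P Q v φ =
    (((√2)⁻¹ : ℝ) : ℂ) • ((v 1 - v 2) • φ + (v 1 + v 2) • P φ + (v 3 - v 0) • Q φ -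
    (v 3 + v 0) • P (Q φ)) := rfl

theorem spread_add (P Q : H →L[ℂ] H) (v w : TwoQubit) :
    spread P Q (v + w) = spread P Q v + spread P Q w := by
  simp only [spread, PiLp.add_apply]
  module

theorem spread_smul (P Q : H →L[ℂ] H) (z : ℂ) (v : TwoQubit) :
    spread P Q (z • v) = z • spread P Q v := by
  simp only [spread, PiLp.smul_apply, smul_eq_mul]
  module

theorem ofReal_sqrt_two_sq : ((√2 : ℝ) : ℂ) ^ 2 = 2 := by
  norm_cast
  simp

theorem ofReal_sqrt_two_ne_zero : ((√2 : ℝ) : ℂ) ≠ 0 := by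
  intro h
  have := ofReal_sqrt_two_sq
  rw [h] at this
  norm_num at this

theorem spread_singlet (P Q : H →L[ℂ] H) (φ : H) : spread P Q singlet φ = φ := by
  have h := ofReal_sqrt_two_sq
  have h0 := ofReal_sqrt_two_ne_zero
  rw [spread_apply]
  simp only [singlet]
  simp
  rw [← sub_eq_zero]
  match_scalars
  field_simp
  linear_combination -h

/-- The Pauli relations are known only at `φ`. To use them at `Q φ`, this vector is rewritten as `Q'
φ`; then `Q'` commutes with `P` and `Q`, which act on `φ` itself. -/
theorem spread_left {P Q P' Q' : H →L[ℂ] H} [CompleteSpace H] (hc : IsCommutingPairs P Q P' Q')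
    {φ : H} (hφ : IsSingletVector P Q P' Q' φ) (a b : ℝ) (v : TwoQubit) :
    (a : ℂ) • P (spread P Q v φ) + (b : ℂ) • Q (spread P Q v φ) =
      spread P Q (realOp (leftMat a b) v) φ := by
  have h1 : P (P (Q φ)) = Q φ := by
    rw [← hφ.eq_Q, hc.comm_PQ', hc.comm_PQ', hφ.sq_P]
  have h2 : Q (P (Q φ)) = -P φ := by
    rw [← hφ.eq_Q, hc.comm_PQ', hc.comm_QQ', hφ.anti, map_neg, ← hc.comm_PQ', ← hc.comm_QQ',
      hφ.eq_Q, hφ.sq_Q]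
  simp only [spread_apply, map_smul, map_add, map_sub, hφ.sq_P, hφ.sq_Q, hφ.anti, h1, h2,
    realOp_apply, Fin.sum_univ_four, leftMat]
  simp
  module

theorem spread_right {P Q P' Q' : H →L[ℂ] H} [CompleteSpace H] (hc : IsCommutingPairs P Q P' Q')
    {φ : H} (hφ : IsSingletVector P Q P' Q' φ) (a b : ℝ) (v : TwoQubit) :
    (a : ℂ) • P' (spread P Q v φ) + (b : ℂ) • Q' (spread P Q v φ) =
      spread P Q (realOp (rightMat (-a) (-b)) v) φ := by
  have h1 : P (P (Q φ)) = Q φ := by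
    rw [← hφ.eq_Q, hc.comm_PQ', hc.comm_PQ', hφ.sq_P]
  simp only [spread_apply, map_smul, map_add, map_sub, ← hc.comm_PP', ← hc.comm_PQ',
    ← hc.comm_QP', ← hc.comm_QQ', hφ.eq_P, hφ.eq_Q, hφ.sq_P, hφ.sq_Q, hφ.anti, h1, map_neg,
    realOp_apply, Fin.sum_univ_four, rightMat]
  simp
  module

/-- The four Bell components are mutually orthogonal because `⟨φ, P ψ⟩`, `⟨φ, Q ψ⟩` and `⟨φ, P (Q
ψ)⟩` vanish. Each equals its own negative: transferring an operator from Alice to Bob on the side of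
`φ`, and back on the side of `ψ`, reverses a product of anticommuting factors. -/
theorem inner_spread {P Q P' Q' : H →L[ℂ] H} [CompleteSpace H] (hc : IsCommutingPairs P Q P' Q')
    {φ ψ : H} (hφ : IsSingletVector P Q P' Q' φ) (hψ : IsSingletVector P Q P' Q' ψ)
    (v w : TwoQubit) :
    inner ℂ (spread P Q v φ) (spread P Q w ψ) = inner ℂ v w * inner ℂ φ ψ := by
  have sP : ∀ x y, inner ℂ (P x) y = inner ℂ x (P y) := hc.selfAdjoint_P.isSymmetric
  have sQ : ∀ x y, inner ℂ (Q x) y = inner ℂ x (Q y) := hc.selfAdjoint_Q.isSymmetric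
  have sP' : ∀ x y, inner ℂ (P' x) y = inner ℂ x (P' y) := hc.selfAdjoint_P'.isSymmetric
  have sQ' : ∀ x y, inner ℂ (Q' x) y = inner ℂ x (Q' y) := hc.selfAdjoint_Q'.isSymmetric
  have hPPQ : P (P (Q ψ)) = Q ψ := by
    rw [← hψ.eq_Q, hc.comm_PQ', hc.comm_PQ', hψ.sq_P]
  have hQPQ : Q (P (Q ψ)) = -P ψ := by
    rw [← hψ.eq_Q, hc.comm_PQ', hc.comm_QQ', hψ.anti, map_neg, ← hc.comm_PQ', ← hc.comm_QQ',
      hψ.eq_Q, hψ.sq_Q]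
  have swapP : ∀ z, inner ℂ φ (P z) = inner ℂ φ (P' z) := fun z => by
    rw [← sP, ← sP', hφ.eq_P]
  have swapQ : ∀ z, inner ℂ φ (Q z) = inner ℂ φ (Q' z) := fun z => by
    rw [← sQ, ← sQ', hφ.eq_Q]
  have hP : inner ℂ φ (P ψ) = 0 := by
    have h := swapQ (P (Q ψ))
    rw [hQPQ, inner_neg_right, ← hc.comm_PQ', ← hc.comm_QQ', hψ.eq_Q, hψ.sq_Q] at h
    exact self_eq_neg.mp h.symm
  have hQ : inner ℂ φ (Q ψ) = 0 := by
    have h := swapP (Q (P ψ))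
    rw [← hc.comm_QP', ← hc.comm_PP', hψ.eq_P, hψ.sq_P, hψ.anti, map_neg, hPPQ,
      inner_neg_right] at h
    exact self_eq_neg.mp h.symm
  have hPQ : inner ℂ φ (P (Q ψ)) = 0 := by
    have h := swapP (Q ψ)
    rw [← hc.comm_QP', hψ.eq_P, hψ.anti, inner_neg_right] at h
    exact self_eq_neg.mp h
  simp only [spread_apply, inner_smul_left, inner_smul_right, inner_add_left, inner_add_right,
    inner_sub_left, inner_sub_right, sP, sQ, hψ.sq_P, hψ.sq_Q, hψ.anti, hPPQ, hQPQ, hP, hQ, hPQ,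
    inner_neg_right, PiLp.inner_apply, Fin.sum_univ_four, RCLike.inner_apply]
  have h := ofReal_sqrt_two_sq
  have h0 := ofReal_sqrt_two_ne_zero
  simp
  field_simp
  rw [h]
  ring

end SingletSpace

/-! ### The subspace of singlet vectors and the action of the algebra on it. -/

section SingletSubspace

variable {H : Type} [NormedAddCommGroup H] [InnerProductSpace ℂ H]

/-- The closed subspace of singlet vectors of a quintuple. -/
def Quintuple.singletSpace (M : Quintuple H) (α β γ : ℝ) : Submodule ℂ H where
  carrier := {φ | IsSingletVector (M.opP α γ) (M.opQ α γ) (M.B 0) (M.opQ' α β) φ}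
  add_mem' h h' :=
    ⟨by rw [map_add, map_add, h.eq_P, h'.eq_P], by rw [map_add, map_add, h.eq_Q, h'.eq_Q],
      by rw [map_add, map_add, h.sq_P, h'.sq_P], by rw [map_add, map_add, h.sq_Q, h'.sq_Q],
      by simp only [map_add, h.anti, h'.anti, neg_add]⟩
  zero_mem' := by constructor <;> simp
  smul_mem' z φ h :=
    ⟨by rw [map_smul, map_smul, h.eq_P], by rw [map_smul, map_smul, h.eq_Q],
      by rw [map_smul, map_smul, h.sq_P], by rw [map_smul, map_smul, h.sq_Q],
      by simp only [map_smul, h.anti, smul_neg]⟩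

theorem Quintuple.isClosed_singletSpace (M : Quintuple H) (α β γ : ℝ) :
    IsClosed (M.singletSpace α β γ : Set H) := by
  have : (M.singletSpace α β γ : Set H) = {φ | M.B 0 φ = M.opP α γ φ} ∩
      {φ | M.opQ' α β φ = M.opQ α γ φ} ∩ {φ | M.opP α γ (M.opP α γ φ) = φ} ∩
      {φ | M.opQ α γ (M.opQ α γ φ) = φ} ∩
      {φ | M.opQ α γ (M.opP α γ φ) = -M.opP α γ (M.opQ α γ φ)} := by
    ext φ
    exact ⟨fun h => ⟨⟨⟨⟨h.eq_P, h.eq_Q⟩, h.sq_P⟩, h.sq_Q⟩, h.anti⟩,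
      fun ⟨⟨⟨⟨h1, h2⟩, h3⟩, h4⟩, h5⟩ => ⟨h1, h2, h3, h4, h5⟩⟩
  rw [this]
  refine IsClosed.inter (IsClosed.inter (IsClosed.inter (IsClosed.inter ?_ ?_) ?_) ?_) ?_ <;>
    exact isClosed_eq (by fun_prop) (by fun_prop)

/-- Elements of the generated algebra preserve closed subspaces preserved by the generators. -/
theorem Quintuple.apply_mem_of_mem_alg {M : Quintuple H} {V : Submodule ℂ H}
    (hV : IsClosed (V : Set H)) (hA : ∀ i, ∀ v ∈ V, M.A i v ∈ V) (hB : ∀ j, ∀ v ∈ V, M.B j v ∈ V)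
    {X : H →L[ℂ] H} (hX : X ∈ M.alg) {v : H} (hv : v ∈ V) : X v ∈ V := by
  have h : Set.MapsTo (fun X : H →L[ℂ] H => X v)
      (Algebra.adjoin ℂ (Set.range M.A ∪ Set.range M.B) : Set (H →L[ℂ] H)) (V : Set H) := by
    intro Y hY
    revert v
    induction hY using Algebra.adjoin_induction with
    | mem X hX =>
      rcases hX with ⟨i, rfl⟩ | ⟨j, rfl⟩
      · exact fun hv => hA i _ hv
      · exact fun hv => hB j _ hv
    | algebraMap r =>
      intro v hv
      rw [Algebra.algebraMap_eq_smul_one]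
      exact V.smul_mem r hv
    | add X Y _ _ hX hY => exact fun hv => V.add_mem (hX hv) (hY hv)
    | mul X Y _ _ hX hY => exact fun hv => hX (hY hv)
  have := map_mem_closure (f := fun X : H →L[ℂ] H => X v) (by fun_prop) hX h
  rwa [hV.closure_eq] at this

variable [CompleteSpace H]

theorem Quintuple.IsModel.isCommutingPairs {M : Quintuple H} (hM : M.IsModel) (α β γ : ℝ) :
    IsCommutingPairs (M.opP α γ) (M.opQ α γ) (M.B 0) (M.opQ' α β) := by
  have hcomm : ∀ i j φ, M.A i (M.B j φ) = M.B j (M.A i φ) := fun i j φ =>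
    congrArg (fun T : H →L[ℂ] H => T φ) (hM.commute i j)
  have hr : ∀ (r : ℝ) {T : H →L[ℂ] H}, IsSelfAdjoint T → IsSelfAdjoint ((r : ℂ) • T) :=
    fun r T hT => IsSelfAdjoint.smul (by simp [IsSelfAdjoint]) hT
  have hA := hM.selfAdjoint_A
  have hB := hM.selfAdjoint_B
  refine ⟨hr _ ((hr _ (hA 0)).add (hr _ (hA 1))), hr _ ((hr _ (hA 0)).sub (hr _ (hA 1))), hB 0,
    hr _ ((hB 1).sub (hr _ (hB 0))), fun φ => ?_, fun φ => ?_, fun φ => ?_, fun φ => ?_⟩ <;>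
  simp only [opP, opQ, opQ', smul_apply, add_apply, sub_apply, map_smul, map_add, map_sub, hcomm]
  all_goals module

theorem Quintuple.IsModel.A_spread {M : Quintuple H} (hM : M.IsModel) {α β γ : ℝ}
    (h : Real.sin (α + γ) ≠ 0) {φ : H} (hφ : φ ∈ M.singletSpace α β γ) (i : Fin 2)
    (v : TwoQubit) :
    M.A i (spread (M.opP α γ) (M.opQ α γ) v φ) =
      spread (M.opP α γ) (M.opQ α γ) ((explicitModel α β γ).A i v) φ := by
  fin_cases i
  · have := spread_left (hM.isCommutingPairs α β γ) hφ (Real.cos α) (Real.sin α) v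
    simp only [Fin.zero_eta]
    conv_lhs => rw [M.A_zero_eq h]
    exact this
  · have := spread_left (hM.isCommutingPairs α β γ) hφ (Real.cos (-γ)) (Real.sin (-γ)) v
    simp only [Fin.mk_one]
    conv_lhs => rw [M.A_one_eq h]
    refine Eq.trans ?_ this
    rw [Real.cos_neg, Real.sin_neg, Complex.ofReal_neg, neg_smul, ← sub_eq_add_neg]
    rfl

theorem Quintuple.IsModel.B_spread {M : Quintuple H} (hM : M.IsModel) {α β γ : ℝ}
    (h : Real.sin (α + β) ≠ 0) {φ : H} (hφ : φ ∈ M.singletSpace α β γ) (j : Fin 2)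
    (v : TwoQubit) :
    M.B j (spread (M.opP α γ) (M.opQ α γ) v φ) =
      spread (M.opP α γ) (M.opQ α γ) ((explicitModel α β γ).B j v) φ := by
  fin_cases j
  · have := spread_right (hM.isCommutingPairs α β γ) hφ 1 0 v
    simp only [Complex.ofReal_one, Complex.ofReal_zero, one_smul, zero_smul, add_zero] at this
    refine Eq.trans this ?_
    change spread _ _ (realOp (rightMat (-1) (-0)) v) φ =
      spread _ _ (realOp (rightMat (Real.cos Real.pi) (Real.sin Real.pi)) v) φ
    rw [Real.cos_pi, Real.sin_pi, neg_zero]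
  · have := spread_right (hM.isCommutingPairs α β γ) hφ (Real.cos (α + β)) (Real.sin (α + β)) v
    simp only [Fin.mk_one]
    conv_lhs => rw [M.B_one_eq h]
    refine Eq.trans this ?_
    change _ = spread _ _ (realOp (rightMat (Real.cos (α + β + Real.pi))
      (Real.sin (α + β + Real.pi))) v) φ
    rw [Real.cos_add_pi, Real.sin_add_pi]

/-- On singlet vectors, expectations of elements of the generated algebra are scalars. -/
theorem Quintuple.IsModel.inner_apply_mul_inner {M : Quintuple H} (hM : M.IsModel) {α β γ : ℝ}
    (hsA : Real.sin (α + γ) ≠ 0) (hsB : Real.sin (α + β) ≠ 0) {X : H →L[ℂ] H} (hX : X ∈ M.alg)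
    {φ φ' ψ ψ' : H} (hφ : φ ∈ M.singletSpace α β γ) (hφ' : φ' ∈ M.singletSpace α β γ)
    (hψ : ψ ∈ M.singletSpace α β γ) (hψ' : ψ' ∈ M.singletSpace α β γ) :
    inner ℂ φ' (X φ) * inner ℂ ψ' ψ = inner ℂ ψ' (X ψ) * inner ℂ φ' φ := by
  have key : ∀ Y ∈ Algebra.adjoin ℂ (Set.range M.A ∪ Set.range M.B), ∃ T : TwoQubit → TwoQubit,
      ∀ v, ∀ φ ∈ M.singletSpace α β γ, Y (spread (M.opP α γ) (M.opQ α γ) v φ) =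
        spread (M.opP α γ) (M.opQ α γ) (T v) φ := by
    intro Y hY
    induction hY using Algebra.adjoin_induction with
    | mem X hX =>
      rcases hX with ⟨i, rfl⟩ | ⟨j, rfl⟩
      · exact ⟨_, fun v φ hφ => hM.A_spread hsA hφ i v⟩
      · exact ⟨_, fun v φ hφ => hM.B_spread hsB hφ j v⟩
    | algebraMap r =>
      refine ⟨fun v => r • v, fun v φ hφ => ?_⟩
      rw [Algebra.algebraMap_eq_smul_one, spread_smul]
      rfl
    | add X Y _ _ hX hY =>
      obtain ⟨S, hS⟩ := hX
      obtain ⟨T, hT⟩ := hY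
      refine ⟨fun v => S v + T v, fun v φ hφ => ?_⟩
      rw [add_apply, hS _ _ hφ, hT _ _ hφ, spread_add, add_apply]
    | mul X Y _ _ hX hY =>
      obtain ⟨S, hS⟩ := hX
      obtain ⟨T, hT⟩ := hY
      exact ⟨fun v => S (T v), fun v φ hφ => by rw [mul_apply_eq_comp, hT _ _ hφ, hS _ _ hφ]⟩
  -- The cross-multiplied identity is closed in `X`, so it passes from polynomials in the generators
  -- to the norm closure without constructing the `ℂ⁴` operator of a limit.
  have hcl : IsClosed {X : H →L[ℂ] H |
      inner ℂ φ' (X φ) * inner ℂ ψ' ψ = inner ℂ ψ' (X ψ) * inner ℂ φ' φ} :=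
    isClosed_eq (by fun_prop) (by fun_prop)
  refine closure_minimal (fun Y hY => ?_) hcl hX
  obtain ⟨T, hT⟩ := key Y hY
  have h : ∀ φ ∈ M.singletSpace α β γ, ∀ φ' ∈ M.singletSpace α β γ,
      inner ℂ φ' (Y φ) = inner ℂ singlet (T singlet) * inner ℂ φ' φ := by
    intro φ hφ φ' hφ'
    conv_lhs => rw [← spread_singlet (M.opP α γ) (M.opQ α γ) φ, hT _ _ hφ,
      ← spread_singlet (M.opP α γ) (M.opQ α γ) φ']
    exact inner_spread (hM.isCommutingPairs α β γ) hφ' hφ _ _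
  change inner ℂ φ' (Y φ) * inner ℂ ψ' ψ = inner ℂ ψ' (Y ψ) * inner ℂ φ' φ
  rw [h φ hφ φ' hφ', h ψ hψ ψ' hψ']
  ring

end SingletSubspace

/-! ### Algebraic security and its cryptographic consequence. -/

section Security

/-- Compressed to singlet vectors, `X` is a scalar `χ`. An operator `E` in the commutant preserves
the relations defining singlet vectors, so `tr (ρ X E) = χ tr (ρ E)`; taking `E = 1` identifies `χ`
as `tr (ρ X)`. -/
theorem isAlgebraicallySecure_of_not_hasDeterministicPart {c : Correlation}
    (hq : c ∈ quantumSet) (hc : ¬ HasDeterministicPart c) : IsAlgebraicallySecure c := by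
  obtain ⟨α, β, γ, h⟩ := exists_isAngleParam hq hc
  obtain ⟨hsA, hsB⟩ := h.sin_ne_zero hc
  intro H _ _ _ _ M hM X hX E hE
  have hρ := hM.1.density
  have hN : ∀ ψ, sqrtOp M.ρ ψ ∈ M.singletSpace α β γ := hM.isSingletVector hc h
  have hgenA : ∀ i φ, E (M.A i φ) = M.A i (E φ) := fun i φ =>
    congrArg (fun T : H →L[ℂ] H => T φ)
      (hE _ (Subalgebra.le_topologicalClosure _ (Algebra.subset_adjoin (Or.inl ⟨i, rfl⟩))))
  have hgenB : ∀ i φ, E (M.B i φ) = M.B i (E φ) := fun i φ =>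
    congrArg (fun T : H →L[ℂ] H => T φ)
      (hE _ (Subalgebra.le_topologicalClosure _ (Algebra.subset_adjoin (Or.inr ⟨i, rfl⟩))))
  have hP : ∀ φ, E (M.opP α γ φ) = M.opP α γ (E φ) := fun φ => by
    simp only [Quintuple.opP, smul_apply, add_apply, map_smul, map_add, hgenA]
  have hQ : ∀ φ, E (M.opQ α γ φ) = M.opQ α γ (E φ) := fun φ => by
    simp only [Quintuple.opQ, smul_apply, sub_apply, map_smul, map_sub, hgenA]
  have hQ' : ∀ φ, E (M.opQ' α β φ) = M.opQ' α β (E φ) := fun φ => by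
    simp only [Quintuple.opQ', smul_apply, sub_apply, map_smul, map_sub, hgenB]
  have hEN : ∀ φ ∈ M.singletSpace α β γ, E φ ∈ M.singletSpace α β γ := fun φ hφ =>
    ⟨by rw [← hgenB, ← hP, hφ.eq_P], by rw [← hQ', ← hQ, hφ.eq_Q],
      by rw [← hP, ← hP, hφ.sq_P], by rw [← hQ, ← hQ, hφ.sq_Q],
      by rw [← hP, ← hQ, ← hQ, ← hP, hφ.anti, map_neg]⟩
  obtain ⟨k, hk⟩ : ∃ k, sqrtOp M.ρ (traceBasis H k) ≠ 0 := by
    by_contra! hall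
    have := hρ.hasSum_norm_sq
    simp only [hall, norm_zero, ne_eq, OfNat.ofNat_ne_zero, not_false_eq_true, zero_pow] at this
    exact zero_ne_one (hasSum_zero.unique this)
  set ψ := sqrtOp M.ρ (traceBasis H k)
  have hψψ : inner ℂ ψ ψ ≠ (0 : ℂ) := inner_self_ne_zero.mpr hk
  set χ : ℂ := inner ℂ ψ (X ψ) / inner ℂ ψ ψ with hχ
  have hscal : ∀ φ ∈ M.singletSpace α β γ, ∀ φ' ∈ M.singletSpace α β γ,
      inner ℂ φ' (X φ) = χ * inner ℂ φ' φ := by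
    intro φ hφ φ' hφ'
    have := hM.1.inner_apply_mul_inner hsA hsB hX hφ hφ' (hN _) (hN _) (ψ := ψ) (ψ' := ψ)
    rw [hχ, div_mul_eq_mul_div, eq_div_iff hψψ, this]
  have hXE : ∀ Y : H →L[ℂ] H, (∀ φ ∈ M.singletSpace α β γ, Y φ ∈ M.singletSpace α β γ) →
      opTrace (M.ρ * (X * Y)) = χ * opTrace (M.ρ * Y) := by
    intro Y hY
    refine (hρ.hasSum_opTrace (X * Y)).unique ?_
    have h2 := (hρ.hasSum_opTrace Y).mul_left χ
    have h3 : ∀ i, inner ℂ (sqrtOp M.ρ (traceBasis H i)) ((X * Y) (sqrtOp M.ρ (traceBasis H i))) =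
        χ * inner ℂ (sqrtOp M.ρ (traceBasis H i)) (Y (sqrtOp M.ρ (traceBasis H i))) := fun i =>
      hscal _ (hY _ (hN _)) _ (hN _)
    simpa only [h3] using h2
  have h1 := hXE E hEN
  have h2 := hXE 1 fun φ hφ => hφ
  rw [mul_one, mul_one, hρ.2, mul_one] at h2
  rw [hE X hX, h1, h2, mul_comm]

theorem IsAlgebraicallySecure.isCryptographicallySecure {c : Correlation}
    (h : IsAlgebraicallySecure c) {p : Behavior} (hp : p.2.2 = c) :
    IsCryptographicallySecure p := by
  intro H _ _ _ _ M hM E _ _ hE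
  have hM' : M.IsModelFor c := ⟨hM.1, fun i j => by rw [hM.2.2.2, hp]⟩
  have hA : ∀ i, M.A i ∈ M.alg := fun i =>
    Subalgebra.le_topologicalClosure _ (Algebra.subset_adjoin (Or.inl ⟨i, rfl⟩))
  have hB : ∀ j, M.B j ∈ M.alg := fun j =>
    Subalgebra.le_topologicalClosure _ (Algebra.subset_adjoin (Or.inr ⟨j, rfl⟩))
  exact ⟨fun i => h H M hM' _ (hA i) E hE, fun j => h H M hM' _ (hB j) E hE,
    fun i j => h H M hM' _ (M.alg.mul_mem (hA i) (hB j)) E hE⟩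

end Security

/-! ### The decomposition of the Hilbert space as `(ℂ⁴ ⊗ L) ⊕ H₀`. -/

section CanonicalForm

variable {H L : Type} [NormedAddCommGroup H] [InnerProductSpace ℂ H]
  [NormedAddCommGroup L] [InnerProductSpace ℂ L]

/-- The map `ℂ⁴ ⊗ L → H` induced by `spread` and an embedding of `L` in `H`. -/
def spreadLin (P Q : H →L[ℂ] H) (ι : L →ₗᵢ[ℂ] H) : TwoQubit ⊗[ℂ] L →ₗ[ℂ] H :=
  TensorProduct.lift (LinearMap.mk₂ ℂ (fun v φ => spread P Q v (ι φ))
    (fun v w φ => by rw [spread_add]; rfl) (fun z v φ => by rw [spread_smul]; rfl)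
    (fun v φ ψ => by rw [map_add, map_add]) (fun z v φ => by rw [map_smul, map_smul]))

theorem spreadLin_tmul (P Q : H →L[ℂ] H) (ι : L →ₗᵢ[ℂ] H) (v : TwoQubit) (φ : L) :
    spreadLin P Q ι (v ⊗ₜ φ) = spread P Q v (ι φ) := rfl

variable [CompleteSpace H] {P Q P' Q' : H →L[ℂ] H}

theorem inner_spreadLin (hc : IsCommutingPairs P Q P' Q') {ι : L →ₗᵢ[ℂ] H}
    (hι : ∀ φ, IsSingletVector P Q P' Q' (ι φ)) (t t' : TwoQubit ⊗[ℂ] L) :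
    inner ℂ (spreadLin P Q ι t) (spreadLin P Q ι t') = inner ℂ t t' := by
  induction t with
  | zero => simp
  | add x y hx hy => rw [map_add, inner_add_left, inner_add_left, hx, hy]
  | tmul v φ =>
    induction t' with
    | zero => simp
    | add x y hx hy => rw [map_add, inner_add_right, inner_add_right, hx, hy]
    | tmul w ψ =>
      rw [spreadLin_tmul, spreadLin_tmul, inner_spread hc (hι φ) (hι ψ),
        TensorProduct.inner_tmul, ι.inner_map_map]

theorem isClosed_range_spreadLin [CompleteSpace L] (hc : IsCommutingPairs P Q P' Q')
    {ι : L →ₗᵢ[ℂ] H} (hι : ∀ φ, IsSingletVector P Q P' Q' (ι φ)) :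
    IsClosed ((LinearMap.range (spreadLin P Q ι) : Submodule ℂ H) : Set H) := by
  -- The four embeddings `φ ↦ e k ⊗ φ`. The range is the fixed space of the bounded operator `∑ k, J
  -- k (J k)*`, hence closed.
  let J : Fin 4 → (L →L[ℂ] H) := fun k =>
    spread P Q (EuclideanSpace.single k 1) ∘L ι.toContinuousLinearMap
  have hJ : ∀ k v (φ : L),
      ContinuousLinearMap.adjoint (J k) (spread P Q v (ι φ)) = v k • φ := by
    intro k v φ
    refine ext_inner_left ℂ fun ψ => ?_
    rw [ContinuousLinearMap.adjoint_inner_right]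
    change inner ℂ (spread P Q _ (ι ψ)) _ = _
    rw [inner_spread hc (hι ψ) (hι φ), EuclideanSpace.inner_single_left,
      inner_smul_right, ι.inner_map_map]
    simp
  have hrange : ((LinearMap.range (spreadLin P Q ι) : Submodule ℂ H) : Set H) =
      {u | ∑ k, J k (ContinuousLinearMap.adjoint (J k) u) = u} := by
    ext u
    constructor
    · rintro ⟨t, rfl⟩
      change ∑ k, J k (ContinuousLinearMap.adjoint (J k) (spreadLin P Q ι t)) =
        spreadLin P Q ι t
      induction t with
      | zero => simp
      | add x y hx hy => simp only [map_add, Finset.sum_add_distrib, hx, hy]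
      | tmul v φ =>
        simp only [spreadLin_tmul, hJ, map_smul]
        have hv : v = ∑ k, v k • EuclideanSpace.single k (1 : ℂ) := by
          ext i
          fin_cases i <;> simp [Fin.sum_univ_four]
        conv_rhs => rw [hv]
        simp only [Fin.sum_univ_four, spread_add, spread_smul, add_apply, smul_apply]
        rfl
    · intro hu
      have hu' : ∑ k, J k (ContinuousLinearMap.adjoint (J k) u) = u := hu
      rw [← hu']
      exact Submodule.sum_mem _ fun k _ =>
        ⟨EuclideanSpace.single k 1 ⊗ₜ ContinuousLinearMap.adjoint (J k) u, rfl⟩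
  rw [hrange]
  exact isClosed_eq (by fun_prop) continuous_id

theorem inner_left_eq_of_isSelfAdjoint {T : H →L[ℂ] H} (hT : IsSelfAdjoint T) (x y : H) :
    inner ℂ (T x) y = inner ℂ x (T y) := hT.isSymmetric x y

/-- A model whose state is supported in the space of singlet vectors has the canonical form. -/
theorem Quintuple.IsModel.hasCanonicalForm_of_isometry [CompleteSpace L]
    [TopologicalSpace.SeparableSpace H] [TopologicalSpace.SeparableSpace L] {M : Quintuple H}
    (hM : M.IsModel) {α β γ : ℝ} (hsA : Real.sin (α + γ) ≠ 0) (hsB : Real.sin (α + β) ≠ 0)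
    (ι : L →ₗᵢ[ℂ] H) (hι : ∀ φ, ι φ ∈ M.singletSpace α β γ)
    (hN : ∀ ψ, ∃ φ, ι φ = sqrtOp M.ρ ψ) :
    M.HasCanonicalForm (explicitModel α β γ) := by
  have : SecondCountableTopology H := UniformSpace.secondCountable_of_separable H
  have hc := hM.isCommutingPairs α β γ
  let S := spreadLin (M.opP α γ) (M.opQ α γ) ι
  let G : Submodule ℂ H := LinearMap.range S
  have : CompleteSpace G := (isClosed_range_spreadLin hc hι).completeSpace_coe
  have hρsa := hM.density.1.isSelfAdjoint
  -- the factorization of the square root of the state through the embedding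
  let ι' : L →L[ℂ] H := ι.toContinuousLinearMap
  let T : H →L[ℂ] L := ContinuousLinearMap.adjoint ι' ∘L sqrtOp M.ρ
  have hιT : ∀ ψ, ι (T ψ) = sqrtOp M.ρ ψ := fun ψ => by
    obtain ⟨φ, hφ⟩ := hN ψ
    have h1 : T ψ = φ := by
      refine ext_inner_left ℂ fun x => ?_
      change inner ℂ x (ContinuousLinearMap.adjoint ι' (sqrtOp M.ρ ψ)) = _
      rw [ContinuousLinearMap.adjoint_inner_right, ← hφ]
      exact ι.inner_map_map x φ
    rw [h1, hφ]
  have hT : ∀ f : L, ContinuousLinearMap.adjoint T f = sqrtOp M.ρ (ι f) := fun f => by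
    refine ext_inner_left ℂ fun x => ?_
    rw [ContinuousLinearMap.adjoint_inner_right, ← inner_sqrtOp, ← hιT, ι.inner_map_map]
  have hρι : ∀ ψ, ι (T (sqrtOp M.ρ ψ)) = M.ρ ψ := fun ψ => by
    rw [hιT, sqrtOp_sqrtOp hM.density.1]
  have hNG : ∀ φ, ι φ ∈ G := fun φ => ⟨singlet ⊗ₜ φ, spread_singlet _ _ _⟩
  -- the unitary
  let W₀ : WithLp 2 ((TwoQubit ⊗[ℂ] L) × Gᗮ) →ₗ[ℂ] H :=
    (S ∘ₗ LinearMap.fst ℂ _ _ + Gᗮ.subtype ∘ₗ LinearMap.snd ℂ _ _) ∘ₗ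
      (WithLp.linearEquiv 2 ℂ ((TwoQubit ⊗[ℂ] L) × Gᗮ)).toLinearMap
  have hW₀ : ∀ z, W₀ z = S z.fst + (z.snd : H) := fun z => rfl
  have horth : ∀ t (h : Gᗮ), inner ℂ (S t) (h : H) = 0 := fun t h =>
    Submodule.inner_right_of_mem_orthogonal (LinearMap.mem_range_self _ t) h.2
  have horth' : ∀ t (h : Gᗮ), inner ℂ (h : H) (S t) = 0 := fun t h =>
    Submodule.inner_left_of_mem_orthogonal (LinearMap.mem_range_self _ t) h.2
  have hW₁ : ∀ z z', inner ℂ (W₀ z) (W₀ z') = inner ℂ z z' := fun z z' => by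
    rw [hW₀, hW₀, inner_add_left, inner_add_right, inner_add_right, horth, horth',
      inner_spreadLin hc hι, WithLp.prod_inner_apply, add_zero, zero_add]
    rfl
  have hsurj : Function.Surjective (W₀.isometryOfInner hW₁) := by
    intro u
    obtain ⟨t, ht⟩ := (G.orthogonalProjectionOnto u).2
    refine ⟨WithLp.toLp 2 (t, ⟨u - G.starProjection u,
      Submodule.sub_starProjection_mem_orthogonal u⟩), ?_⟩
    change S t + (u - G.starProjection u) = u
    rw [ht]
    simp
  let W := LinearIsometryEquiv.ofSurjective (W₀.isometryOfInner hW₁) hsurj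
  have hW : ∀ t h, W (WithLp.toLp 2 (t, h)) = S t + (h : H) := fun t h => rfl
  have hWsymm : ∀ (T : H →L[ℂ] H) (R : TwoQubit ⊗[ℂ] L →ₗ[ℂ] TwoQubit ⊗[ℂ] L) (T₀ : Gᗮ → Gᗮ),
      (∀ v φ, T (S (v ⊗ₜ φ)) = S (R (v ⊗ₜ φ))) →
      (∀ h : Gᗮ, T h = T₀ h) → ∀ φ, W.symm (T φ) =
        WithLp.toLp 2 (R (W.symm φ).fst, T₀ (W.symm φ).snd) := by
    intro T R T₀ hR hT₀ φ
    obtain ⟨⟨t, h⟩, rfl⟩ := W.surjective φ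
    rw [LinearIsometryEquiv.symm_apply_apply, LinearIsometryEquiv.symm_apply_eq, hW, hW, map_add,
      hT₀]
    congr 1
    change T (S t) = S (R t)
    induction t with
    | zero => simp
    | add x y hx hy => simp only [map_add, hx, hy]
    | tmul v φ => exact hR v φ
  -- observables
  have hobs : ∀ (T : H →L[ℂ] H) (R : TwoQubit →L[ℂ] TwoQubit), IsSelfAdjoint T →
      (∀ v φ, T (spread (M.opP α γ) (M.opQ α γ) v (ι φ)) =
        spread (M.opP α γ) (M.opQ α γ) (R v) (ι φ)) →
      ∃ T₀ : Gᗮ →L[ℂ] Gᗮ, ∀ φ, W.symm (T φ) = WithLp.toLp 2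
        (TensorProduct.map (R : TwoQubit →ₗ[ℂ] TwoQubit) LinearMap.id (W.symm φ).fst,
          T₀ (W.symm φ).snd) := by
    intro T R hT hTR
    have hTG : ∀ t, T (S t) ∈ G := by
      intro t
      induction t with
      | zero => simp
      | add x y hx hy => rw [map_add, map_add]; exact add_mem hx hy
      | tmul v φ => exact ⟨R v ⊗ₜ φ, (hTR v φ).symm⟩
    have hT₀ : ∀ h ∈ Gᗮ, T h ∈ Gᗮ := by
      intro h hh
      rw [Submodule.mem_orthogonal]
      rintro _ ⟨t, rfl⟩
      rw [← inner_left_eq_of_isSelfAdjoint hT]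
      exact Submodule.inner_right_of_mem_orthogonal (hTG t) hh
    exact ⟨(T ∘L Gᗮ.subtypeL).codRestrict Gᗮ fun h => hT₀ h h.2,
      hWsymm T _ _ (fun v φ => hTR v φ) fun h => rfl⟩
  choose A₀ hA₀ using fun i => hobs (M.A i) ((explicitModel α β γ).A i) (hM.selfAdjoint_A i)
    fun v φ => hM.A_spread hsA (hι φ) i v
  choose B₀ hB₀ using fun j => hobs (M.B j) ((explicitModel α β γ).B j) (hM.selfAdjoint_B j)
    fun v φ => hM.B_spread hsB (hι φ) j v
  -- the state
  have hσ : IsDensityOperator (T ∘L ContinuousLinearMap.adjoint T) := by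
    refine ⟨ContinuousLinearMap.isPositive_self_comp_adjoint T, ?_⟩
    have h1 := hasSum_norm_sq_adjoint (traceBasis H) (traceBasis L) T <| by
      simpa only [← hιT, ι.norm_map] using hM.density.hasSum_norm_sq
    have h2 : ∀ f : L, inner ℂ f ((T ∘L ContinuousLinearMap.adjoint T) f) =
        ((‖ContinuousLinearMap.adjoint T f‖ ^ 2 : ℝ) : ℂ) := fun f => by
      rw [ContinuousLinearMap.comp_apply, ← ContinuousLinearMap.adjoint_inner_left,
        inner_self_eq_norm_sq_to_K]
      simp
    rw [opTrace_eq]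
    simp only [h2]
    rw [← Complex.ofReal_tsum, h1.tsum_eq, Complex.ofReal_one]
  refine ⟨L, inferInstance, inferInstance, inferInstance, inferInstance, Gᗮ, inferInstance,
    inferInstance, inferInstance, inferInstance, T ∘L ContinuousLinearMap.adjoint T, A₀, B₀,
    W.symm, hσ, ?_, hA₀, hB₀⟩
  -- The range of `ρ` consists of vectors `singlet ⊗ φ`. Pairing with `ρ x` therefore gives the
  -- factor `⟨singlet, v⟩` and annihilates the complement of `G`; on the second factor, `T T*` is
  -- the compression of `ρ` to `L`.
  refine hWsymm M.ρ _ (fun _ => 0) (fun v φ => ?_) fun h => ?_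
  · refine ext_inner_left ℂ fun x => ?_
    rw [← inner_left_eq_of_isSelfAdjoint hρsa, TensorProduct.map_tmul, spreadLin_tmul, ← hρι]
    conv_lhs => rw [← spread_singlet (M.opP α γ) (M.opQ α γ) (ι (T (sqrtOp M.ρ x)))]
    rw [inner_spread hc (hι _) (hι φ), hρι, inner_left_eq_of_isSelfAdjoint hρsa]
    have h1 : (explicitModel α β γ).ρ v = inner ℂ singlet v • singlet := rfl
    change _ = inner ℂ x (spread (M.opP α γ) (M.opQ α γ) ((explicitModel α β γ).ρ v)
      (ι (T (ContinuousLinearMap.adjoint T φ))))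
    rw [h1, spread_smul, smul_apply, spread_singlet, inner_smul_right, hT, hρι]
  · refine ext_inner_left ℂ fun x => ?_
    rw [← inner_left_eq_of_isSelfAdjoint hρsa, ← hρι]
    simpa using Submodule.inner_right_of_mem_orthogonal (hNG _) h.2

theorem Quintuple.IsModel.hasCanonicalForm [TopologicalSpace.SeparableSpace H] {M : Quintuple H}
    (hM : M.IsModel) {α β γ : ℝ} (hsA : Real.sin (α + γ) ≠ 0) (hsB : Real.sin (α + β) ≠ 0)
    (hN : ∀ ψ, sqrtOp M.ρ ψ ∈ M.singletSpace α β γ) :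
    M.HasCanonicalForm (explicitModel α β γ) := by
  have : SecondCountableTopology H := UniformSpace.secondCountable_of_separable H
  have : CompleteSpace (M.singletSpace α β γ) :=
    (M.isClosed_singletSpace α β γ).completeSpace_coe
  exact hM.hasCanonicalForm_of_isometry hsA hsB (M.singletSpace α β γ).subtypeₗᵢ
    (fun φ => φ.2) fun ψ => ⟨⟨_, hN ψ⟩, rfl⟩

end CanonicalForm

/-! ### Consequences: cyclic models, extensions, extremality. -/

section Equivalences

theorem explicitModel_eq_pureQuintuple (α β γ : ℝ) : explicitModel α β γ =
    pureQuintuple singlet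
      (fun i => realOp (leftMat (Real.cos (![α, -γ] i)) (Real.sin (![α, -γ] i))))
      (fun j => realOp (rightMat (Real.cos (![Real.pi, α + β + Real.pi] j))
        (Real.sin (![Real.pi, α + β + Real.pi] j)))) := by
  unfold explicitModel pureQuintuple
  congr 1 <;> funext i <;> fin_cases i <;> rfl

/-- The explicit model of a correlation has vanishing marginals. -/
theorem IsAngleParam.isModelForBehavior {c : Correlation} {α β γ : ℝ} (h : IsAngleParam c α β γ) :
    (explicitModel α β γ).IsModelForBehavior (0, 0, c) := by
  obtain ⟨h00, h01, h10, δ, h11, k, hk⟩ := h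
  rw [explicitModel_eq_pureQuintuple]
  refine IsPureModel.isModelForBehavior
    (isPureModel_twoQubit (a := fun i => ![Real.cos (![α, -γ] i), Real.sin (![α, -γ] i)])
      (b := fun j => ![Real.cos (![Real.pi, α + β + Real.pi] j),
        Real.sin (![Real.pi, α + β + Real.pi] j)])
      (fun i => (Real.cos_sq_add_sin_sq _).le) (fun j => (Real.cos_sq_add_sin_sq _).le))
    (fun i => ?_) (fun j => ?_) fun i j => ?_
  · simp [inner_singlet_left]
  · simp [inner_singlet_right]
  · rw [inner_singlet_left_right, Complex.ofReal_inj]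
    change -(Real.cos (![α, -γ] i) * Real.cos (![Real.pi, α + β + Real.pi] j) +
      Real.sin (![α, -γ] i) * Real.sin (![Real.pi, α + β + Real.pi] j)) = c i j
    rw [← Real.cos_sub]
    fin_cases i <;> fin_cases j
    · simp [h00, Real.cos_sub_pi]
    · simp only [Fin.zero_eta, Fin.mk_one, Matrix.cons_val_zero, Matrix.cons_val_one, h01]
      rw [show α - (α + β + Real.pi) = -(β + Real.pi) by ring, Real.cos_neg, Real.cos_add_pi,
        neg_neg]
    · simp only [Fin.zero_eta, Fin.mk_one, Matrix.cons_val_zero, Matrix.cons_val_one, h10]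
      rw [show -γ - Real.pi = -(γ + Real.pi) by ring, Real.cos_neg, Real.cos_add_pi, neg_neg]
    · simp only [Fin.mk_one, Matrix.cons_val_one, Matrix.cons_val_fin_one, h11]
      rw [show -γ - (α + β + Real.pi) = δ - Real.pi - k * (2 * Real.pi) by linarith,
        Real.cos_sub_int_mul_two_pi, Real.cos_sub_pi, neg_neg]

theorem IsAngleParam.isModelFor {c : Correlation} {α β γ : ℝ} (h : IsAngleParam c α β γ) :
    (explicitModel α β γ).IsModelFor c :=
  ⟨h.isModelForBehavior.1, h.isModelForBehavior.2.2.2⟩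

theorem IsAngleParam.isExtension {c : Correlation} {α β γ : ℝ} (h : IsAngleParam c α β γ) :
    IsExtension (0, 0, c) c :=
  ⟨⟨_, _, _, inferInstance, inferInstance, _, h.isModelForBehavior⟩, rfl⟩

theorem everyModelIsCanonical_of_not_hasDeterministicPart {c : Correlation}
    (hq : c ∈ quantumSet) (hc : ¬ HasDeterministicPart c) : EveryModelIsCanonical c :=
  ⟨exists_isAngleParam hq hc, fun _ _ _ h _ _ _ _ _ _ hM =>
    hM.1.hasCanonicalForm (h.sin_ne_zero hc).1 (h.sin_ne_zero hc).2 (hM.isSingletVector hc h)⟩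

section Cyclic

variable {H K : Type} [NormedAddCommGroup H] [InnerProductSpace ℂ H]
  [NormedAddCommGroup K] [InnerProductSpace ℂ K]

theorem Quintuple.spread_mem_alg (M : Quintuple H) (α γ : ℝ) (v : TwoQubit) :
    spread (M.opP α γ) (M.opQ α γ) v ∈ M.alg := by
  have hA : ∀ i, M.A i ∈ M.alg := fun i =>
    Subalgebra.le_topologicalClosure _ (Algebra.subset_adjoin (Or.inl ⟨i, rfl⟩))
  have hP : M.opP α γ ∈ M.alg :=
    M.alg.smul_mem (M.alg.add_mem (M.alg.smul_mem (hA 0) _) (M.alg.smul_mem (hA 1) _)) _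
  have hQ : M.opQ α γ ∈ M.alg :=
    M.alg.smul_mem (M.alg.sub_mem (M.alg.smul_mem (hA 0) _) (M.alg.smul_mem (hA 1) _)) _
  exact M.alg.smul_mem (M.alg.sub_mem (M.alg.add_mem (M.alg.add_mem
    (M.alg.smul_mem M.alg.one_mem _) (M.alg.smul_mem hP _)) (M.alg.smul_mem hQ _))
    (M.alg.smul_mem (M.alg.mul_mem hP hQ) _)) _

/-- The isometry `ℂ⁴ → H` induced by `spread` and a singlet unit vector. -/
def spreadIsometry [CompleteSpace H] {P Q P' Q' : H →L[ℂ] H} (hc : IsCommutingPairs P Q P' Q')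
    {Ψ : H} (hΨ : IsSingletVector P Q P' Q' Ψ) (hn : ‖Ψ‖ = 1) : TwoQubit →ₗᵢ[ℂ] H :=
  LinearMap.isometryOfInner
    { toFun := fun v => spread P Q v Ψ
      map_add' := fun v w => by rw [spread_add]; rfl
      map_smul' := fun z v => by rw [spread_smul]; rfl }
    fun v w => by
      change inner ℂ (spread P Q v Ψ) (spread P Q w Ψ) = _
      rw [inner_spread hc hΨ hΨ, inner_self_eq_norm_sq_to_K, hn]
      simp

theorem mem_of_rankOne_eq [CompleteSpace H] {M : Quintuple H} {N : Submodule ℂ H}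
    (hM : M.IsModel) (hN : ∀ ψ, sqrtOp M.ρ ψ ∈ N) {Ψ : H} (hn : ‖Ψ‖ = 1)
    (hρ : M.ρ = InnerProductSpace.rankOne ℂ Ψ Ψ) : Ψ ∈ N := by
  have h1 : M.ρ Ψ = Ψ := by
    rw [hρ, InnerProductSpace.rankOne_apply, inner_self_eq_norm_sq_to_K, hn]
    simp
  rw [← h1, ← sqrtOp_sqrtOp hM.density.1]
  exact hN _

/-- Rigidity applies to the explicit model itself. The resulting isometry of `ℂ⁴` into `ℂ⁴` is onto
by dimension, and its values are algebra elements applied to the singlet. -/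
theorem IsAngleParam.isCyclic {c : Correlation} {α β γ : ℝ} (h : IsAngleParam c α β γ)
    (hc : ¬ HasDeterministicPart c) : (explicitModel α β γ).IsCyclic := by
  have hM := h.isModelFor
  have hN := mem_of_rankOne_eq (N := (explicitModel α β γ).singletSpace α β γ) hM.1
    (hM.isSingletVector hc h) norm_singlet rfl
  let W := spreadIsometry (hM.1.isCommutingPairs α β γ) hN norm_singlet
  have hW : Function.Surjective W :=
    LinearMap.injective_iff_surjective.mp W.injective
  refine ⟨singlet, norm_singlet, rfl, ?_⟩
  convert dense_univ
  refine Set.eq_univ_of_forall fun φ => ?_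
  obtain ⟨v, rfl⟩ := hW φ
  exact ⟨_, Quintuple.spread_mem_alg _ α γ v, rfl⟩

theorem Quintuple.IsModelFor.unitarilyEquivalent_explicitModel [CompleteSpace H] {M : Quintuple H}
    {c : Correlation} (hM : M.IsModelFor c) (hcyc : M.IsCyclic) (hc : ¬ HasDeterministicPart c)
    {α β γ : ℝ} (h : IsAngleParam c α β γ) : M.UnitarilyEquivalent (explicitModel α β γ) := by
  obtain ⟨hsA, hsB⟩ := h.sin_ne_zero hc
  obtain ⟨Ψ, hn, hρ, hd⟩ := hcyc
  have hN := mem_of_rankOne_eq (N := M.singletSpace α β γ) hM.1 (hM.isSingletVector hc h) hn hρ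
  have hpair := hM.1.isCommutingPairs α β γ
  let W := spreadIsometry hpair hN hn
  have hW : ∀ v, W v = spread (M.opP α γ) (M.opQ α γ) v Ψ := fun v => rfl
  have hcl : IsClosed ((LinearMap.range W.toLinearMap : Submodule ℂ H) : Set H) :=
    Submodule.closed_of_finiteDimensional _
  have hsurj : Function.Surjective W := by
    intro φ
    have : φ ∈ closure {φ : H | ∃ X ∈ M.alg, X Ψ = φ} := hd φ
    -- The four-dimensional range of `W` is closed, contains `Ψ` and is invariant under the
    -- observables, so cyclicity makes it the whole space.
    refine closure_minimal ?_ hcl this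
    rintro _ ⟨X, hX, rfl⟩
    refine Quintuple.apply_mem_of_mem_alg hcl ?_ ?_ hX ⟨singlet, spread_singlet _ _ _⟩
    · rintro i _ ⟨v, rfl⟩
      exact ⟨_, (hM.1.A_spread hsA hN i v).symm⟩
    · rintro j _ ⟨v, rfl⟩
      exact ⟨_, (hM.1.B_spread hsB hN j v).symm⟩
  let U := LinearIsometryEquiv.ofSurjective W hsurj
  have hU : ∀ v, U v = spread (M.opP α γ) (M.opQ α γ) v Ψ := fun v => rfl
  have key : ∀ (S : H →L[ℂ] H) (R : TwoQubit →L[ℂ] TwoQubit), (∀ v, S (U v) = U (R v)) →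
      ∀ φ, U.symm (S φ) = R (U.symm φ) := fun S R hSR φ => by
    rw [LinearIsometryEquiv.symm_apply_eq, ← hSR, LinearIsometryEquiv.apply_symm_apply]
  refine ⟨U.symm, key _ _ fun v => ?_, fun i => key _ _ fun v => hM.1.A_spread hsA hN i v,
    fun j => key _ _ fun v => hM.1.B_spread hsB hN j v⟩
  have h1 : U singlet = Ψ := spread_singlet _ _ _
  have h2 : (explicitModel α β γ).ρ v = inner ℂ singlet v • singlet := rfl
  rw [h2, map_smul, h1, hρ, InnerProductSpace.rankOne_apply]
  conv_lhs => rw [← h1, U.inner_map_map, h1]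

theorem Quintuple.UnitarilyEquivalent.symm {M : Quintuple H} {N : Quintuple K}
    (h : M.UnitarilyEquivalent N) : N.UnitarilyEquivalent M := by
  obtain ⟨U, h1, h2, h3⟩ := h
  refine ⟨U.symm, fun φ => ?_, fun i φ => ?_, fun j φ => ?_⟩ <;>
    rw [LinearIsometryEquiv.symm_apply_eq] <;> simp [h1, h2, h3]

theorem Quintuple.UnitarilyEquivalent.trans {L : Type} [NormedAddCommGroup L]
    [InnerProductSpace ℂ L] {M : Quintuple H} {N : Quintuple K} {R : Quintuple L}
    (h : M.UnitarilyEquivalent N) (h' : N.UnitarilyEquivalent R) : M.UnitarilyEquivalent R := by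
  obtain ⟨U, h1, h2, h3⟩ := h
  obtain ⟨V, h4, h5, h6⟩ := h'
  exact ⟨U.trans V, by simp [h1, h4], by simp [h2, h5], by simp [h3, h6]⟩

theorem ExplicitModelIsUniqueCyclic.hasUniqueCyclicModel {c : Correlation}
    (h : ExplicitModelIsUniqueCyclic c) : HasUniqueCyclicModel c := by
  obtain ⟨⟨α, β, γ, hang⟩, h⟩ := h
  obtain ⟨hm, hcyc, hu⟩ := h α β γ hang
  exact ⟨⟨_, _, _, inferInstance, inferInstance, _, hm, hcyc⟩,
    fun H _ _ _ _ K _ _ _ _ M N hM hM' hN hN' => (hu H M hM hM').trans (hu K N hN hN').symm⟩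

theorem explicitModelIsUniqueCyclic_of_not_hasDeterministicPart {c : Correlation}
    (hq : c ∈ quantumSet) (hc : ¬ HasDeterministicPart c) : ExplicitModelIsUniqueCyclic c :=
  ⟨exists_isAngleParam hq hc, fun _ _ _ h => ⟨h.isModelFor, h.isCyclic hc,
    fun _ _ _ _ _ _ hM hcyc => hM.unitarilyEquivalent_explicitModel hcyc hc h⟩⟩

end Cyclic

section Extensions

variable {H K : Type} [NormedAddCommGroup H] [InnerProductSpace ℂ H] [CompleteSpace H]
  [NormedAddCommGroup K] [InnerProductSpace ℂ K]

/-- Expectation values that vanish in a model also vanish in its expansions. -/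
theorem IsDensityOperator.opTrace_mul_eq_zero_of_expansion {L H₀ : Type} [NormedAddCommGroup L]
    [InnerProductSpace ℂ L] [NormedAddCommGroup H₀] [InnerProductSpace ℂ H₀]
    {ρ X : H →L[ℂ] H} (hρ : IsDensityOperator ρ) {ρ' X' : K →L[ℂ] K} {σ : L →L[ℂ] L}
    {X₀ : H₀ →L[ℂ] H₀} {U : H ≃ₗᵢ[ℂ] WithLp 2 ((K ⊗[ℂ] L) × H₀)}
    (hU : ∀ φ, U (ρ φ) = WithLp.toLp 2
      (TensorProduct.map (ρ' : K →ₗ[ℂ] K) (σ : L →ₗ[ℂ] L) (U φ).fst, 0))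
    (hX : ∀ φ, U (X φ) = WithLp.toLp 2
      (TensorProduct.map (X' : K →ₗ[ℂ] K) LinearMap.id (U φ).fst, X₀ (U φ).snd))
    (h : ∀ v, ρ' (X' (ρ' v)) = 0) : opTrace (ρ * X) = 0 := by
  refine hρ.opTrace_mul_eq_zero fun φ => ?_
  apply U.injective
  rw [hU, hX, hU, map_zero]
  have key : ∀ t : K ⊗[ℂ] L, TensorProduct.map (ρ' : K →ₗ[ℂ] K) (σ : L →ₗ[ℂ] L)
      (TensorProduct.map (X' : K →ₗ[ℂ] K) LinearMap.id
        (TensorProduct.map (ρ' : K →ₗ[ℂ] K) (σ : L →ₗ[ℂ] L) t)) = 0 := by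
    intro t
    induction t with
    | zero => simp
    | add x y hx hy => simp only [map_add, hx, hy, add_zero]
    | tmul v w => simp [h]
  exact congrArg (WithLp.toLp 2) (Prod.ext (key _) rfl)

/-- Single-party observables have expectation zero in the singlet, and the canonical form transfers
this to every model. -/
theorem EveryModelIsCanonical.eq_of_isExtension {c : Correlation} (h : EveryModelIsCanonical c)
    {p : Behavior} (hp : IsExtension p c) : p = (0, 0, c) := by
  obtain ⟨⟨α, β, γ, hang⟩, h⟩ := h
  obtain ⟨⟨H, _, _, _, _, M, hM, ha, hb, hab⟩, rfl⟩ := hp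
  obtain ⟨L, _, _, _, _, H₀, _, _, _, _, σ, A₀, B₀, U, -, hρ, hA, hB⟩ :=
    h α β γ hang H M ⟨hM, hab⟩
  have hzero : ∀ T : TwoQubit →L[ℂ] TwoQubit, inner ℂ singlet (T singlet) = 0 → ∀ v,
      (explicitModel α β γ).ρ (T ((explicitModel α β γ).ρ v)) = 0 := fun T hT v => by
    simp [explicitModel, InnerProductSpace.rankOne_apply, hT]
  rw [explicitModel_eq_pureQuintuple] at hA hB
  refine Prod.ext (funext fun i => ?_) (Prod.ext (funext fun j => ?_) rfl)
  · have := hM.density.opTrace_mul_eq_zero_of_expansion hρ (hA i)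
      (hzero _ (inner_singlet_left _ _))
    exact Complex.ofReal_injective ((ha i).symm.trans this)
  · have := hM.density.opTrace_mul_eq_zero_of_expansion hρ (hB j)
      (hzero _ (inner_singlet_right _ _))
    exact Complex.ofReal_injective ((hb j).symm.trans this)

theorem EveryModelIsCanonical.isExtension_iff {c : Correlation} (h : EveryModelIsCanonical c)
    (q : Behavior) : IsExtension q c ↔ q = (0, 0, c) := by
  refine ⟨h.eq_of_isExtension, ?_⟩
  rintro rfl
  obtain ⟨⟨α, β, γ, hang⟩, -⟩ := h
  exact hang.isExtension

theorem correlation_mem_quantumSet {p : Behavior} (hp : p ∈ behaviorSet) : p.2.2 ∈ quantumSet := by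
  obtain ⟨H, _, _, _, _, M, hM⟩ := hp
  exact ⟨H, _, _, inferInstance, inferInstance, M, hM.1, hM.2.2.2⟩

/-- Projecting a segment through `p` to its correlations gives a segment through the extreme point
`c`; its end is thus another extension of `c`. -/
theorem mem_extremePoints_behaviorSet {c : Correlation}
    (hc : c ∈ Set.extremePoints ℝ quantumSet) {p : Behavior}
    (hp : ∀ q, IsExtension q c ↔ q = p) : p ∈ Set.extremePoints ℝ behaviorSet := by
  obtain ⟨hpb, hpc⟩ := (hp p).mpr rfl
  refine ⟨hpb, fun q hq r hr hseg => (hp q).mp ⟨hq, ?_⟩⟩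
  refine hc.2 (correlation_mem_quantumSet hq) (correlation_mem_quantumSet hr) ?_
  obtain ⟨a, b, ha, hb, hab, rfl⟩ := hseg
  exact ⟨a, b, ha, hb, hab, hpc⟩

end Extensions

end Equivalences

end

end QuantumCorrelation

theorem mainTheorem4 (c : QuantumCorrelation.Correlation)
    (hc : c ∈ QuantumCorrelation.quantumSet) :
    List.TFAE
      [ -- (1)
        c ∉ QuantumCorrelation.classicalSet ∧
          c ∈ Set.extremePoints ℝ QuantumCorrelation.quantumSet,
        -- (2)
        QuantumCorrelation.HasUniqueCyclicModel c,
        -- (2, explicit)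
        QuantumCorrelation.ExplicitModelIsUniqueCyclic c,
        -- (3)
        QuantumCorrelation.EveryModelIsCanonical c,
        -- (4)
        ∃! p : QuantumCorrelation.Behavior, QuantumCorrelation.IsExtension p c,
        -- (5)
        ∃ p : QuantumCorrelation.Behavior,
          (∀ q, QuantumCorrelation.IsExtension q c ↔ q = p) ∧
          QuantumCorrelation.IsCryptographicallySecure p,
        -- (5, for all extensions)
        ∀ p : QuantumCorrelation.Behavior, QuantumCorrelation.IsExtension p c →
          QuantumCorrelation.IsCryptographicallySecure p,
        -- (6)
        QuantumCorrelation.IsAlgebraicallySecure c ] ∧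
    -- the extension in (4) is necessarily extreme
    ∀ p : QuantumCorrelation.Behavior,
      (∀ q, QuantumCorrelation.IsExtension q c ↔ q = p) →
      p ∈ Set.extremePoints ℝ QuantumCorrelation.behaviorSet := by
  open QuantumCorrelation in
  have hiff := extreme_nonclassical_iff hc
  have hcan := everyModelIsCanonical_of_not_hasDeterministicPart hc
  constructor
  -- Implications out of (1) use rigidity; those back to (1) exclude a deterministic part by the
  -- mixture models.
  · tfae_have 1 → 3 := fun h =>
      explicitModelIsUniqueCyclic_of_not_hasDeterministicPart hc (hiff.mp h)
    tfae_have 3 → 2 := fun h => h.hasUniqueCyclicModel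
    tfae_have 2 → 1 := fun h => hiff.mpr fun hP => hP.not_hasUniqueCyclicModel h
    tfae_have 1 → 4 := fun h => hcan (hiff.mp h)
    tfae_have 4 → 5 := fun h =>
      ⟨_, (h.isExtension_iff _).mpr rfl, fun q hq => h.eq_of_isExtension hq⟩
    tfae_have 5 → 1 := fun ⟨p, _, hp⟩ => hiff.mpr fun hP => hP.not_unique_extension p hp
    tfae_have 1 → 8 := fun h => isAlgebraicallySecure_of_not_hasDeterministicPart hc (hiff.mp h)
    tfae_have 8 → 7 := fun h p hp => h.isCryptographicallySecure hp.2
    tfae_have 7 → 1 := fun h => hiff.mpr fun hP => hP.not_secure h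
    tfae_have 1 → 6 := fun h => ⟨_, (hcan (hiff.mp h)).isExtension_iff,
      (isAlgebraicallySecure_of_not_hasDeterministicPart hc
        (hiff.mp h)).isCryptographicallySecure rfl⟩
    tfae_have 6 → 5 := fun ⟨p, hp, _⟩ => ⟨p, (hp p).mpr rfl, fun q hq => (hp q).mp hq⟩
    tfae_finish
  · intro p hp
    have hP : ¬ HasDeterministicPart c := fun hP =>
      hP.not_unique_extension p fun q hq => (hp q).mp hq
    exact mem_extremePoints_behaviorSet (hiff.mpr hP).2 hp
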